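/- Conventions. Let $A=\mathbb Z[X]/(X^2)$, graded by $\deg 1=-1$, $\deg X=1$, with the Frobenius structure $\Delta(1)=1\otimes X+X\otimes 1$, $\Delta(X)=X\otimes X$, $\mathrm{tr}(1)=0$, $\mathrm{tr}(X)=1$, and let $\mathcal F$ be the associated two-dimensional TQFT, so that $\mathcal F$ of $r$ disjoint circles is $A^{\otimes r}$. For a graded module $M$ let $M\{j\}$ be $M$ with the grading raised by $j$, i.e. $(M\{j\})_d=M_{d-j}$. For a finite ordered set $P$ of $2m$ points on a line let $B_P$ be the set of crossingless matchings of $P$, and for $b\in B_P$ let $W(b)$ be its mirror image. The arc ring of $P$ is $H_P=\bigoplus_{a,b\in B_P}\mathcal F(W(b)a)\{m\}$, with the multiplication $\mathcal F(W(c)b)\otimes \mathcal F(W(b)a)\to\mathcal F(W(c)a)$ induced by the minimal (saddle) cobordism $bW(b)\to \mathrm{Id}$; products of non-matching components are zero. For a flat (crossingless) tangle $T$ with set $P$ of bottom end points and set $Q$ of top end points ($|P|=2m$) let $\mathcal F(T)=\bigoplus_{b\in B_Q,\,a\in B_P}\mathcal F(W(b)Ta)\{m\}$, a graded $(H_Q,H_P)$-bimodule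 by the same minimal cobordisms. Fix integers $n$, $k$ with $1\le k\le n-1$ and $i$ with $1\le i\le n-1$. A weight is a sequence $\lambda=(\lambda_1,\dots,\lambda_n)$ of integers with $0\le\lambda_j\le 2$ and $\lambda_1+\dots+\lambda_n=2k$. Let $P(\lambda)=\{j:\lambda_j=1\}$, let $\mathcal C(\lambda)$ be the category of finitely generated graded left $H_{P(\lambda)}$-modules and grading-preserving homomorphisms, and let $\mathcal C=\bigoplus_\lambda\mathcal C(\lambda)$ over all weights. Let $\alpha_i=(0,\dots,0,1,-1,0,\dots,0)$ with $1$ in position $i$. For weights $\lambda,\mu$ with $\mu=\lambda\pm\alpha_i$ let $T_{\lambda,\mu}$ be the flat tangle with bottom end points $P(\lambda)$ and top end points $P(\mu)$ in which each $j\in P(\lambda)\setminus\{i,i+1\}=P(\mu)\setminus\{i,i+1\}$ at the bottom is joined to $j$ at the top, and the remaining two end points, one at position $i$ and one at position $i+1$, are joined to each other (so that $T_{\lambda,\mu}$ shifts one strand by one position, or is a cup, or is a cap). Define endofunctors of $\mathcal C$ as follows. On $\mathcal C(\lambda)$: * $\mathcal E_i$ is $\mathcal F(T_{\lambda,\lambda+\alpha_i})\otimes_{H_{P(\lambda)}}-:\mathcal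 C(\lambda)\to\mathcal C(\lambda+\alpha_i)$ if $\lambda+\alpha_i$ is a weight, and $0$ otherwise; * $\mathcal F_i$ is $\mathcal F(T_{\lambda,\lambda-\alpha_i})\otimes_{H_{P(\lambda)}}-:\mathcal C(\lambda)\to\mathcal C(\lambda-\alpha_i)$ if $\lambda-\alpha_i$ is a weight, and $0$ otherwise; * $\mathcal K_i$ is the shift $\{\lambda_i-\lambda_{i+1}\}$ and $\mathcal K_i^{-1}$ is the shift $\{\lambda_{i+1}-\lambda_i\}$. Proposition. The functor $\mathcal E_i$ is left adjoint to $\mathcal F_i\mathcal K_i^{-1}\{1\}$, the functor $\mathcal F_i$ is left adjoint to $\mathcal E_i\mathcal K_i\{1\}$, and $\mathcal K_i$ is left adjoint to $\mathcal K_i^{-1}$ (as endofunctors of $\mathcal C$). -/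

import Mathlib

set_option linter.unusedSectionVars false

namespace ArcAlgebra

/-- Two vertices of a closed diagram with edge relation `R` lie on the same circle. -/
def SameCircle {V : Type} (R : V → V → Prop) (x y : V) : Prop := Quot.mk R x = Quot.mk R y

theorem SameCircle.map {V W : Type} {R : V → V → Prop} {R' : W → W → Prop} (f : V → W)
    (h : ∀ x y, R x y → SameCircle R' (f x) (f y)) {x y : V} (hxy : SameCircle R x y) :
    SameCircle R' (f x) (f y) :=
  congrArg (Quot.lift (fun x => Quot.mk R' (f x)) h) hxy

theorem SameCircle.lift {V α : Type} {R : V → V → Prop} (f : V → α)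
    (h : ∀ x y, R x y → f x = f y) {x y : V} (hxy : SameCircle R x y) : f x = f y :=
  congrArg (Quot.lift f h) hxy

theorem SameCircle.of {V : Type} {R : V → V → Prop} {x y : V} (h : R x y) : SameCircle R x y :=
  Quot.sound h

theorem SameCircle.symm {V : Type} {R : V → V → Prop} {x y : V} (h : SameCircle R x y) :
    SameCircle R y x := Eq.symm h

theorem SameCircle.trans {V : Type} {R : V → V → Prop} {x y z : V} (h : SameCircle R x y)
    (h' : SameCircle R y z) : SameCircle R x z := Eq.trans h h'

theorem SameCircle.rfl {V : Type} {R : V → V → Prop} {x : V} : SameCircle R x x := Eq.refl _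

/-- Walking along a component of a graph whose edges form two involutions `o` and `w`: a component
contains at most two ends, that is, fixed points of `w`. -/
theorem ends_le_two {V : Type} [Fintype V] (o w : V → V) (ho : ∀ x, o (o x) = x)
    (hw : ∀ x, w (w x) = x) {a b c : V} (ha : w a = a) (hb : w b = b) (hc : w c = c)
    (hab : SameCircle (fun x y => y = o x ∨ y = w x) a b)
    (hac : SameCircle (fun x y => y = o x ∨ y = w x) a c) : a = b ∨ a = c ∨ b = c := by
  classical
  let O : Equiv.Perm V := Function.Involutive.toPerm o ho
  let W : Equiv.Perm V := Function.Involutive.toPerm w hw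
  let g : Equiv.Perm V := W * O
  have hOx : ∀ x, O x = o x := fun _ => rfl
  have hWx : ∀ x, W x = w x := fun _ => rfl
  have hOO : O * O = 1 := by ext x; simp only [Equiv.Perm.mul_apply, hOx, ho, Equiv.Perm.one_apply]
  have hWW : W * W = 1 := by ext x; simp only [Equiv.Perm.mul_apply, hWx, hw, Equiv.Perm.one_apply]
  have hWinv : W⁻¹ = W := inv_eq_of_mul_eq_one_left hWW
  have hOinv : O⁻¹ = O := inv_eq_of_mul_eq_one_left hOO
  have hconj : W * g * W⁻¹ = g⁻¹ := by
    simp only [g, mul_inv_rev, hOinv, hWinv]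
    rw [← mul_assoc, hWW, one_mul]
  have hWg : ∀ z : ℤ, W * g ^ z = g ^ (-z) * W := by
    intro z
    have h := conj_zpow (i := z) (a := W) (b := g)
    rw [hconj] at h
    rw [zpow_neg, ← inv_zpow, h]
    group
  have hWa : ∀ z : ℤ, w ((g ^ z) a) = (g ^ (-z)) a := by
    intro z
    have := congrArg (fun e : Equiv.Perm V => e a) (hWg z)
    simpa only [Equiv.Perm.mul_apply, hWx, ha] using this
  have hOa : ∀ z : ℤ, o ((g ^ z) a) = (g ^ (-z - 1)) a := by
    intro z
    have h1 : O = W * g := by simp only [g]; rw [← mul_assoc, hWW, one_mul]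
    have h2 : O * g ^ z = W * g ^ (z + 1) := by
      rw [h1, mul_assoc, add_comm, zpow_add, zpow_one]
    have := congrArg (fun e : Equiv.Perm V => e a) h2
    have h3 := hWa (z + 1)
    have h4 : (-z - 1 : ℤ) = -(z + 1) := by ring
    rw [h4, ← h3]
    simpa only [Equiv.Perm.mul_apply, hWx, hOx] using this
  have key : ∀ {y}, SameCircle (fun x y => y = o x ∨ y = w x) a y → ∃ z : ℤ, (g ^ z) a = y := by
    intro y hy
    have : (∃ z : ℤ, (g ^ z) a = a) = (∃ z : ℤ, (g ^ z) a = y) := by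
      refine SameCircle.lift (fun y => ∃ z : ℤ, (g ^ z) a = y) ?_ hy
      intro x y hxy
      apply propext
      have hO' : ∀ x, (∃ z : ℤ, (g ^ z) a = x) → (∃ z : ℤ, (g ^ z) a = o x) := by
        rintro x ⟨z, rfl⟩; exact ⟨_, (hOa z).symm⟩
      have hW' : ∀ x, (∃ z : ℤ, (g ^ z) a = x) → (∃ z : ℤ, (g ^ z) a = w x) := by
        rintro x ⟨z, rfl⟩; exact ⟨_, (hWa z).symm⟩
      rcases hxy with rfl | rfl
      · exact ⟨hO' x, fun h => by simpa [ho] using hO' _ h⟩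
      · exact ⟨hW' x, fun h => by simpa [hw] using hW' _ h⟩
    exact this ▸ ⟨0, by simp⟩
  obtain ⟨i, hi⟩ := key hab
  obtain ⟨j, hj⟩ := key hac
  have hper : ∀ z : ℤ, (g ^ z) a = a ↔ (MulAction.period g a : ℤ) ∣ z := by
    intro z
    have := MulAction.zpow_smul_eq_iff_period_dvd (j := z) (g := g) (a := a)
    simpa [Equiv.Perm.smul_def] using this
  have h2 : ∀ z : ℤ, w ((g ^ z) a) = (g ^ z) a → (MulAction.period g a : ℤ) ∣ 2 * z := by
    intro z hz
    rw [hWa] at hz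
    rw [← hper]
    have := congrArg (fun x => (g ^ z) x) hz
    simp only [← Equiv.Perm.mul_apply, ← zpow_add] at this
    rw [two_mul, ← this]; simp
  have hi2 := h2 i (by rw [hi, hb])
  have hj2 := h2 j (by rw [hj, hc])
  by_cases h1 : (MulAction.period g a : ℤ) ∣ i
  · left; rw [← hi]; exact ((hper i).2 h1).symm
  by_cases h1' : (MulAction.period g a : ℤ) ∣ j
  · right; left; rw [← hj]; exact ((hper j).2 h1').symm
  right; right
  have : (MulAction.period g a : ℤ) ∣ i - j := by
    obtain ⟨c, hc⟩ := hi2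
    obtain ⟨d, hd⟩ := hj2
    rcases Int.even_or_odd' c with ⟨c', rfl | rfl⟩
    · exact absurd ⟨c', by linarith⟩ h1
    rcases Int.even_or_odd' d with ⟨d', rfl | rfl⟩
    · exact absurd ⟨d', by linarith⟩ h1'
    exact ⟨c' - d', by linarith⟩
  have h5 := (hper (i - j)).2 this
  rw [← hi, ← hj]
  have h6 : (g ^ i) a = (g ^ j) ((g ^ (i - j)) a) := by
    rw [← Equiv.Perm.mul_apply, ← zpow_add]; congr 2; ring
  rw [h6, h5]

/-- In a bipartite graph whose edges form two involutions `o` and `w`, the fixed points of `w` in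
one component are equally distributed among the two colours. -/
theorem exists_other_end {V : Type} [Fintype V] (o w : V → V) (col : V → Bool)
    (ho : ∀ x, o (o x) = x) (hw : ∀ x, w (w x) = x) (hoc : ∀ x, col (o x) ≠ col x)
    (hwc : ∀ x, w x ≠ x → col (w x) ≠ col x) {a : V} (ha : w a = a) :
    ∃ b, w b = b ∧ col b ≠ col a ∧ SameCircle (fun x y => y = o x ∨ y = w x) a b := by
  classical
  by_contra hcon
  push Not at hcon
  let C : Finset V := Finset.univ.filter (fun y => SameCircle (fun x y => y = o x ∨ y = w x) a y)
  have hCo : ∀ x ∈ C, o x ∈ C := by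
    intro x hx
    simp only [C, Finset.mem_filter, Finset.mem_univ, true_and] at hx ⊢
    exact hx.trans (SameCircle.of (Or.inl rfl))
  have hCw : ∀ x ∈ C, w x ∈ C := by
    intro x hx
    simp only [C, Finset.mem_filter, Finset.mem_univ, true_and] at hx ⊢
    exact hx.trans (SameCircle.of (Or.inr rfl))
  have haC : a ∈ C := by simp only [C, Finset.mem_filter, Finset.mem_univ, true_and]; rfl
  have h1 : (C.filter (fun x => col x = col a)).card = (C.filter (fun x => col x ≠ col a)).card := by
    refine Finset.card_bij' (fun x _ => o x) (fun x _ => o x) ?_ ?_ ?_ ?_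
    · intro x hx
      rw [Finset.mem_filter] at hx ⊢
      exact ⟨hCo x hx.1, by rw [← hx.2]; exact hoc x⟩
    · intro x hx
      rw [Finset.mem_filter] at hx ⊢
      refine ⟨hCo x hx.1, ?_⟩
      have := hoc x
      revert this; have := hx.2; revert this
      cases col x <;> cases col a <;> cases col (o x) <;> simp
    · intro x _; exact ho x
    · intro x _; exact ho x
  have h2 : (C.filter (fun x => col x ≠ col a)).card
      ≤ ((C.filter (fun x => col x = col a)).erase a).card := by
    refine Finset.card_le_card_of_injOn (fun x => w x) ?_ ?_
    · intro x hx
      rw [Finset.mem_coe, Finset.mem_filter] at hx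
      have hxC := hx.1
      simp only [C, Finset.mem_filter, Finset.mem_univ, true_and] at hxC
      have hne : w x ≠ x := fun h => hcon x h hx.2 hxC
      rw [Finset.mem_coe, Finset.mem_erase, Finset.mem_filter]
      refine ⟨?_, hCw x hx.1, ?_⟩
      · intro h
        apply hne
        show w x = x
        have h0 : w x = a := h
        have h' : x = a := by rw [← hw x, h0, ha]
        rw [h', ha]
      · have := hwc x hne
        revert this; have := hx.2; revert this
        cases col x <;> cases col a <;> cases col (w x) <;> simp
    · intro x _ y _ h
      have := congrArg w h
      simpa [hw] using this
  rw [Finset.card_erase_of_mem (by rw [Finset.mem_filter]; exact ⟨haC, rfl⟩), ← h1] at h2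
  have h3 : 0 < (C.filter (fun x => col x = col a)).card :=
    Finset.card_pos.2 ⟨a, by rw [Finset.mem_filter]; exact ⟨haC, rfl⟩⟩
  omega

theorem pairing {V : Type} [Fintype V] (o w : V → V) (col : V → Bool)
    (ho : ∀ x, o (o x) = x) (hw : ∀ x, w (w x) = x) (hoc : ∀ x, col (o x) ≠ col x)
    (hwc : ∀ x, w x ≠ x → col (w x) ≠ col x) (p q p' q' : V)
    (hfix : ∀ x, w x = x ↔ x = p ∨ x = q ∨ x = p' ∨ x = q')
    (cq : col q ≠ col p) (cp' : col p' ≠ col p) (cq' : col q' = col p)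
    (hpq' : p ≠ q') (hqp' : q ≠ p') :
    (SameCircle (fun x y => y = o x ∨ y = w x) p q ∧
      SameCircle (fun x y => y = o x ∨ y = w x) p' q' ∧
      ¬ SameCircle (fun x y => y = o x ∨ y = w x) p p') ∨
    (SameCircle (fun x y => y = o x ∨ y = w x) p p' ∧
      SameCircle (fun x y => y = o x ∨ y = w x) q q' ∧
      ¬ SameCircle (fun x y => y = o x ∨ y = w x) p q) := by
  have fp : w p = p := (hfix p).2 (by simp)
  have fq : w q = q := (hfix q).2 (by simp)
  have fp' : w p' = p' := (hfix p').2 (by simp)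
  have fq' : w q' = q' := (hfix q').2 (by simp)
  have npq : p ≠ q := fun h => cq (by rw [h])
  have npp' : p ≠ p' := fun h => cp' (by rw [h])
  have nqq' : q ≠ q' := fun h => cq (by rw [h, cq'])
  have np'q' : p' ≠ q' := fun h => cp' (by rw [h, cq'])
  obtain ⟨b, fb, cb, hb⟩ := exists_other_end o w col ho hw hoc hwc fp
  rcases (hfix b).1 fb with rfl | rfl | rfl | rfl
  · exact absurd rfl cb
  · have n1 : ¬ SameCircle (fun x y => y = o x ∨ y = w x) p p' := fun h => by
      rcases ends_le_two o w ho hw fp fb fp' hb h with h | h | h <;> contradiction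
    left
    refine ⟨hb, ?_, n1⟩
    obtain ⟨c, fc, cc, hc⟩ := exists_other_end o w col ho hw hoc hwc fp'
    rcases (hfix c).1 fc with rfl | rfl | rfl | rfl
    · exact absurd hc.symm n1
    · exact absurd (hb.trans hc.symm) n1
    · exact absurd rfl cc
    · exact hc
  · have n1 : ¬ SameCircle (fun x y => y = o x ∨ y = w x) p q := fun h => by
      rcases ends_le_two o w ho hw fp fb fq hb h with h | h | h
      · contradiction
      · contradiction
      · exact hqp' h.symm
    right
    refine ⟨hb, ?_, n1⟩
    obtain ⟨c, fc, cc, hc⟩ := exists_other_end o w col ho hw hoc hwc fq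
    rcases (hfix c).1 fc with rfl | rfl | rfl | rfl
    · exact absurd hc.symm n1
    · exact absurd rfl cc
    · exact absurd (hb.trans hc.symm) n1
    · exact hc
  · exact absurd cq' cb

/-- The equivalence relation obtained from `s` by joining the classes of `a` and `b`. -/
def Join {V : Type} (s : V → V → Prop) (a b x y : V) : Prop :=
  s x y ∨ (s x a ∧ s b y) ∨ (s x b ∧ s a y)

theorem SameCircle.join {V : Type} {R R' : V → V → Prop} {a b : V}
    (h : ∀ x y, R x y → Join (SameCircle R') a b x y) {x y : V} (hxy : SameCircle R x y) :
    Join (SameCircle R') a b x y := by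
  have hs : Equivalence (Join (SameCircle R') a b) := by
    refine ⟨fun x => Or.inl rfl, ?_, ?_⟩
    · rintro x y (h | ⟨h1, h2⟩ | ⟨h1, h2⟩)
      · exact Or.inl h.symm
      · exact Or.inr (Or.inr ⟨h2.symm, h1.symm⟩)
      · exact Or.inr (Or.inl ⟨h2.symm, h1.symm⟩)
    · rintro x y z (h | ⟨h1, h2⟩ | ⟨h1, h2⟩) (h' | ⟨h1', h2'⟩ | ⟨h1', h2'⟩)
      · exact Or.inl (h.trans h')
      · exact Or.inr (Or.inl ⟨h.trans h1', h2'⟩)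
      · exact Or.inr (Or.inr ⟨h.trans h1', h2'⟩)
      · exact Or.inr (Or.inl ⟨h1, h2.trans h'⟩)
      · exact Or.inl (h1.trans ((h2.trans h1').symm.trans h2'))
      · exact Or.inl (h1.trans h2')
      · exact Or.inr (Or.inr ⟨h1, h2.trans h'⟩)
      · exact Or.inl (h1.trans h2')
      · exact Or.inl (h1.trans ((h2.trans h1').symm.trans h2'))
  have := SameCircle.lift (R := R) (fun x => Quot.mk (Join (SameCircle R') a b) x)
    (fun x y hxy => Quot.sound (h x y hxy)) hxy
  exact hs.eqvGen_iff.1 (Quot.eqvGen_exact this)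

/-- The end `k` of an arc has been reached by the surgeries along the arcs in `L`. -/
def Surg {K : Type} (β : K → K) (L : List K) (k : K) : Prop := k ∈ L ∨ β k ∈ L

/-- A family of arcs in a bipartite closed diagram, along which surgeries are to be performed. -/
structure SurgerySystem (V K : Type) where
  o : V → V
  e : V → V
  β : K → K
  pt : K → Bool → V
  col : V → Bool
  oo : ∀ x, o (o x) = x
  ββ : ∀ k, β (β k) = k
  ne : ∀ k, β k ≠ k
  inj : ∀ k l k' l', pt k l = pt k' l' → k = k' ∧ l = l'
  ee : ∀ x, (∀ k l, pt k l ≠ x) → (∀ k l, pt k l ≠ e x) ∧ e (e x) = x ∧ col (e x) ≠ col x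
  co : ∀ x, col (o x) ≠ col x
  cβ : ∀ k l, col (pt (β k) l) ≠ col (pt k l)
  cv : ∀ k, col (pt k true) ≠ col (pt k false)

namespace SurgerySystem

variable {V K : Type} (σ : SurgerySystem V K)

/-- The edges after the surgeries along the arcs in `L`. -/
inductive Rel (L : List K) : V → V → Prop
  | o (x : V) : Rel L x (σ.o x)
  | e (x : V) : (∀ k l, σ.pt k l ≠ x) → Rel L x (σ.e x)
  | arc (k : K) (l : Bool) : ¬ Surg σ.β L k → Rel L (σ.pt k l) (σ.pt (σ.β k) l)
  | vert (k : K) : Surg σ.β L k → Rel L (σ.pt k false) (σ.pt k true)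

theorem surg_β (L : List K) (k : K) : Surg σ.β L (σ.β k) ↔ Surg σ.β L k := by
  simp only [Surg, σ.ββ]; exact or_comm

theorem Rel.mono {L L' : List K} (h : ∀ k, Surg σ.β L k ↔ Surg σ.β L' k) (x y : V)
    (hxy : σ.Rel L x y) : σ.Rel L' x y := by
  cases hxy with
  | o => exact .o _
  | e _ h' => exact .e _ h'
  | arc k l h' => exact .arc k l (fun h'' => h' ((h k).2 h''))
  | vert k h' => exact .vert k ((h k).1 h')

theorem rel_swap (k l : K) (L : List K) : σ.Rel (k :: l :: L) = σ.Rel (l :: k :: L) := by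
  have h : ∀ (k l x : K), Surg σ.β (k :: l :: L) x → Surg σ.β (l :: k :: L) x := by
    intro k l x
    simp only [Surg, List.mem_cons]
    tauto
  funext x y
  exact propext ⟨Rel.mono σ (fun x => ⟨h k l x, h l k x⟩) x y,
    Rel.mono σ (fun x => ⟨h l k x, h k l x⟩) x y⟩

theorem SameCircle_le (L : List K) (k : K) {x y : V} (h : SameCircle (σ.Rel L) x y) :
    Join (SameCircle (σ.Rel (k :: L))) (σ.pt k false) (σ.pt (σ.β k) false) x y := by
  refine SameCircle.join ?_ h
  have hv : ∀ j, Surg σ.β (k :: L) j →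
      SameCircle (σ.Rel (k :: L)) (σ.pt j false) (σ.pt j true) :=
    fun j hj => SameCircle.of (.vert j hj)
  have hk : Surg σ.β (k :: L) k := Or.inl (List.mem_cons_self ..)
  have hk' : Surg σ.β (k :: L) (σ.β k) := (σ.surg_β _ _).2 hk
  intro x y hxy
  cases hxy with
  | o => exact Or.inl (SameCircle.of (.o _))
  | e _ h' => exact Or.inl (SameCircle.of (.e _ h'))
  | arc j l h' =>
    by_cases hj : Surg σ.β (k :: L) j
    · have : j = k ∨ σ.β j = k := by
        simp only [Surg, List.mem_cons] at hj h'
        tauto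
      rcases this with rfl | h1
      · cases l
        · exact Or.inr (Or.inl ⟨rfl, rfl⟩)
        · exact Or.inr (Or.inl ⟨(hv _ hk).symm, hv _ hk'⟩)
      · have : j = σ.β k := by rw [← h1, σ.ββ]
        subst this
        rw [σ.ββ]
        cases l
        · exact Or.inr (Or.inr ⟨rfl, rfl⟩)
        · exact Or.inr (Or.inr ⟨(hv _ hk').symm, hv _ hk⟩)
    · exact Or.inl (SameCircle.of (.arc j l hj))
  | vert j h' =>
    exact Or.inl (hv j (h'.imp (List.mem_cons_of_mem _) (List.mem_cons_of_mem _)))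

theorem SameCircle_ge (L : List K) (k : K) (hk : ¬ Surg σ.β L k) {x y : V}
    (h : SameCircle (σ.Rel (k :: L)) x y) :
    Join (SameCircle (σ.Rel L)) (σ.pt k false) (σ.pt k true) x y := by
  refine SameCircle.join ?_ h
  have ha : ∀ l, SameCircle (σ.Rel L) (σ.pt k l) (σ.pt (σ.β k) l) :=
    fun l => SameCircle.of (.arc k l hk)
  intro x y hxy
  cases hxy with
  | o => exact Or.inl (SameCircle.of (.o _))
  | e _ h' => exact Or.inl (SameCircle.of (.e _ h'))
  | arc j l h' =>
    exact Or.inl (SameCircle.of (.arc j l fun h => h'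
      (h.imp (List.mem_cons_of_mem _) (List.mem_cons_of_mem _))))
  | vert j h' =>
    by_cases hj : Surg σ.β L j
    · exact Or.inl (SameCircle.of (.vert j hj))
    · have : j = k ∨ σ.β j = k := by
        simp only [Surg, List.mem_cons] at hj h'
        tauto
      rcases this with rfl | h1
      · exact Or.inr (Or.inl ⟨rfl, rfl⟩)
      · have : j = σ.β k := by rw [← h1, σ.ββ]
        subst this
        exact Or.inr (Or.inl ⟨(ha _).symm, ha _⟩)

/-- A surgery either merges two circles or splits a circle in two. -/
theorem saddle [Fintype V] (L : List K) (k : K) (hk : ¬ Surg σ.β L k) :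
    (SameCircle (σ.Rel (k :: L)) (σ.pt k false) (σ.pt (σ.β k) false) ∧
      ¬ SameCircle (σ.Rel L) (σ.pt k false) (σ.pt k true) ∧
      ∀ x y, SameCircle (σ.Rel L) x y → SameCircle (σ.Rel (k :: L)) x y) ∨
    (¬ SameCircle (σ.Rel (k :: L)) (σ.pt k false) (σ.pt (σ.β k) false) ∧
      SameCircle (σ.Rel L) (σ.pt k false) (σ.pt k true) ∧
      ∀ x y, SameCircle (σ.Rel (k :: L)) x y → SameCircle (σ.Rel L) x y) := by
  classical
  let w : V → V := fun x => if h : ∃ j : K × Bool, σ.pt j.1 j.2 = x then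
      (if h.choose.1 = k ∨ h.choose.1 = σ.β k then x
       else if Surg σ.β L h.choose.1 then σ.pt h.choose.1 (!h.choose.2)
       else σ.pt (σ.β h.choose.1) h.choose.2)
    else σ.e x
  have hβk : ∀ j, σ.β j = k ↔ j = σ.β k := fun j =>
    ⟨fun h => by rw [← h, σ.ββ], fun h => by rw [h, σ.ββ]⟩
  have hββ : ∀ j, σ.β j = σ.β k ↔ j = k := fun j =>
    ⟨fun h => by rw [← σ.ββ j, h, σ.ββ], fun h => by rw [h]⟩
  have w_pt : ∀ j l, w (σ.pt j l) = if j = k ∨ j = σ.β k then σ.pt j l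
       else if Surg σ.β L j then σ.pt j (!l) else σ.pt (σ.β j) l := by
    intro j l
    have h : ∃ j' : K × Bool, σ.pt j'.1 j'.2 = σ.pt j l := ⟨(j, l), rfl⟩
    have h1 := σ.inj _ _ _ _ h.choose_spec
    simp only [w]
    rw [dif_pos h, h1.1, h1.2]
  have w_e : ∀ x, (∀ j l, σ.pt j l ≠ x) → w x = σ.e x := by
    intro x h
    simp only [w]
    rw [dif_neg]
    rintro ⟨j, hj⟩
    exact h _ _ hj
  have cases_pt : ∀ x, (∃ j l, σ.pt j l = x) ∨ (∀ j l, σ.pt j l ≠ x) := by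
    intro x
    by_cases h : ∃ j l, σ.pt j l = x
    · exact Or.inl h
    · push Not at h; exact Or.inr h
  have hww : ∀ x, w (w x) = x := by
    intro x
    rcases cases_pt x with ⟨j, l, rfl⟩ | hx
    · rw [w_pt]
      split_ifs with h1 h2
      · rw [w_pt, if_pos h1]
      · rw [w_pt, if_neg h1, if_pos h2, Bool.not_not]
      · rw [w_pt, if_neg, if_neg, σ.ββ]
        · rwa [σ.surg_β]
        · rw [hβk, hββ]; tauto
    · rw [w_e x hx, w_e _ (σ.ee x hx).1, (σ.ee x hx).2.1]
  have hwc : ∀ x, w x ≠ x → σ.col (w x) ≠ σ.col x := by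
    intro x hne
    rcases cases_pt x with ⟨j, l, rfl⟩ | hx
    · rw [w_pt] at hne ⊢
      split_ifs at hne ⊢ with h1 h2
      · exact absurd rfl hne
      · cases l
        · exact σ.cv j
        · exact (σ.cv j).symm
      · exact σ.cβ j l
    · rw [w_e x hx]; exact (σ.ee x hx).2.2
  have hfix : ∀ x, w x = x ↔ x = σ.pt k false ∨ x = σ.pt (σ.β k) false ∨ x = σ.pt k true ∨
      x = σ.pt (σ.β k) true := by
    intro x
    constructor
    · intro h
      rcases cases_pt x with ⟨j, l, rfl⟩ | hx
      · rw [w_pt] at h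
        split_ifs at h with h1 h2
        · rcases h1 with rfl | rfl <;> cases l <;> simp
        · have := (σ.inj _ _ _ _ h).2
          simp at this
        · exact absurd (σ.inj _ _ _ _ h).1 (σ.ne j)
      · rw [w_e x hx] at h
        exact absurd (congrArg σ.col h) (σ.ee x hx).2.2
    · rintro (rfl | rfl | rfl | rfl) <;> rw [w_pt, if_pos (by simp)]
  set r0 : V → V → Prop := fun x y => y = σ.o x ∨ y = w x with hr0
  have edge : ∀ L', (∀ j, j ≠ k → j ≠ σ.β k → (Surg σ.β L' j ↔ Surg σ.β L j)) →
      ∀ x y, SameCircle r0 x y → SameCircle (σ.Rel L') x y := by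
    intro L' hL' x y h
    refine SameCircle.map id ?_ h
    rintro x y (rfl | rfl)
    · exact SameCircle.of (.o x)
    · rcases cases_pt x with ⟨j, l, rfl⟩ | hx
      · simp only [id]
        rw [w_pt]
        split_ifs with h1 h2
        · rfl
        · have h3 := SameCircle.of (Rel.vert (σ := σ) (L := L') j
            ((hL' j (fun h => h1 (Or.inl h)) (fun h => h1 (Or.inr h))).2 h2))
          cases l
          · exact h3
          · exact h3.symm
        · exact SameCircle.of (.arc j l
            (fun h => h2 ((hL' j (fun h => h1 (Or.inl h)) (fun h => h1 (Or.inr h))).1 h)))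
      · simp only [id]
        rw [w_e x hx]
        exact SameCircle.of (.e x hx)
  have edge1 := edge L (fun j _ _ => Iff.rfl)
  have edge2 := edge (k :: L) (fun j h1 h2 => by
    have : σ.β j ≠ k := fun h => h2 ((hβk j).1 h)
    simp only [Surg, List.mem_cons]; tauto)
  have o0 : ∀ x, SameCircle r0 x (σ.o x) := fun x => SameCircle.of (Or.inl rfl)
  have w0 : ∀ x, SameCircle r0 x (w x) := fun x => SameCircle.of (Or.inr rfl)
  rcases pairing σ.o w σ.col σ.oo hww σ.co hwc (σ.pt k false) (σ.pt (σ.β k) false)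
      (σ.pt k true) (σ.pt (σ.β k) true) hfix (σ.cβ k false) (σ.cv k)
      (by
        have h1 := σ.cv k
        have h2 := σ.cβ k true
        revert h1 h2
        generalize σ.col (σ.pt k true) = a
        generalize σ.col (σ.pt k false) = b
        generalize σ.col (σ.pt (σ.β k) true) = c
        cases a <;> cases b <;> cases c <;> simp)
      (fun h => by simpa using (σ.inj _ _ _ _ h).2)
      (fun h => by simpa using (σ.inj _ _ _ _ h).2) with ⟨h1, h2, h3⟩ | ⟨h1, h2, h3⟩
  · have le : ∀ x y, SameCircle (σ.Rel L) x y → SameCircle r0 x y := by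
      intro x y h
      refine SameCircle.map id ?_ h
      intro x y hxy
      cases hxy with
      | o => exact o0 _
      | e _ h' => have := w0 x; rwa [w_e x h'] at this
      | arc j l h' =>
        by_cases hj : j = k
        · subst hj; cases l
          · exact h1
          · exact h2
        by_cases hj' : j = σ.β k
        · subst hj'; rw [σ.ββ]; cases l
          · exact h1.symm
          · exact h2.symm
        have := w0 (σ.pt j l)
        rwa [w_pt, if_neg (by tauto), if_neg h'] at this
      | vert j h' =>
        have := w0 (σ.pt j false)
        rwa [w_pt, if_neg, if_pos h', Bool.not_false] at this
        rintro (rfl | rfl)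
        · exact hk h'
        · exact hk ((σ.surg_β _ _).1 h')
    exact Or.inl ⟨edge2 _ _ h1, fun h => h3 (le _ _ h), fun x y h => edge2 _ _ (le _ _ h)⟩
  · have le : ∀ x y, SameCircle (σ.Rel (k :: L)) x y → SameCircle r0 x y := by
      intro x y h
      refine SameCircle.map id ?_ h
      intro x y hxy
      cases hxy with
      | o => exact o0 _
      | e _ h' => have := w0 x; rwa [w_e x h'] at this
      | arc j l h' =>
        have := w0 (σ.pt j l)
        rwa [w_pt, if_neg, if_neg] at this
        · exact fun h => h' (h.imp (List.mem_cons_of_mem _) (List.mem_cons_of_mem _))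
        · rintro (rfl | rfl)
          · exact h' (Or.inl (List.mem_cons_self ..))
          · exact h' ((σ.surg_β _ _).2 (Or.inl (List.mem_cons_self ..)))
      | vert j h' =>
        by_cases hj : j = k
        · subst hj; exact h1
        by_cases hj' : j = σ.β k
        · subst hj'; exact h2
        have := w0 (σ.pt j false)
        rwa [w_pt, if_neg (by tauto), if_pos, Bool.not_false] at this
        have : σ.β j ≠ k := fun h => hj' ((hβk j).1 h)
        simp only [Surg, List.mem_cons] at h' ⊢; tauto
    exact Or.inr ⟨fun h => h3 (le _ _ h), edge1 _ _ h1, fun x y h => edge1 _ _ (le _ _ h)⟩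

end SurgerySystem

/-- The ideal generated by the squares of the variables and the differences of variables at
adjacent vertices. -/
noncomputable def circleIdeal {V : Type} (R : V → V → Prop) : Ideal (MvPolynomial V ℤ) :=
  Ideal.span ({f | ∃ v, f = MvPolynomial.X v ^ 2} ∪
    {f | ∃ v w, R v w ∧ f = MvPolynomial.X v - MvPolynomial.X w})

section CircleIdeal

open MvPolynomial

variable {V : Type} {R R' : V → V → Prop}

theorem X_sq_mem (v : V) : (X v ^ 2 : MvPolynomial V ℤ) ∈ circleIdeal R :=
  Ideal.subset_span (Or.inl ⟨v, rfl⟩)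

theorem X_sub_mem {v w : V} (h : SameCircle R v w) :
    (X v - X w : MvPolynomial V ℤ) ∈ circleIdeal R := by
  rw [← Ideal.Quotient.eq]
  exact SameCircle.lift (fun v => Ideal.Quotient.mk (circleIdeal R) (X v))
    (fun x y hxy => Ideal.Quotient.eq.2 (Ideal.subset_span (Or.inr ⟨x, y, hxy, rfl⟩))) h

theorem circleIdeal_map_le {W : Type} {R' : W → W → Prop} (φ : V → W)
    (h : ∀ x y, R x y → SameCircle R' (φ x) (φ y)) {f : MvPolynomial V ℤ}
    (hf : f ∈ circleIdeal R) : rename φ f ∈ circleIdeal R' := by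
  have : circleIdeal R ≤ (circleIdeal R').comap (rename φ) := by
    refine Ideal.span_le.2 ?_
    rintro _ (⟨v, rfl⟩ | ⟨v, w, hvw, rfl⟩)
    · simpa using X_sq_mem (R := R') (φ v)
    · simpa using X_sub_mem (h v w hvw)
  exact this hf

open Classical in
/-- The factor contributed by a saddle which, after the surgery, has its two strands at `a` and
`b`: multiplication by it is `m` or `Δ`. -/
noncomputable def saddleFactor (R : V → V → Prop) (a b : V) : MvPolynomial V ℤ :=
  if SameCircle R a b then 1 else X a + X b

theorem mul_saddleFactor_mem {a b : V}
    (h : ∀ x y, SameCircle R x y → Join (SameCircle R') a b x y) {f : MvPolynomial V ℤ}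
    (hf : f ∈ circleIdeal R) : f * saddleFactor R' a b ∈ circleIdeal R' := by
  have : circleIdeal R ≤ Submodule.comap (LinearMap.mulRight (MvPolynomial V ℤ)
      (saddleFactor R' a b)) (circleIdeal R') := by
    refine Ideal.span_le.2 ?_
    rintro _ (⟨v, rfl⟩ | ⟨v, w, hvw, rfl⟩)
    · show X v ^ 2 * saddleFactor R' a b ∈ circleIdeal R'
      exact Ideal.mul_mem_right _ _ (X_sq_mem v)
    · show (X v - X w) * saddleFactor R' a b ∈ circleIdeal R'
      unfold saddleFactor
      have hj := h v w (SameCircle.of hvw)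
      split_ifs with hab
      · rw [mul_one]
        apply X_sub_mem
        rcases hj with h | ⟨h1, h2⟩ | ⟨h1, h2⟩
        · exact h
        · exact h1.trans (hab.trans h2)
        · exact h1.trans (hab.symm.trans h2)
      · have key : ((X a - X b) * (X a + X b) : MvPolynomial V ℤ) ∈ circleIdeal R' := by
          have : ((X a - X b) * (X a + X b) : MvPolynomial V ℤ) = X a ^ 2 - X b ^ 2 := by ring
          rw [this]
          exact Ideal.sub_mem _ (X_sq_mem a) (X_sq_mem b)
        rcases hj with h | ⟨h1, h2⟩ | ⟨h1, h2⟩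
        · exact Ideal.mul_mem_right _ _ (X_sub_mem h)
        · have : ((X v - X w) * (X a + X b) : MvPolynomial V ℤ) =
            (X v - X a) * (X a + X b) + (X b - X w) * (X a + X b) +
              (X a - X b) * (X a + X b) := by ring
          rw [this]
          exact Ideal.add_mem _ (Ideal.add_mem _ (Ideal.mul_mem_right _ _ (X_sub_mem h1))
            (Ideal.mul_mem_right _ _ (X_sub_mem h2))) key
        · have : ((X v - X w) * (X a + X b) : MvPolynomial V ℤ) =
            (X v - X b) * (X a + X b) + (X a - X w) * (X a + X b) -
              (X a - X b) * (X a + X b) := by ring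
          rw [this]
          exact Ideal.sub_mem _ (Ideal.add_mem _ (Ideal.mul_mem_right _ _ (X_sub_mem h1))
            (Ideal.mul_mem_right _ _ (X_sub_mem h2))) key
  exact this hf

end CircleIdeal

namespace SurgerySystem

open MvPolynomial

variable {V K : Type} (σ : SurgerySystem V K)

/-- The product of the factors of the surgeries in `L`, the last one being performed first. -/
noncomputable def prod : List K → MvPolynomial V ℤ
  | [] => 1
  | k :: L => saddleFactor (σ.Rel (k :: L)) (σ.pt k false) (σ.pt (σ.β k) false) * prod L

/-- The arcs in `L` are distinct. -/
def Valid (L : List K) : Prop := L.Pairwise (fun k j => k ≠ j ∧ k ≠ σ.β j)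

theorem mul_prod_mem (L : List K) {f : MvPolynomial V ℤ} (hf : f ∈ circleIdeal (σ.Rel [])) :
    f * σ.prod L ∈ circleIdeal (σ.Rel L) := by
  induction L with
  | nil => simpa [prod] using hf
  | cons k L ih =>
    have := mul_saddleFactor_mem (R' := σ.Rel (k :: L))
      (fun x y h => σ.SameCircle_le L k h) ih
    rwa [mul_assoc, mul_comm (σ.prod L)] at this

theorem aux_split [Fintype V] {L : List K} {k l : K} (hlk : ¬ Surg σ.β (l :: L) k)
    (h1 : ¬ SameCircle (σ.Rel (l :: k :: L)) (σ.pt k false) (σ.pt (σ.β k) false))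
    (h3 : SameCircle (σ.Rel (k :: L)) (σ.pt k false) (σ.pt (σ.β k) false)) :
    SameCircle (σ.Rel (l :: L)) (σ.pt l false) (σ.pt (σ.β l) false) ∧
    (X (σ.pt k false) + X (σ.pt (σ.β k) false) - (X (σ.pt l false) + X (σ.pt (σ.β l) false)) :
      MvPolynomial V ℤ) ∈ circleIdeal (σ.Rel (l :: k :: L)) := by
  rcases σ.saddle (l :: L) k hlk with ⟨h4, _⟩ | ⟨_, _, h5⟩
  · exact absurd (σ.rel_swap k l L ▸ h4) h1
  have hk' : SameCircle (σ.Rel (l :: L)) (σ.pt k false) (σ.pt (σ.β k) false) :=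
    SameCircle.of (.arc k false hlk)
  have h5' : ∀ x y, SameCircle (σ.Rel (l :: k :: L)) x y → SameCircle (σ.Rel (l :: L)) x y := by
    rw [σ.rel_swap l k L]; exact h5
  rcases σ.SameCircle_le _ l h3 with h | ⟨ha, hb⟩ | ⟨ha, hb⟩
  · exact absurd h h1
  · refine ⟨((h5' _ _ ha).symm.trans hk').trans (h5' _ _ hb).symm, ?_⟩
    convert Ideal.sub_mem _ (X_sub_mem ha) (X_sub_mem hb) using 1
    ring
  · refine ⟨((h5' _ _ hb).trans hk'.symm).trans (h5' _ _ ha), ?_⟩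
    convert Ideal.sub_mem _ (X_sub_mem ha) (X_sub_mem hb) using 1
    ring

theorem aux_merge [Fintype V] {L : List K} {k l : K} (hk : ¬ Surg σ.β L k)
    (hl : ¬ Surg σ.β L l)
    (hkl : ¬ Surg σ.β (k :: L) l)
    (h1 : SameCircle (σ.Rel (l :: k :: L)) (σ.pt k false) (σ.pt (σ.β k) false))
    (h2 : SameCircle (σ.Rel (l :: k :: L)) (σ.pt l false) (σ.pt (σ.β l) false))
    (h3 : ¬ SameCircle (σ.Rel (k :: L)) (σ.pt k false) (σ.pt (σ.β k) false)) :
    ¬ SameCircle (σ.Rel (l :: L)) (σ.pt l false) (σ.pt (σ.β l) false) ∧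
    (X (σ.pt k false) + X (σ.pt (σ.β k) false) - (X (σ.pt l false) + X (σ.pt (σ.β l) false)) :
      MvPolynomial V ℤ) ∈ circleIdeal (σ.Rel (l :: k :: L)) := by
  rcases σ.saddle (k :: L) l hkl with ⟨_, h4, h5⟩ | ⟨h4, _⟩
  swap
  · exact absurd h2 h4
  rcases σ.saddle L k hk with ⟨h6, _⟩ | ⟨_, _, h6⟩
  · exact absurd h6 h3
  have hk' : SameCircle (σ.Rel L) (σ.pt k false) (σ.pt (σ.β k) false) :=
    SameCircle.of (.arc k false hk)
  have hv : SameCircle (σ.Rel (l :: k :: L)) (σ.pt l false) (σ.pt l true) :=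
    SameCircle.of (.vert l (Or.inl (List.mem_cons_self ..)))
  have main : SameCircle (σ.Rel L) (σ.pt l false) (σ.pt l true) ∧
      SameCircle (σ.Rel (l :: k :: L)) (σ.pt k false) (σ.pt l false) := by
    rcases σ.SameCircle_ge _ l hkl h1 with h | ⟨ha, hb⟩ | ⟨ha, hb⟩
    · exact absurd h h3
    · exact ⟨((h6 _ _ ha).symm.trans hk').trans (h6 _ _ hb).symm, h5 _ _ ha⟩
    · exact ⟨((h6 _ _ hb).trans hk'.symm).trans (h6 _ _ ha), (h5 _ _ ha).trans hv.symm⟩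
  refine ⟨?_, ?_⟩
  · rcases σ.saddle L l hl with ⟨_, h7, _⟩ | ⟨h7, _⟩
    · exact absurd main.1 h7
    · exact h7
  · convert Ideal.add_mem _ (X_sub_mem main.2)
      (X_sub_mem (h1.symm.trans (main.2.trans h2))) using 1
    ring

theorem prod_swap [Fintype V] {L : List K} {k l : K} (h : σ.Valid (l :: k :: L)) :
    σ.prod (l :: k :: L) - σ.prod (k :: l :: L) ∈ circleIdeal (σ.Rel (l :: k :: L)) := by
  have nS : ∀ (L : List K) k, (∀ a ∈ L, k ≠ a ∧ k ≠ σ.β a) → ¬ Surg σ.β L k := by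
    rintro L k h (h' | h')
    · exact (h _ h').1 rfl
    · exact (h _ h').2 (σ.ββ k).symm
  simp only [Valid, List.pairwise_cons] at h
  have hk := nS _ _ h.2.1
  have hkl := nS _ _ h.1
  have hl : ¬ Surg σ.β L l := fun h => hkl
    (h.imp (List.mem_cons_of_mem _) (List.mem_cons_of_mem _))
  have hlk : ¬ Surg σ.β (l :: L) k := by
    refine nS _ _ ?_
    intro a ha
    rcases List.mem_cons.1 ha with rfl | ha
    · have := h.1 k (List.mem_cons_self ..)
      exact ⟨this.1.symm, fun h => this.2 (by rw [h, σ.ββ])⟩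
    · exact h.2.1 a ha
  simp only [prod]
  rw [σ.rel_swap k l L, ← mul_assoc, ← mul_assoc, ← sub_mul]
  refine Ideal.mul_mem_right _ _ ?_
  unfold saddleFactor
  have hsw := σ.rel_swap k l L
  by_cases h1 : SameCircle (σ.Rel (l :: k :: L)) (σ.pt k false) (σ.pt (σ.β k) false) <;>
  by_cases h2 : SameCircle (σ.Rel (l :: k :: L)) (σ.pt l false) (σ.pt (σ.β l) false)
  · rw [if_pos h1, if_pos h2, one_mul, one_mul]
    by_cases h3 : SameCircle (σ.Rel (k :: L)) (σ.pt k false) (σ.pt (σ.β k) false)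
    · by_cases h4 : SameCircle (σ.Rel (l :: L)) (σ.pt l false) (σ.pt (σ.β l) false)
      · rw [if_pos h3, if_pos h4, sub_self]; exact Ideal.zero_mem _
      · exact absurd h3 (σ.aux_merge hl hk hlk (hsw ▸ h2) (hsw ▸ h1) h4).1
    · have := σ.aux_merge hk hl hkl h1 h2 h3
      rw [if_neg h3, if_neg this.1]
      exact this.2
  · rw [if_pos h1, if_neg h2, one_mul]
    rcases σ.saddle (k :: L) l hkl with ⟨h3, _⟩ | ⟨_, _, h3⟩
    · exact absurd h3 h2
    rcases σ.saddle (l :: L) k hlk with ⟨_, _, h4⟩ | ⟨h4, _⟩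
    · rw [if_pos (h3 _ _ h1), if_neg (fun h => h2 (hsw ▸ h4 _ _ h)), mul_one, sub_self]
      exact Ideal.zero_mem _
    · exact absurd (hsw ▸ h1) h4
  · rw [if_neg h1, if_pos h2, one_mul]
    rcases σ.saddle (l :: L) k hlk with ⟨h3, _⟩ | ⟨_, _, h3⟩
    · exact absurd (hsw ▸ h3) h1
    rcases σ.saddle (k :: L) l hkl with ⟨_, _, h4⟩ | ⟨h4, _⟩
    · rw [if_pos (h3 _ _ (hsw ▸ h2)), if_neg (fun h => h1 (h4 _ _ h)), mul_one, sub_self]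
      exact Ideal.zero_mem _
    · exact absurd h2 h4
  · rw [if_neg h1, if_neg h2]
    by_cases h3 : SameCircle (σ.Rel (k :: L)) (σ.pt k false) (σ.pt (σ.β k) false)
    · have := σ.aux_split hlk h1 h3
      rw [if_pos h3, if_pos this.1, mul_one, mul_one, ← neg_mem_iff, neg_sub]
      exact this.2
    · by_cases h4 : SameCircle (σ.Rel (l :: L)) (σ.pt l false) (σ.pt (σ.β l) false)
      · exact absurd (σ.aux_split hkl (hsw ▸ h2) h4).1 h3
      · rw [if_neg h3, if_neg h4, mul_comm, sub_self]
        exact Ideal.zero_mem _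

theorem valid_perm {L L' : List K} (h : L.Perm L') : σ.Valid L → σ.Valid L' :=
  (h.pairwise_iff (fun {a b} hab => ⟨hab.1.symm, fun h' => hab.2 (by rw [h', σ.ββ])⟩)).1

theorem rel_perm {L L' : List K} (h : L.Perm L') : σ.Rel L = σ.Rel L' := by
  have : ∀ k, Surg σ.β L k ↔ Surg σ.β L' k := fun k => by
    simp only [Surg, h.mem_iff]
  funext x y
  exact propext ⟨Rel.mono σ this x y, Rel.mono σ (fun k => (this k).symm) x y⟩

/-- The composition of the saddles does not depend on their order. -/
theorem prod_perm [Fintype V] {L L' : List K} (h : L.Perm L') (hL : σ.Valid L) :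
    σ.prod L - σ.prod L' ∈ circleIdeal (σ.Rel L) := by
  induction h with
  | nil => simp
  | cons k h ih =>
    rename_i L L'
    have := ih (List.pairwise_cons.1 hL).2
    simp only [prod]
    rw [← σ.rel_perm (h.cons k), ← mul_sub, mul_comm]
    exact mul_saddleFactor_mem (fun x y h => σ.SameCircle_le L k h) this
  | swap k l L => exact σ.prod_swap hL
  | trans h1 h2 ih1 ih2 =>
    have := Ideal.add_mem _ (ih1 hL) (σ.rel_perm h1 ▸ ih2 (σ.valid_perm h1 hL))
    simpa using this

end SurgerySystem

/-- Crossingless perfect matchings of the points of a finite linearly ordered set. -/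
@[ext] structure Matching (P : Type) [LinearOrder P] where
  toFun : P → P
  invol : ∀ p, toFun (toFun p) = p
  ne : ∀ p, toFun p ≠ p
  crossingless : ∀ p q, p < q → q < toFun p → ¬ toFun p < toFun q

namespace Matching

variable {P : Type} [LinearOrder P]

instance : CoeFun (Matching P) (fun _ => P → P) := ⟨Matching.toFun⟩

instance [Fintype P] : Finite (Matching P) :=
  Finite.of_injective Matching.toFun (fun _ _ h => Matching.ext h)

noncomputable instance [Fintype P] : Fintype (Matching P) := Fintype.ofFinite _

/-- The arcs of a matching, as edges. -/
def Graph (a : Matching P) (p q : P) : Prop := q = a p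

/-- The left ends of the arcs of a matching, in increasing order. -/
noncomputable def arcs [Fintype P] (b : Matching P) : List P :=
  (Finset.univ.filter (fun p => p < b p)).sort (· ≤ ·)

theorem surg_arcs [Fintype P] (b : Matching P) (p : P) : Surg b b.arcs p := by
  simp only [Surg, arcs, Finset.mem_sort, Finset.mem_filter, Finset.mem_univ, true_and, b.invol]
  exact (b.ne p).symm.lt_or_gt

theorem valid_arcs [Fintype P] (b : Matching P) :
    b.arcs.Pairwise (fun k j => k ≠ j ∧ k ≠ b j) := by
  have h1 : b.arcs.Nodup := Finset.sort_nodup _ _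
  refine List.Pairwise.imp_of_mem ?_ h1
  intro x y hx hy hxy
  refine ⟨hxy, ?_⟩
  simp only [arcs, Finset.mem_sort, Finset.mem_filter, Finset.mem_univ, true_and] at hx hy
  rintro rfl
  rw [b.invol] at hx
  exact lt_asymm hx hy

/-- The parity of the position of a point. -/
def colour [Fintype P] (p : P) : Bool :=
  decide ((Finset.univ.filter (fun q : P => q < p)).card % 2 = 0)

theorem between [Fintype P] (b : Matching P) {p q : P} (h1 : p < q) (h2 : q < b p) :
    p < b q ∧ b q < b p := by
  have n1 : b q ≠ p := fun h => by rw [← h, b.invol] at h2; exact lt_irrefl _ h2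
  have n2 : b q ≠ b p := fun h => by
    have := congrArg b.toFun h; rw [b.invol, b.invol] at this; exact h1.ne' this
  constructor
  · by_contra h
    have h3 : b q < p := lt_of_le_of_ne (not_lt.1 h) n1
    exact b.crossingless (b q) p h3 (by rwa [b.invol]) (by rwa [b.invol])
  · exact lt_of_le_of_ne (not_lt.1 (b.crossingless p q h1 h2)) n2

theorem colour_ne [Fintype P] (b : Matching P) (p : P) : colour (b p) ≠ colour p := by
  classical
  have key : ∀ p, p < b p → colour (b p) ≠ colour p := by
    intro p hp
    let I : Finset P := Finset.univ.filter (fun q => p < q ∧ q < b p)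
    have hI : Even I.card := by
      have h := Finset.sum_involution (s := I) (f := fun _ => (1 : ZMod 2)) (fun q _ => b q)
        (fun q _ => by decide) (fun q _ _ => b.ne q)
        (fun q hq => by
          simp only [I, Finset.mem_filter, Finset.mem_univ, true_and] at hq ⊢
          exact b.between hq.1 hq.2)
        (fun q _ => b.invol q)
      simp only [Finset.sum_const, nsmul_eq_mul, mul_one] at h
      exact (ZMod.natCast_eq_zero_iff_even).1 h
    have hU : Finset.univ.filter (fun q : P => q < b p) =
        insert p (Finset.univ.filter (fun q : P => q < p) ∪ I) := by
      ext q
      simp only [I, Finset.mem_filter, Finset.mem_univ, true_and, Finset.mem_insert,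
        Finset.mem_union]
      constructor
      · intro h
        rcases lt_trichotomy q p with h' | h' | h'
        · exact Or.inr (Or.inl h')
        · exact Or.inl h'
        · exact Or.inr (Or.inr ⟨h', h⟩)
      · rintro (rfl | h | h)
        · exact hp
        · exact h.trans hp
        · exact h.2
    have hc : (Finset.univ.filter (fun q : P => q < b p)).card =
        (Finset.univ.filter (fun q : P => q < p)).card + I.card + 1 := by
      rw [hU, Finset.card_insert_of_notMem, Finset.card_union_of_disjoint]
      · rw [Finset.disjoint_left]
        intro q hq hq'
        simp only [I, Finset.mem_filter, Finset.mem_univ, true_and] at hq hq'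
        exact lt_asymm hq hq'.1
      · simp [I]
    unfold colour
    rw [hc]
    rw [Nat.even_iff] at hI
    intro h
    rw [decide_eq_decide] at h
    omega
  rcases (b.ne p).symm.lt_or_gt with h | h
  · exact key p h
  · have := key (b p) (by rwa [b.invol])
    rw [b.invol] at this
    exact this.symm

end Matching

/-- The edges of the diagram obtained from an open diagram, with edges `R` and boundary points
`bd p`, by closing it off with the matching `b`. -/
inductive Closure {P V : Type} [LinearOrder P] (R : V → V → Prop) (bd : P → V) (b : Matching P) :
    V → V → Prop
  | inner {v w : V} : R v w → Closure R bd b v w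
  | arc (p : P) : Closure R bd b (bd p) (bd (b p))

/-- The contraction of `b` with `W(b)` in `W(c) b W(b) u`, where `u` is the open diagram with edges
`R` and boundary points `bd p`, after the surgeries along the arcs of `b` with an end in `L`:
the two strands along such an arc are replaced by the vertical segments joining the
two copies of its end points. -/
inductive Contracting {P V : Type} [LinearOrder P] (R : V → V → Prop) (bd : P → V)
    (c b : Matching P) (L : List P) : P ⊕ V → P ⊕ V → Prop
  | upper (p : P) : Contracting R bd c b L (.inl p) (.inl (c p))
  | lower {v w : V} : R v w → Contracting R bd c b L (.inr v) (.inr w)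
  | arcUpper (p : P) : ¬ Surg b L p → Contracting R bd c b L (.inl p) (.inl (b p))
  | arcLower (p : P) : ¬ Surg b L p → Contracting R bd c b L (.inr (bd p)) (.inr (bd (b p)))
  | vertical (p : P) : Surg b L p → Contracting R bd c b L (.inl p) (.inr (bd p))

/-- The product of the factors of the saddles of a contraction, along the arcs in `L`. -/
noncomputable def saddles {P V : Type} [LinearOrder P] (R : V → V → Prop) (bd : P → V)
    (c b : Matching P) : List P → MvPolynomial (P ⊕ V) ℤ
  | [] => 1
  | p :: L => saddleFactor (Contracting R bd c b (p :: L)) (.inl p) (.inl (b p)) *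
      saddles R bd c b L

section Contraction

open MvPolynomial

variable {P V : Type} [LinearOrder P] (R : V → V → Prop) (bd : P → V)

theorem contracting_join (c b : Matching P) (p : P) (L : List P) {x y : P ⊕ V}
    (h : SameCircle (Contracting R bd c b L) x y) :
    Join (SameCircle (Contracting R bd c b (p :: L))) (.inl p) (.inl (b p)) x y := by
  refine SameCircle.join ?_ h
  have hv : ∀ j, Surg b (p :: L) j →
      SameCircle (Contracting R bd c b (p :: L)) (.inl j) (.inr (bd j)) :=
    fun j hj => SameCircle.of (.vertical j hj)
  have hs : ∀ j, Surg b L j → Surg b (p :: L) j :=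
    fun j h => h.imp (List.mem_cons_of_mem _) (List.mem_cons_of_mem _)
  have hp : Surg b (p :: L) p := Or.inl (List.mem_cons_self ..)
  have hp' : Surg b (p :: L) (b p) := Or.inr (by rw [b.invol]; exact List.mem_cons_self ..)
  have hj : ∀ j, ¬ Surg b L j → Surg b (p :: L) j → j = p ∨ j = b p := by
    intro j h1 h2
    have : j = p ∨ b j = p := by
      simp only [Surg, List.mem_cons] at h1 h2
      tauto
    exact this.imp_right (fun h => by rw [← h, b.invol])
  intro x y hxy
  cases hxy with
  | upper j => exact Or.inl (SameCircle.of (.upper j))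
  | lower h => exact Or.inl (SameCircle.of (.lower h))
  | vertical j h => exact Or.inl (hv j (hs j h))
  | arcUpper j h =>
    by_cases h' : Surg b (p :: L) j
    · rcases hj j h h' with rfl | rfl
      · exact Or.inr (Or.inl ⟨rfl, rfl⟩)
      · rw [b.invol]; exact Or.inr (Or.inr ⟨rfl, rfl⟩)
    · exact Or.inl (SameCircle.of (.arcUpper j h'))
  | arcLower j h =>
    by_cases h' : Surg b (p :: L) j
    · rcases hj j h h' with rfl | rfl
      · exact Or.inr (Or.inl ⟨(hv _ hp).symm, hv _ hp'⟩)
      · rw [b.invol]; exact Or.inr (Or.inr ⟨(hv _ hp').symm, hv _ hp⟩)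
    · exact Or.inl (SameCircle.of (.arcLower j h'))

theorem mul_saddles_mem (c b : Matching P) (L : List P) {f : MvPolynomial (P ⊕ V) ℤ}
    (hf : f ∈ circleIdeal (Contracting R bd c b [])) :
    f * saddles R bd c b L ∈ circleIdeal (Contracting R bd c b L) := by
  induction L with
  | nil => simpa [saddles] using hf
  | cons p L ih =>
    have := mul_saddleFactor_mem (fun x y h => contracting_join R bd c b p L h) ih
    rwa [mul_assoc, mul_comm (saddles R bd c b L)] at this

variable [Fintype P]

/-- The identification of the two copies of the boundary points after a contraction. -/
def collapse : P ⊕ V → V := Sum.elim bd id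

/-- The contraction cobordism, on polynomials. -/
noncomputable def contractPoly (c b : Matching P) (f : MvPolynomial P ℤ) (g : MvPolynomial V ℤ) :
    MvPolynomial V ℤ :=
  rename (collapse bd) (rename Sum.inl f * rename Sum.inr g * saddles R bd c b b.arcs)

theorem collapse_mem (c b : Matching P) {f : MvPolynomial (P ⊕ V) ℤ}
    (hf : f ∈ circleIdeal (Contracting R bd c b [])) :
    rename (collapse bd) (f * saddles R bd c b b.arcs) ∈ circleIdeal (Closure R bd c) := by
  refine circleIdeal_map_le _ ?_ (mul_saddles_mem R bd c b b.arcs hf)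
  intro x y hxy
  cases hxy with
  | upper j => exact SameCircle.of (.arc j)
  | lower h => exact SameCircle.of (.inner h)
  | vertical j h => rfl
  | arcUpper j h => exact absurd (b.surg_arcs j) h
  | arcLower j h => exact absurd (b.surg_arcs j) h

theorem contractPoly_mem_left (c b : Matching P) {f : MvPolynomial P ℤ} (g : MvPolynomial V ℤ)
    (hf : f ∈ circleIdeal (Closure b.Graph id c)) :
    contractPoly R bd c b f g ∈ circleIdeal (Closure R bd c) := by
  refine collapse_mem R bd c b (Ideal.mul_mem_right _ _ ?_)
  refine circleIdeal_map_le _ ?_ hf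
  intro x y hxy
  cases hxy with
  | inner h => cases h; exact SameCircle.of (.arcUpper x (by simp [Surg]))
  | arc p => exact SameCircle.of (.upper p)

theorem contractPoly_mem_right (c b : Matching P) (f : MvPolynomial P ℤ) {g : MvPolynomial V ℤ}
    (hg : g ∈ circleIdeal (Closure R bd b)) :
    contractPoly R bd c b f g ∈ circleIdeal (Closure R bd c) := by
  refine collapse_mem R bd c b (Ideal.mul_mem_left _ _ ?_)
  refine circleIdeal_map_le _ ?_ hg
  intro x y hxy
  cases hxy with
  | inner h => exact SameCircle.of (.lower h)
  | arc p => exact SameCircle.of (.arcLower p (by simp [Surg]))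

end Contraction

/-- An open diagram which is a bipartite 1-manifold with boundary points `bd p`. -/
structure Regular {P V : Type} [LinearOrder P] (R : V → V → Prop) (bd : P → V) where
  o : V → V
  e : V → V
  col : V → Bool
  oo : ∀ x, o (o x) = x
  co : ∀ x, col (o x) ≠ col x
  inj : Function.Injective bd
  ee : ∀ x, (∀ p, bd p ≠ x) → (∀ p, bd p ≠ e x) ∧ e (e x) = x ∧ col (e x) ≠ col x
  rel_o : ∀ x, R x (o x)
  rel_e : ∀ x, (∀ p, bd p ≠ x) → R x (e x)
  rel : ∀ x y, R x y → y = o x ∨ ((∀ p, bd p ≠ x) ∧ y = e x)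
  col_bd : ∀ (b : Matching P) (p : P), col (bd (b p)) ≠ col (bd p)

namespace Regular

open MvPolynomial

variable {P V : Type} [LinearOrder P] {R : V → V → Prop} {bd : P → V} (ρ : Regular R bd)

/-- The surgeries of a single contraction. -/
def system (c b : Matching P) : SurgerySystem (P ⊕ V) P where
  o := Sum.map c ρ.o
  e := Sum.map id ρ.e
  β := b
  pt p l := cond l (.inr (bd p)) (.inl p)
  col := Sum.elim (fun p => !ρ.col (bd p)) ρ.col
  oo := by rintro (x | x) <;> simp [c.invol, ρ.oo]
  ββ := b.invol
  ne := b.ne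
  inj := by
    rintro k (_ | _) k' (_ | _) h
    · simpa using h
    · simp at h
    · simp at h
    · simpa using ρ.inj (by simpa using h)
  ee := by
    rintro (x | x) h
    · exact absurd rfl (h x false)
    · have := ρ.ee x (fun p hp => h p true (by simp [hp]))
      refine ⟨?_, by simp [this.2.1], this.2.2⟩
      rintro k (_ | _)
      · simp
      · simpa using this.1 k
  co := by
    rintro (x | x)
    · simpa using ρ.col_bd c x
    · exact ρ.co x
  cβ := by
    rintro k (_ | _)
    · simpa using ρ.col_bd b k
    · exact ρ.col_bd b k
  cv := by simp

theorem system_rel (c b : Matching P) (L : List P) {x y : P ⊕ V} :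
    SameCircle ((ρ.system c b).Rel L) x y ↔ SameCircle (Contracting R bd c b L) x y := by
  constructor
  · refine SameCircle.map id ?_
    intro x y hxy
    cases hxy with
    | o =>
      rcases x with x | x
      · exact SameCircle.of (.upper x)
      · exact SameCircle.of (.lower (ρ.rel_o x))
    | e _ h =>
      rcases x with x | x
      · exact absurd rfl (h x false)
      · exact SameCircle.of (.lower (ρ.rel_e x (fun p hp => h p true (by simp [system, hp]))))
    | arc k l h =>
      cases l
      · exact SameCircle.of (.arcUpper k h)
      · exact SameCircle.of (.arcLower k h)
    | vert k h => exact SameCircle.of (.vertical k h)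
  · refine SameCircle.map id ?_
    intro x y hxy
    cases hxy with
    | upper p => exact SameCircle.of (SurgerySystem.Rel.o (σ := ρ.system c b) (.inl p))
    | lower h =>
      rename_i v w
      rcases ρ.rel _ _ h with rfl | ⟨h1, rfl⟩
      · exact SameCircle.of (SurgerySystem.Rel.o (σ := ρ.system c b) (.inr v))
      · refine SameCircle.of (SurgerySystem.Rel.e (σ := ρ.system c b) (.inr v) ?_)
        rintro k (_ | _)
        · simp [system]
        · simpa [system] using h1 k
    | arcUpper p h => exact SameCircle.of (SurgerySystem.Rel.arc (σ := ρ.system c b) p false h)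
    | arcLower p h => exact SameCircle.of (SurgerySystem.Rel.arc (σ := ρ.system c b) p true h)
    | vertical p h => exact SameCircle.of (SurgerySystem.Rel.vert (σ := ρ.system c b) p h)

theorem rename_saddleFactor {V W U : Type} {R : V → V → Prop} {R' : W → W → Prop}
    (φ : V → U) (ψ : W → U) {a b : V} {a' b' : W} (h : SameCircle R a b ↔ SameCircle R' a' b')
    (ha : φ a = ψ a') (hb : φ b = ψ b') :
    rename φ (saddleFactor R a b) = rename ψ (saddleFactor R' a' b') := by
  unfold saddleFactor
  by_cases h1 : SameCircle R a b
  · rw [if_pos h1, if_pos (h.1 h1)]; simp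
  · rw [if_neg h1, if_neg (fun h' => h1 (h.2 h'))]; simp [ha, hb]

/-- The surgeries of two successive contractions, of `c` and of `b`. -/
def system₂ (d c b : Matching P) : SurgerySystem (P ⊕ (P ⊕ P) ⊕ V) (P ⊕ P) where
  o := Sum.map d (Sum.map Sum.swap ρ.o)
  e := Sum.map id (Sum.map id ρ.e)
  β := Sum.map c b
  pt k l := match k, l with
    | .inl p, false => .inl p
    | .inl p, true => .inr (.inl (.inl p))
    | .inr p, false => .inr (.inl (.inr p))
    | .inr p, true => .inr (.inr (bd p))
  col := Sum.elim (fun p => !ρ.col (bd p)) (Sum.elim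
    (Sum.elim (fun p => ρ.col (bd p)) (fun p => !ρ.col (bd p))) ρ.col)
  oo := by rintro (x | (x | x) | x) <;> simp [d.invol, ρ.oo]
  ββ := by rintro (x | x) <;> simp [c.invol, b.invol]
  ne := by rintro (x | x) <;> simp [c.ne, b.ne]
  inj := by
    rintro (k | k) (_ | _) (k' | k') (_ | _) h <;>
    first
    | (simp at h; done)
    | (simpa using h)
    | (simpa using ρ.inj (by simpa using h))
  ee := by
    rintro (x | (x | x) | x) h
    · exact absurd rfl (h (.inl x) false)
    · exact absurd rfl (h (.inl x) true)
    · exact absurd rfl (h (.inr x) false)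
    · have := ρ.ee x (fun p hp => h (.inr p) true (by simp [hp]))
      refine ⟨?_, by simp [this.2.1], this.2.2⟩
      rintro (k | k) (_ | _) <;> simp
      exact this.1 k
  co := by
    rintro (x | (x | x) | x)
    · simpa using ρ.col_bd d x
    · simp
    · simp
    · exact ρ.co x
  cβ := by
    rintro (k | k) (_ | _)
    · simpa using ρ.col_bd c k
    · exact ρ.col_bd c k
    · simpa using ρ.col_bd b k
    · exact ρ.col_bd b k
  cv := by rintro (k | k) <;> simp

end Regular

theorem SameCircle.iff_of_retract {V W : Type} {R : V → V → Prop} {R' : W → W → Prop}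
    (r : V → W) (i : W → V) (hr : ∀ x y, R x y → SameCircle R' (r x) (r y))
    (hi : ∀ x y, R' x y → SameCircle R (i x) (i y)) {a b : W} (ha : r (i a) = a)
    (hb : r (i b) = b) : SameCircle R (i a) (i b) ↔ SameCircle R' a b :=
  ⟨fun h => by have := h.map r hr; rwa [ha, hb] at this, fun h => h.map i hi⟩

theorem surg_append {K K' : Type} (c : K → K) (b : K' → K') (L : List K) (L' : List K') :
    (∀ x, Surg (Sum.map c b) (L.map Sum.inl ++ L'.map Sum.inr) (.inl x) ↔ Surg c L x) ∧
    (∀ x, Surg (Sum.map c b) (L.map Sum.inl ++ L'.map Sum.inr) (.inr x) ↔ Surg b L' x) ∧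
    (∀ x, Surg (Sum.map c b) (L'.map Sum.inr ++ L.map Sum.inl) (.inl x) ↔ Surg c L x) ∧
    (∀ x, Surg (Sum.map c b) (L'.map Sum.inr ++ L.map Sum.inl) (.inr x) ↔ Surg b L' x) := by
  simp [Surg]

theorem SurgerySystem.valid_append {V K K' : Type} (σ : SurgerySystem V (K ⊕ K')) (c : K → K)
    (b : K' → K') (hβ : σ.β = Sum.map c b) {L : List K} {L' : List K'}
    (hL : L.Pairwise (fun k j => k ≠ j ∧ k ≠ c j))
    (hL' : L'.Pairwise (fun k j => k ≠ j ∧ k ≠ b j)) :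
    σ.Valid (L.map Sum.inl ++ L'.map Sum.inr) := by
  unfold SurgerySystem.Valid
  rw [hβ, List.pairwise_append, List.pairwise_map, List.pairwise_map]
  refine ⟨by simpa using hL, by simpa using hL', ?_⟩
  simp

theorem contractPoly_eq {P V : Type} [LinearOrder P] [Fintype P] (R : V → V → Prop) (bd : P → V)
    (c b : Matching P) (f : MvPolynomial P ℤ) (g : MvPolynomial V ℤ) :
    contractPoly R bd c b f g = MvPolynomial.rename bd f * g *
      MvPolynomial.rename (collapse bd) (saddles R bd c b b.arcs) := by
  have h1 : collapse bd ∘ Sum.inl = bd := rfl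
  have h2 : collapse bd ∘ Sum.inr = id := rfl
  simp only [contractPoly, map_mul, MvPolynomial.rename_rename, h1, h2, MvPolynomial.rename_id,
    AlgHom.coe_id, id_eq]

namespace Regular

open MvPolynomial

variable {P V : Type} [LinearOrder P] {R : V → V → Prop} {bd : P → V} (ρ : Regular R bd)
  (d c b : Matching P)

theorem system₂_rel {L : List (P ⊕ P)} {Lc Lb : List P}
    (hc : ∀ x, Surg (Sum.map c b) L (.inl x) ↔ Surg c Lc x)
    (hb : ∀ x, Surg (Sum.map c b) L (.inr x) ↔ Surg b Lb x) :
    (∀ x, SameCircle ((ρ.system₂ d c b).Rel L) (.inl x) (.inl (d x))) ∧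
    (∀ x, SameCircle ((ρ.system₂ d c b).Rel L) (.inr (.inl (.inl x))) (.inr (.inl (.inr x)))) ∧
    (∀ x y, R x y → SameCircle ((ρ.system₂ d c b).Rel L) (.inr (.inr x)) (.inr (.inr y))) ∧
    (∀ x, ¬ Surg c Lc x →
      SameCircle ((ρ.system₂ d c b).Rel L) (.inl x) (.inl (c x)) ∧
      SameCircle ((ρ.system₂ d c b).Rel L) (.inr (.inl (.inl x))) (.inr (.inl (.inl (c x))))) ∧
    (∀ x, Surg c Lc x →
      SameCircle ((ρ.system₂ d c b).Rel L) (.inl x) (.inr (.inl (.inl x)))) ∧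
    (∀ x, ¬ Surg b Lb x →
      SameCircle ((ρ.system₂ d c b).Rel L) (.inr (.inl (.inr x))) (.inr (.inl (.inr (b x)))) ∧
      SameCircle ((ρ.system₂ d c b).Rel L) (.inr (.inr (bd x))) (.inr (.inr (bd (b x))))) ∧
    (∀ x, Surg b Lb x →
      SameCircle ((ρ.system₂ d c b).Rel L) (.inr (.inl (.inr x))) (.inr (.inr (bd x)))) := by
  let σ := ρ.system₂ d c b
  refine ⟨fun x => SameCircle.of (SurgerySystem.Rel.o (σ := σ) (.inl x)),
    fun x => SameCircle.of (SurgerySystem.Rel.o (σ := σ) (.inr (.inl (.inl x)))), ?_,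
    fun x hx => ⟨SameCircle.of (SurgerySystem.Rel.arc (σ := σ) (.inl x) false
        (fun h => hx ((hc x).1 h))),
      SameCircle.of (SurgerySystem.Rel.arc (σ := σ) (.inl x) true (fun h => hx ((hc x).1 h)))⟩,
    fun x hx => SameCircle.of (SurgerySystem.Rel.vert (σ := σ) (.inl x) ((hc x).2 hx)),
    fun x hx => ⟨SameCircle.of (SurgerySystem.Rel.arc (σ := σ) (.inr x) false
        (fun h => hx ((hb x).1 h))),
      SameCircle.of (SurgerySystem.Rel.arc (σ := σ) (.inr x) true (fun h => hx ((hb x).1 h)))⟩,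
    fun x hx => SameCircle.of (SurgerySystem.Rel.vert (σ := σ) (.inr x) ((hb x).2 hx))⟩
  intro x y hxy
  rcases ρ.rel _ _ hxy with rfl | ⟨h1, rfl⟩
  · exact SameCircle.of (SurgerySystem.Rel.o (σ := σ) (.inr (.inr x)))
  · refine SameCircle.of (SurgerySystem.Rel.e (σ := σ) (.inr (.inr x)) ?_)
    rintro (k | k) (_ | _)
    · simp [σ, system₂]
    · simp [σ, system₂]
    · simp [σ, system₂]
    · simpa [σ, system₂] using h1 k

theorem system₂_map {U : Type} {R' : U → U → Prop} {L : List (P ⊕ P)} {Lc Lb : List P}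
    (hc : ∀ x, Surg (Sum.map c b) L (.inl x) ↔ Surg c Lc x)
    (hb : ∀ x, Surg (Sum.map c b) L (.inr x) ↔ Surg b Lb x)
    (f g h : P → U) (i : V → U)
    (h1 : ∀ x, SameCircle R' (f x) (f (d x)))
    (h2 : ∀ x, SameCircle R' (g x) (h x))
    (h3 : ∀ x y, R x y → SameCircle R' (i x) (i y))
    (h4 : ∀ x, ¬ Surg c Lc x → SameCircle R' (f x) (f (c x)) ∧ SameCircle R' (g x) (g (c x)))
    (h5 : ∀ x, Surg c Lc x → SameCircle R' (f x) (g x))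
    (h6 : ∀ x, ¬ Surg b Lb x → SameCircle R' (h x) (h (b x)) ∧
      SameCircle R' (i (bd x)) (i (bd (b x))))
    (h7 : ∀ x, Surg b Lb x → SameCircle R' (h x) (i (bd x))) (x y : P ⊕ (P ⊕ P) ⊕ V)
    (hxy : (ρ.system₂ d c b).Rel L x y) :
    SameCircle R' (Sum.elim f (Sum.elim (Sum.elim g h) i) x)
      (Sum.elim f (Sum.elim (Sum.elim g h) i) y) := by
  cases hxy with
  | o =>
    rcases x with x | (x | x) | x
    · exact h1 x
    · exact h2 x
    · exact (h2 x).symm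
    · exact h3 _ _ (ρ.rel_o x)
  | e _ h' =>
    rcases x with x | (x | x) | x
    · rfl
    · rfl
    · rfl
    · exact h3 _ _ (ρ.rel_e x (fun p hp => h' (.inr p) true (by simp [system₂, hp])))
  | arc k l h' =>
    rcases k with k | k <;> cases l
    · exact (h4 k (fun h => h' ((hc k).2 h))).1
    · exact (h4 k (fun h => h' ((hc k).2 h))).2
    · exact (h6 k (fun h => h' ((hb k).2 h))).1
    · exact (h6 k (fun h => h' ((hb k).2 h))).2
  | vert k h' =>
    rcases k with k | k
    · exact h5 k ((hc k).1 h')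
    · exact h7 k ((hb k).1 h')

/-- The collapse of all the layers of a double contraction. -/
def collapse₂ (bd : P → V) : P ⊕ (P ⊕ P) ⊕ V → V :=
  Sum.elim bd (Sum.elim (Sum.elim bd bd) id)

theorem prod_left_first (L : List P) :
    rename (collapse₂ bd) ((ρ.system₂ d c b).prod (L.map Sum.inl)) =
      rename bd (rename (collapse (id : P → P)) (saddles b.Graph id d c L)) := by
  induction L with
  | nil => simp [SurgerySystem.prod, saddles]
  | cons p L ih =>
    simp only [List.map_cons, SurgerySystem.prod, saddles, map_mul, ih]
    congr 1
    rw [rename_rename]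
    have hs := surg_append c b (p :: L) []
    simp only [List.map_nil, List.append_nil] at hs
    refine rename_saddleFactor _ _ ?_ rfl rfl
    obtain ⟨k1, k2, k3, k4, k5, k6, k7⟩ := ρ.system₂_rel d c b hs.1 hs.2.1
    have hn : ∀ x, ¬ Surg b [] x := by simp [Surg]
    refine SameCircle.iff_of_retract (a := Sum.inl p) (b := Sum.inl (c p))
      (Sum.elim Sum.inl (Sum.elim (Sum.elim Sum.inr Sum.inr) (fun _ => Sum.inl p)))
      (Sum.elim Sum.inl (fun x => Sum.inr (Sum.inl (Sum.inl x)))) ?_ ?_ rfl rfl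
    · refine ρ.system₂_map d c b hs.1 hs.2.1 _ _ _ _ (fun x => SameCircle.of (.upper x))
        (fun x => rfl) (fun _ _ _ => rfl)
        (fun x hx => ⟨SameCircle.of (.arcUpper x hx), SameCircle.of (.arcLower x hx)⟩)
        (fun x hx => SameCircle.of (.vertical x hx)) (fun x _ => ⟨?_, rfl⟩)
        (fun x hx => absurd hx (hn x))
      exact SameCircle.of (.lower (show Matching.Graph b x (b x) from rfl))
    · intro x y hxy
      cases hxy with
      | upper x => exact k1 x
      | lower h => cases h; exact (k2 _).trans (((k6 _ (hn _)).1).trans (k2 _).symm)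
      | arcUpper x h => exact (k4 x h).1
      | arcLower x h => exact (k4 x h).2
      | vertical x h => exact k5 x h

theorem prod_left_second [Fintype P] (L : List P) :
    rename (collapse₂ bd) ((ρ.system₂ d c b).prod (L.map Sum.inr ++ c.arcs.map Sum.inl)) =
      rename (collapse bd) (saddles R bd d b L) *
        rename (collapse₂ bd) ((ρ.system₂ d c b).prod (c.arcs.map Sum.inl)) := by
  induction L with
  | nil => simp [saddles]
  | cons p L ih =>
    simp only [List.map_cons, List.cons_append, SurgerySystem.prod, saddles, map_mul, ih]
    rw [mul_assoc]
    congr 1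
    have hs := surg_append c b c.arcs (p :: L)
    refine rename_saddleFactor _ _ ?_ rfl rfl
    obtain ⟨k1, k2, k3, k4, k5, k6, k7⟩ := ρ.system₂_rel d c b hs.2.2.1 hs.2.2.2
    have hn : ∀ x, Surg c c.arcs x := c.surg_arcs
    refine SameCircle.iff_of_retract (a := Sum.inl p) (b := Sum.inl (b p))
      (Sum.elim Sum.inl (Sum.elim (Sum.elim Sum.inl Sum.inl) Sum.inr))
      (Sum.elim (fun x => Sum.inr (Sum.inl (Sum.inr x))) (fun x => Sum.inr (Sum.inr x)))
      ?_ ?_ rfl rfl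
    · exact ρ.system₂_map d c b hs.2.2.1 hs.2.2.2 _ _ _ _ (fun x => SameCircle.of (.upper x))
        (fun x => rfl) (fun _ _ h => SameCircle.of (.lower h))
        (fun x hx => absurd (hn x) hx) (fun x hx => rfl)
        (fun x hx => ⟨SameCircle.of (.arcUpper x hx), SameCircle.of (.arcLower x hx)⟩)
        (fun x hx => SameCircle.of (.vertical x hx))
    · have k8 : ∀ x, SameCircle ((ρ.system₂ d c b).Rel
          ((p :: L).map Sum.inr ++ c.arcs.map Sum.inl)) (.inl x) (.inr (.inl (.inr x))) :=
        fun x => (k5 x (hn x)).trans (k2 x)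
      intro x y hxy
      cases hxy with
      | upper x => exact (k8 x).symm.trans ((k1 x).trans (k8 _))
      | lower h => exact k3 _ _ h
      | arcUpper x h => exact (k6 x h).1
      | arcLower x h => exact (k6 x h).2
      | vertical x h => exact k7 x h

theorem prod_right_first (L : List P) :
    rename (collapse₂ bd) ((ρ.system₂ d c b).prod (L.map Sum.inr)) =
      rename (collapse bd) (saddles R bd c b L) := by
  induction L with
  | nil => simp [SurgerySystem.prod, saddles]
  | cons p L ih =>
    simp only [List.map_cons, SurgerySystem.prod, saddles, map_mul, ih]
    congr 1
    have hs := surg_append c b [] (p :: L)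
    simp only [List.map_nil, List.nil_append] at hs
    refine rename_saddleFactor _ _ ?_ rfl rfl
    obtain ⟨k1, k2, k3, k4, k5, k6, k7⟩ := ρ.system₂_rel d c b hs.1 hs.2.1
    have hn : ∀ x, ¬ Surg c [] x := by simp [Surg]
    refine SameCircle.iff_of_retract (a := Sum.inl p) (b := Sum.inl (b p))
      (Sum.elim (fun _ => Sum.inl p) (Sum.elim (Sum.elim Sum.inl Sum.inl) Sum.inr))
      (Sum.elim (fun x => Sum.inr (Sum.inl (Sum.inr x))) (fun x => Sum.inr (Sum.inr x)))
      ?_ ?_ rfl rfl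
    · exact ρ.system₂_map d c b hs.1 hs.2.1 _ _ _ _ (fun _ => rfl)
        (fun x => rfl) (fun _ _ h => SameCircle.of (.lower h))
        (fun x hx => ⟨rfl, SameCircle.of (.upper x)⟩) (fun x hx => absurd hx (hn x))
        (fun x hx => ⟨SameCircle.of (.arcUpper x hx), SameCircle.of (.arcLower x hx)⟩)
        (fun x hx => SameCircle.of (.vertical x hx))
    · intro x y hxy
      cases hxy with
      | upper x => exact (k2 _).symm.trans (((k4 x (hn x)).2).trans (k2 _))
      | lower h => exact k3 _ _ h
      | arcUpper x h => exact (k6 x h).1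
      | arcLower x h => exact (k6 x h).2
      | vertical x h => exact k7 x h

theorem prod_right_second [Fintype P] (L : List P) :
    rename (collapse₂ bd) ((ρ.system₂ d c b).prod (L.map Sum.inl ++ b.arcs.map Sum.inr)) =
      rename (collapse bd) (saddles R bd d c L) *
        rename (collapse₂ bd) ((ρ.system₂ d c b).prod (b.arcs.map Sum.inr)) := by
  induction L with
  | nil => simp [saddles]
  | cons p L ih =>
    simp only [List.map_cons, List.cons_append, SurgerySystem.prod, saddles, map_mul, ih]
    rw [mul_assoc]
    congr 1
    have hs := surg_append c b (p :: L) b.arcs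
    refine rename_saddleFactor _ _ ?_ rfl rfl
    obtain ⟨k1, k2, k3, k4, k5, k6, k7⟩ := ρ.system₂_rel d c b hs.1 hs.2.1
    have hn : ∀ x, Surg b b.arcs x := b.surg_arcs
    refine SameCircle.iff_of_retract (a := Sum.inl p) (b := Sum.inl (c p))
      (Sum.elim Sum.inl (Sum.elim (Sum.elim (fun x => Sum.inr (bd x)) (fun x => Sum.inr (bd x)))
        Sum.inr))
      (Sum.elim Sum.inl (fun x => Sum.inr (Sum.inr x)))
      ?_ ?_ rfl rfl
    · exact ρ.system₂_map d c b hs.1 hs.2.1 _ _ _ _ (fun x => SameCircle.of (.upper x))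
        (fun x => rfl) (fun _ _ h => SameCircle.of (.lower h))
        (fun x hx => ⟨SameCircle.of (.arcUpper x hx), SameCircle.of (.arcLower x hx)⟩)
        (fun x hx => SameCircle.of (.vertical x hx))
        (fun x hx => absurd (hn x) hx)
        (fun x hx => rfl)
    · have k8 : ∀ x, SameCircle ((ρ.system₂ d c b).Rel
          ((p :: L).map Sum.inl ++ b.arcs.map Sum.inr)) (.inr (.inl (.inl x)))
            (.inr (.inr (bd x))) :=
        fun x => (k2 x).trans (k7 x (hn x))
      intro x y hxy
      cases hxy with
      | upper x => exact k1 x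
      | lower h => exact k3 _ _ h
      | arcUpper x h => exact (k4 x h).1
      | arcLower x h => exact (k8 x).symm.trans (((k4 x h).2).trans (k8 _))
      | vertical x h => exact (k5 x h).trans (k8 x)

/-- Associativity of the contraction maps. -/
theorem contractPoly_assoc [Fintype P] [Fintype V] (ρ : Regular R bd) (d c b : Matching P)
    (f g : MvPolynomial P ℤ) (h : MvPolynomial V ℤ) :
    contractPoly R bd d b (contractPoly b.Graph id d c f g) h -
      contractPoly R bd d c f (contractPoly R bd c b g h) ∈ circleIdeal (Closure R bd d) := by
  have e1 := ρ.prod_left_second d c b b.arcs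
  rw [ρ.prod_left_first d c b] at e1
  have e2 := ρ.prod_right_second d c b c.arcs
  rw [ρ.prod_right_first d c b] at e2
  have hv := (ρ.system₂ d c b).valid_append c b rfl c.valid_arcs b.valid_arcs
  have hp := (ρ.system₂ d c b).prod_perm List.perm_append_comm hv
  have hs := surg_append c b c.arcs b.arcs
  have hm := circleIdeal_map_le (R' := Closure R bd d) (collapse₂ bd)
    (ρ.system₂_map d c b hs.1 hs.2.1 _ _ _ _ (fun x => SameCircle.of (.arc x)) (fun x => rfl)
      (fun x y h => SameCircle.of (.inner h)) (fun x hx => absurd (c.surg_arcs x) hx)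
      (fun x _ => rfl) (fun x hx => absurd (b.surg_arcs x) hx) (fun x _ => rfl)) hp
  change rename (collapse₂ bd) _ ∈ _ at hm
  rw [map_sub, e1, e2] at hm
  simp only [contractPoly_eq, map_mul, rename_id, AlgHom.coe_id, id_eq]
  have := Ideal.mul_mem_left _ (-(rename bd f * rename bd g * h)) hm
  convert this using 1
  ring

end Regular

section Unit

open MvPolynomial

variable {P V : Type} [LinearOrder P] {R : V → V → Prop} {bd : P → V}

theorem contractPoly_one_left [Fintype P] (b : Matching P) (g : MvPolynomial V ℤ) :
    contractPoly R bd b b 1 g = g := by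
  have : ∀ L, saddles R bd b b L = 1 := by
    intro L
    induction L with
    | nil => rfl
    | cons p L ih =>
      rw [saddles, ih, saddleFactor, if_pos (SameCircle.of (.upper p)), mul_one]
  rw [contractPoly_eq, this]
  simp

theorem contractPoly_one_right [Fintype P] (c a : Matching P) (f : MvPolynomial P ℤ) :
    contractPoly a.Graph id c a f 1 = f := by
  have : ∀ L, saddles a.Graph id c a L = 1 := by
    intro L
    induction L with
    | nil => rfl
    | cons p L ih =>
      have h1 : Surg a (p :: L) p := Or.inl (List.mem_cons_self ..)
      have h2 : Surg a (p :: L) (a p) := Or.inr (by rw [a.invol]; exact List.mem_cons_self ..)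
      rw [saddles, ih, saddleFactor, if_pos, mul_one]
      exact (SameCircle.of (.vertical p h1)).trans ((SameCircle.of (.lower rfl)).trans
        (SameCircle.of (.vertical (a p) h2)).symm)
  rw [contractPoly_eq, this]
  simp

theorem closure_graph_symm (c a : Matching P) :
    Closure a.Graph id c = Closure c.Graph id a := by
  have : ∀ a c : Matching P, ∀ x y, Closure a.Graph id c x y → Closure c.Graph id a x y := by
    rintro a c x y (h | ⟨p⟩)
    · cases h; exact .arc x
    · exact .inner rfl
  funext x y
  exact propext ⟨this a c x y, this c a x y⟩

/-- Contractions are compatible with the reflection. -/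
theorem contractPoly_symm [Fintype P] (a d e : Matching P) (f g : MvPolynomial P ℤ) :
    contractPoly a.Graph id e d f g = contractPoly e.Graph id a d g f := by
  have key : ∀ a e : Matching P, ∀ L x y, Contracting a.Graph id e d L x y →
      SameCircle (Contracting e.Graph id a d L) x.swap y.swap := by
    rintro a e L x y h
    cases h with
    | upper p => exact SameCircle.of (.lower rfl)
    | lower h => cases h; exact SameCircle.of (.upper _)
    | arcUpper p h => exact SameCircle.of (.arcLower p h)
    | arcLower p h => exact SameCircle.of (.arcUpper p h)
    | vertical p h => exact (SameCircle.of (.vertical p h)).symm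
  have hs : ∀ L, rename (collapse (id : P → P)) (saddles a.Graph id e d L) =
      rename (collapse id) (saddles e.Graph id a d L) := by
    intro L
    induction L with
    | nil => simp [saddles]
    | cons p L ih =>
      simp only [saddles, map_mul, ih]
      congr 1
      refine Regular.rename_saddleFactor _ _ ?_ rfl rfl
      have h1 : Surg d (p :: L) p := Or.inl (List.mem_cons_self ..)
      have h2 : Surg d (p :: L) (d p) := Or.inr (by rw [d.invol]; exact List.mem_cons_self ..)
      have k : ∀ a e : Matching P, SameCircle (Contracting a.Graph id e d (p :: L)) (.inl p)
          (.inl (d p)) → SameCircle (Contracting e.Graph id a d (p :: L)) (.inl p)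
          (.inl (d p)) := by
        intro a e h
        exact (SameCircle.of (.vertical p h1)).trans ((h.map Sum.swap (key a e _)).trans
          (SameCircle.of (.vertical (d p) h2)).symm)
      exact ⟨k a e, k e a⟩
  rw [contractPoly_eq, contractPoly_eq, hs]
  simp only [rename_id, AlgHom.coe_id, id_eq]
  ring

end Unit

/-- Flat tangles without closed components, with bottom end points `P` and top end points `Q`:
crossingless matchings of the end points, where the boundary of the strip is traversed along the
bottom from left to right and then along the top from right to left. -/
abbrev FlatTangle (P Q : Type) [LinearOrder P] [LinearOrder Q] : Type := Matching (P ⊕ₗ Qᵒᵈ)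

/-- The bottom end points of a flat tangle. -/
def botPt {P Q : Type} (p : P) : P ⊕ₗ Qᵒᵈ := toLex (.inl p)

/-- The top end points of a flat tangle. -/
def topPt {P Q : Type} (q : Q) : P ⊕ₗ Qᵒᵈ := toLex (.inr (OrderDual.toDual q))

section Tangle

open MvPolynomial

variable {P Q : Type}

theorem botPt_or_topPt (x : P ⊕ₗ Qᵒᵈ) : (∃ p, botPt p = x) ∨ (∃ q, topPt q = x) := by
  rcases h : ofLex x with p | q
  · exact Or.inl ⟨p, by rw [botPt, ← h]; rfl⟩
  · exact Or.inr ⟨OrderDual.ofDual q, by rw [topPt, OrderDual.toDual_ofDual, ← h]; rfl⟩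

theorem botPt_injective : Function.Injective (botPt : P → P ⊕ₗ Qᵒᵈ) := fun p q h => by
  simpa [botPt] using h

theorem topPt_injective : Function.Injective (topPt : Q → P ⊕ₗ Qᵒᵈ) := fun p q h => by
  simpa [topPt] using h

theorem botPt_ne_topPt (p : P) (q : Q) : (botPt p : P ⊕ₗ Qᵒᵈ) ≠ topPt q := fun h => by
  simp [botPt, topPt] at h

variable [LinearOrder P] [LinearOrder Q] [Fintype P] [Fintype Q]

theorem colour_bot (p : P) : Matching.colour (botPt p : P ⊕ₗ Qᵒᵈ) = Matching.colour p := by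
  classical
  unfold Matching.colour
  congr 3
  have : Finset.univ.filter (fun x : P ⊕ₗ Qᵒᵈ => x < botPt p) =
      (Finset.univ.filter (fun q : P => q < p)).map ⟨botPt, botPt_injective⟩ := by
    ext x
    simp only [Finset.mem_filter, Finset.mem_univ, true_and, Finset.mem_map,
      Function.Embedding.coeFn_mk]
    rcases botPt_or_topPt x with ⟨y, rfl⟩ | ⟨y, rfl⟩
    · constructor
      · intro h; exact ⟨y, by simpa [botPt] using h, rfl⟩
      · rintro ⟨z, hz, h⟩; rw [botPt_injective h] at hz; simpa [botPt] using hz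
    · constructor
      · intro h; simp [botPt, topPt] at h
      · rintro ⟨z, hz, h⟩; exact absurd h (botPt_ne_topPt z y)
  rw [this, Finset.card_map]

theorem colour_top (q : Q) : Matching.colour (topPt q : P ⊕ₗ Qᵒᵈ) =
    decide ((Fintype.card P + Fintype.card Q + 1) % 2 =
      (Finset.univ.filter (fun x : Q => x < q)).card % 2) := by
  classical
  unfold Matching.colour
  have h1 : Finset.univ.filter (fun x : P ⊕ₗ Qᵒᵈ => x < topPt q) =
      (Finset.univ.map ⟨botPt, botPt_injective⟩) ∪
      (Finset.univ.filter (fun x : Q => q < x)).map ⟨topPt, topPt_injective⟩ := by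
    ext x
    simp only [Finset.mem_filter, Finset.mem_univ, true_and, Finset.mem_map, Finset.mem_union,
      Function.Embedding.coeFn_mk]
    rcases botPt_or_topPt x with ⟨y, rfl⟩ | ⟨y, rfl⟩
    · constructor
      · intro h; exact Or.inl ⟨y, rfl⟩
      · intro h; simp [botPt, topPt]
    · constructor
      · intro h; exact Or.inr ⟨y, by simpa [topPt] using h, rfl⟩
      · rintro (⟨z, h⟩ | ⟨z, hz, h⟩)
        · exact absurd h (botPt_ne_topPt z y)
        · rw [topPt_injective h] at hz; simpa [topPt] using hz
  have h2 : (Finset.univ.filter (fun x : P ⊕ₗ Qᵒᵈ => x < topPt q)).card =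
      Fintype.card P + (Finset.univ.filter (fun x : Q => q < x)).card := by
    rw [h1, Finset.card_union_of_disjoint, Finset.card_map, Finset.card_map, Finset.card_univ]
    rw [Finset.disjoint_left]
    intro x hx hx'
    simp only [Finset.mem_map, Finset.mem_univ, true_and, Function.Embedding.coeFn_mk] at hx hx'
    obtain ⟨y, rfl⟩ := hx
    obtain ⟨z, _, hz⟩ := hx'
    exact botPt_ne_topPt y z hz.symm
  have h3 : (Finset.univ.filter (fun x : Q => q < x)).card +
      (Finset.univ.filter (fun x : Q => x < q)).card + 1 = Fintype.card Q := by
    have : (Finset.univ : Finset Q) = insert q (Finset.univ.filter (fun x : Q => q < x) ∪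
        Finset.univ.filter (fun x : Q => x < q)) := by
      ext x
      simp only [Finset.mem_filter, Finset.mem_univ, true_and, Finset.mem_insert,
        Finset.mem_union, true_iff]
      rcases lt_trichotomy x q with h | h | h
      · exact Or.inr (Or.inr h)
      · exact Or.inl h
      · exact Or.inr (Or.inl h)
    rw [← Finset.card_univ, this, Finset.card_insert_of_notMem (by simp),
      Finset.card_union_of_disjoint]
    · rw [← this]
    · rw [Finset.disjoint_left]
      intro x hx hx'
      simp only [Finset.mem_filter, Finset.mem_univ, true_and] at hx hx'
      exact lt_asymm hx hx'
  rw [h2, decide_eq_decide]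
  omega

theorem colour_bot_ne (a : Matching P) (p : P) : Matching.colour (botPt (a p) : P ⊕ₗ Qᵒᵈ) ≠
    Matching.colour (botPt p : P ⊕ₗ Qᵒᵈ) := by
  rw [colour_bot, colour_bot]; exact a.colour_ne p

theorem colour_top_ne (a : Matching Q) (p : Q) : Matching.colour (topPt (a p) : P ⊕ₗ Qᵒᵈ) ≠
    Matching.colour (topPt p : P ⊕ₗ Qᵒᵈ) := by
  have := a.colour_ne p
  unfold Matching.colour at this
  rw [colour_top, colour_top]
  rw [ne_eq, decide_eq_decide] at this ⊢
  omega

/-- The surgeries of a contraction at the top and of a contraction at the bottom. -/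
def tangleSystem (T : FlatTangle P Q) (c b : Matching Q) (d a : Matching P) :
    SurgerySystem (Q ⊕ (P ⊕ₗ Qᵒᵈ) ⊕ P) (Q ⊕ P) where
  o := Sum.map c (Sum.map T d)
  e := id
  β := Sum.map b a
  pt k l := match k, l with
    | .inl q, false => .inl q
    | .inl q, true => .inr (.inl (topPt q))
    | .inr p, false => .inr (.inr p)
    | .inr p, true => .inr (.inl (botPt p))
  col := Sum.elim (fun q => !Matching.colour (topPt q : P ⊕ₗ Qᵒᵈ)) (Sum.elim Matching.colour
    (fun p => !Matching.colour (botPt p : P ⊕ₗ Qᵒᵈ)))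
  oo := by rintro (x | x | x) <;> simp [d.invol, c.invol, T.invol]
  ββ := by rintro (x | x) <;> simp [a.invol, b.invol]
  ne := by rintro (x | x) <;> simp [a.ne, b.ne]
  inj := by
    rintro (k | k) (_ | _) (k' | k') (_ | _) h <;>
    first
    | (simp at h; done)
    | (simpa using h)
    | (simpa using topPt_injective (by simpa using h))
    | (simpa using botPt_injective (by simpa using h))
    | exact absurd (by simpa using h) (botPt_ne_topPt _ _)
    | exact absurd (by simpa using h.symm) (botPt_ne_topPt _ _)
  ee := by
    rintro (x | x | x) h
    · exact absurd rfl (h (.inl x) false)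
    · rcases botPt_or_topPt x with ⟨y, rfl⟩ | ⟨y, rfl⟩
      · exact absurd rfl (h (.inr y) true)
      · exact absurd rfl (h (.inl y) true)
    · exact absurd rfl (h (.inr x) false)
  co := by
    rintro (x | x | x)
    · simpa using colour_top_ne c x
    · exact T.colour_ne x
    · simpa using colour_bot_ne d x
  cβ := by
    rintro (k | k) (_ | _)
    · simpa using colour_top_ne b k
    · exact colour_top_ne b k
    · simpa using colour_bot_ne a k
    · exact colour_bot_ne a k
  cv := by rintro (k | k) <;> simp

section TangleSystem

variable (T : FlatTangle P Q) (c b : Matching Q) (d a : Matching P)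

theorem tangleSystem_rel {L : List (Q ⊕ P)} {Lb : List Q} {La : List P}
    (hb : ∀ x, Surg (Sum.map b a) L (.inl x) ↔ Surg b Lb x)
    (ha : ∀ x, Surg (Sum.map b a) L (.inr x) ↔ Surg a La x) :
    (∀ x, SameCircle ((tangleSystem T c b d a).Rel L) (.inl x) (.inl (c x))) ∧
    (∀ x, SameCircle ((tangleSystem T c b d a).Rel L) (.inr (.inl x)) (.inr (.inl (T x)))) ∧
    (∀ x, SameCircle ((tangleSystem T c b d a).Rel L) (.inr (.inr x)) (.inr (.inr (d x)))) ∧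
    (∀ x, ¬ Surg b Lb x →
      SameCircle ((tangleSystem T c b d a).Rel L) (.inl x) (.inl (b x)) ∧
      SameCircle ((tangleSystem T c b d a).Rel L) (.inr (.inl (topPt x)))
        (.inr (.inl (topPt (b x))))) ∧
    (∀ x, Surg b Lb x →
      SameCircle ((tangleSystem T c b d a).Rel L) (.inl x) (.inr (.inl (topPt x)))) ∧
    (∀ x, ¬ Surg a La x →
      SameCircle ((tangleSystem T c b d a).Rel L) (.inr (.inr x)) (.inr (.inr (a x))) ∧
      SameCircle ((tangleSystem T c b d a).Rel L) (.inr (.inl (botPt x)))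
        (.inr (.inl (botPt (a x))))) ∧
    (∀ x, Surg a La x →
      SameCircle ((tangleSystem T c b d a).Rel L) (.inr (.inr x)) (.inr (.inl (botPt x)))) := by
  let σ := tangleSystem T c b d a
  exact ⟨fun x => SameCircle.of (SurgerySystem.Rel.o (σ := σ) (.inl x)),
    fun x => SameCircle.of (SurgerySystem.Rel.o (σ := σ) (.inr (.inl x))),
    fun x => SameCircle.of (SurgerySystem.Rel.o (σ := σ) (.inr (.inr x))),
    fun x hx => ⟨SameCircle.of (SurgerySystem.Rel.arc (σ := σ) (.inl x) false
        (fun h => hx ((hb x).1 h))),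
      SameCircle.of (SurgerySystem.Rel.arc (σ := σ) (.inl x) true (fun h => hx ((hb x).1 h)))⟩,
    fun x hx => SameCircle.of (SurgerySystem.Rel.vert (σ := σ) (.inl x) ((hb x).2 hx)),
    fun x hx => ⟨SameCircle.of (SurgerySystem.Rel.arc (σ := σ) (.inr x) false
        (fun h => hx ((ha x).1 h))),
      SameCircle.of (SurgerySystem.Rel.arc (σ := σ) (.inr x) true (fun h => hx ((ha x).1 h)))⟩,
    fun x hx => SameCircle.of (SurgerySystem.Rel.vert (σ := σ) (.inr x) ((ha x).2 hx))⟩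

theorem tangleSystem_map {U : Type} {R' : U → U → Prop} {L : List (Q ⊕ P)} {Lb : List Q}
    {La : List P}
    (hb : ∀ x, Surg (Sum.map b a) L (.inl x) ↔ Surg b Lb x)
    (ha : ∀ x, Surg (Sum.map b a) L (.inr x) ↔ Surg a La x)
    (f : Q → U) (g : P ⊕ₗ Qᵒᵈ → U) (h : P → U)
    (h1 : ∀ x, SameCircle R' (f x) (f (c x)))
    (h2 : ∀ x, SameCircle R' (g x) (g (T x)))
    (h3 : ∀ x, SameCircle R' (h x) (h (d x)))
    (h4 : ∀ x, ¬ Surg b Lb x → SameCircle R' (f x) (f (b x)) ∧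
      SameCircle R' (g (topPt x)) (g (topPt (b x))))
    (h5 : ∀ x, Surg b Lb x → SameCircle R' (f x) (g (topPt x)))
    (h6 : ∀ x, ¬ Surg a La x → SameCircle R' (h x) (h (a x)) ∧
      SameCircle R' (g (botPt x)) (g (botPt (a x))))
    (h7 : ∀ x, Surg a La x → SameCircle R' (h x) (g (botPt x))) (x y : Q ⊕ (P ⊕ₗ Qᵒᵈ) ⊕ P)
    (hxy : (tangleSystem T c b d a).Rel L x y) :
    SameCircle R' (Sum.elim f (Sum.elim g h) x) (Sum.elim f (Sum.elim g h) y) := by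
  cases hxy with
  | o =>
    rcases x with x | x | x
    · exact h1 x
    · exact h2 x
    · exact h3 x
  | e _ h' => rfl
  | arc k l h' =>
    rcases k with k | k <;> cases l
    · exact (h4 k (fun h => h' ((hb k).2 h))).1
    · exact (h4 k (fun h => h' ((hb k).2 h))).2
    · exact (h6 k (fun h => h' ((ha k).2 h))).1
    · exact (h6 k (fun h => h' ((ha k).2 h))).2
  | vert k h' =>
    rcases k with k | k
    · exact h5 k ((hb k).1 h')
    · exact h7 k ((ha k).1 h')

/-- The identification of the copies of the end points after both contractions. -/
def tangleCollapse : Q ⊕ (P ⊕ₗ Qᵒᵈ) ⊕ P → P ⊕ₗ Qᵒᵈ := Sum.elim topPt (Sum.elim id botPt)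

theorem tangle_top_first (L : List Q) :
    rename tangleCollapse ((tangleSystem T c b d a).prod (L.map Sum.inl)) =
      rename (collapse topPt) (saddles (Closure T.Graph botPt a) topPt c b L) := by
  induction L with
  | nil => simp [SurgerySystem.prod, saddles]
  | cons p L ih =>
    simp only [List.map_cons, SurgerySystem.prod, saddles, map_mul, ih]
    congr 1
    have hs := surg_append b a (p :: L) []
    simp only [List.map_nil, List.append_nil] at hs
    refine Regular.rename_saddleFactor _ _ ?_ rfl rfl
    obtain ⟨k1, k2, k3, k4, k5, k6, k7⟩ := tangleSystem_rel T c b d a hs.1 hs.2.1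
    have hn : ∀ x, ¬ Surg a [] x := by simp [Surg]
    refine SameCircle.iff_of_retract (a := Sum.inl p) (b := Sum.inl (b p))
      (Sum.elim Sum.inl (Sum.elim Sum.inr (fun _ => Sum.inl p)))
      (Sum.elim Sum.inl (fun x => Sum.inr (Sum.inl x))) ?_ ?_ rfl rfl
    · exact tangleSystem_map T c b d a hs.1 hs.2.1 _ _ _ (fun x => SameCircle.of (.upper x))
        (fun x => SameCircle.of (.lower (.inner rfl))) (fun _ => rfl)
        (fun x hx => ⟨SameCircle.of (.arcUpper x hx), SameCircle.of (.arcLower x hx)⟩)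
        (fun x hx => SameCircle.of (.vertical x hx))
        (fun x _ => ⟨rfl, SameCircle.of (.lower (.arc x))⟩) (fun x hx => absurd hx (hn x))
    · intro x y hxy
      cases hxy with
      | upper x => exact k1 x
      | lower h =>
        cases h with
        | inner h => cases h; exact k2 _
        | arc x => exact (k6 x (hn x)).2
      | arcUpper x h => exact (k4 x h).1
      | arcLower x h => exact (k4 x h).2
      | vertical x h => exact k5 x h

theorem tangle_bot_first (L : List P) :
    rename tangleCollapse ((tangleSystem T c b d a).prod (L.map Sum.inr)) =
      rename (collapse botPt) (saddles (Closure T.Graph topPt b) botPt d a L) := by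
  induction L with
  | nil => simp [SurgerySystem.prod, saddles]
  | cons p L ih =>
    simp only [List.map_cons, SurgerySystem.prod, saddles, map_mul, ih]
    congr 1
    have hs := surg_append b a [] (p :: L)
    simp only [List.map_nil, List.nil_append] at hs
    refine Regular.rename_saddleFactor _ _ ?_ rfl rfl
    obtain ⟨k1, k2, k3, k4, k5, k6, k7⟩ := tangleSystem_rel T c b d a hs.1 hs.2.1
    have hn : ∀ x, ¬ Surg b [] x := by simp [Surg]
    refine SameCircle.iff_of_retract (a := Sum.inl p) (b := Sum.inl (a p))
      (Sum.elim (fun _ => Sum.inl p) (Sum.elim Sum.inr Sum.inl))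
      (Sum.elim (fun x => Sum.inr (Sum.inr x)) (fun x => Sum.inr (Sum.inl x))) ?_ ?_ rfl rfl
    · exact tangleSystem_map T c b d a hs.1 hs.2.1 _ _ _ (fun x => rfl)
        (fun x => SameCircle.of (.lower (.inner rfl))) (fun x => SameCircle.of (.upper x))
        (fun x _ => ⟨rfl, SameCircle.of (.lower (.arc x))⟩) (fun x hx => absurd hx (hn x))
        (fun x hx => ⟨SameCircle.of (.arcUpper x hx), SameCircle.of (.arcLower x hx)⟩)
        (fun x hx => SameCircle.of (.vertical x hx))
    · intro x y hxy
      cases hxy with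
      | upper x => exact k3 x
      | lower h =>
        cases h with
        | inner h => cases h; exact k2 _
        | arc x => exact (k4 x (hn x)).2
      | arcUpper x h => exact (k6 x h).1
      | arcLower x h => exact (k6 x h).2
      | vertical x h => exact k7 x h

theorem tangle_bot_second (L : List P) :
    rename tangleCollapse ((tangleSystem T c b d a).prod
      (L.map Sum.inr ++ b.arcs.map Sum.inl)) =
      rename (collapse botPt) (saddles (Closure T.Graph topPt c) botPt d a L) *
        rename tangleCollapse ((tangleSystem T c b d a).prod (b.arcs.map Sum.inl)) := by
  induction L with
  | nil => simp [saddles]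
  | cons p L ih =>
    simp only [List.map_cons, List.cons_append, SurgerySystem.prod, saddles, map_mul, ih]
    rw [mul_assoc]
    congr 1
    have hs := surg_append b a b.arcs (p :: L)
    refine Regular.rename_saddleFactor _ _ ?_ rfl rfl
    obtain ⟨k1, k2, k3, k4, k5, k6, k7⟩ := tangleSystem_rel T c b d a hs.2.2.1 hs.2.2.2
    have hn : ∀ x, Surg b b.arcs x := b.surg_arcs
    refine SameCircle.iff_of_retract (a := Sum.inl p) (b := Sum.inl (a p))
      (Sum.elim (fun x => Sum.inr (topPt x)) (Sum.elim Sum.inr Sum.inl))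
      (Sum.elim (fun x => Sum.inr (Sum.inr x)) (fun x => Sum.inr (Sum.inl x))) ?_ ?_ rfl rfl
    · exact tangleSystem_map T c b d a hs.2.2.1 hs.2.2.2 _ _ _
        (fun x => SameCircle.of (.lower (.arc x)))
        (fun x => SameCircle.of (.lower (.inner rfl))) (fun x => SameCircle.of (.upper x))
        (fun x hx => absurd (hn x) hx) (fun x hx => rfl)
        (fun x hx => ⟨SameCircle.of (.arcUpper x hx), SameCircle.of (.arcLower x hx)⟩)
        (fun x hx => SameCircle.of (.vertical x hx))
    · intro x y hxy
      cases hxy with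
      | upper x => exact k3 x
      | lower h =>
        cases h with
        | inner h => cases h; exact k2 _
        | arc x => exact (k5 x (hn x)).symm.trans ((k1 x).trans (k5 _ (hn _)))
      | arcUpper x h => exact (k6 x h).1
      | arcLower x h => exact (k6 x h).2
      | vertical x h => exact k7 x h

theorem tangle_top_second (L : List Q) :
    rename tangleCollapse ((tangleSystem T c b d a).prod
      (L.map Sum.inl ++ a.arcs.map Sum.inr)) =
      rename (collapse topPt) (saddles (Closure T.Graph botPt d) topPt c b L) *
        rename tangleCollapse ((tangleSystem T c b d a).prod (a.arcs.map Sum.inr)) := by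
  induction L with
  | nil => simp [saddles]
  | cons p L ih =>
    simp only [List.map_cons, List.cons_append, SurgerySystem.prod, saddles, map_mul, ih]
    rw [mul_assoc]
    congr 1
    have hs := surg_append b a (p :: L) a.arcs
    refine Regular.rename_saddleFactor _ _ ?_ rfl rfl
    obtain ⟨k1, k2, k3, k4, k5, k6, k7⟩ := tangleSystem_rel T c b d a hs.1 hs.2.1
    have hn : ∀ x, Surg a a.arcs x := a.surg_arcs
    refine SameCircle.iff_of_retract (a := Sum.inl p) (b := Sum.inl (b p))
      (Sum.elim Sum.inl (Sum.elim Sum.inr (fun x => Sum.inr (botPt x))))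
      (Sum.elim Sum.inl (fun x => Sum.inr (Sum.inl x))) ?_ ?_ rfl rfl
    · exact tangleSystem_map T c b d a hs.1 hs.2.1 _ _ _ (fun x => SameCircle.of (.upper x))
        (fun x => SameCircle.of (.lower (.inner rfl)))
        (fun x => SameCircle.of (.lower (.arc x)))
        (fun x hx => ⟨SameCircle.of (.arcUpper x hx), SameCircle.of (.arcLower x hx)⟩)
        (fun x hx => SameCircle.of (.vertical x hx))
        (fun x hx => absurd (hn x) hx) (fun x hx => rfl)
    · intro x y hxy
      cases hxy with
      | upper x => exact k1 x
      | lower h =>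
        cases h with
        | inner h => cases h; exact k2 _
        | arc x => exact (k7 x (hn x)).symm.trans ((k3 x).trans (k7 _ (hn _)))
      | arcUpper x h => exact (k4 x h).1
      | arcLower x h => exact (k4 x h).2
      | vertical x h => exact k5 x h

/-- Contractions at the top and at the bottom of a flat tangle commute. -/
theorem contractPoly_comm (f : MvPolynomial Q ℤ) (g : MvPolynomial (P ⊕ₗ Qᵒᵈ) ℤ)
    (h : MvPolynomial P ℤ) :
    contractPoly (Closure T.Graph topPt c) botPt d a h
        (contractPoly (Closure T.Graph botPt a) topPt c b f g) -
      contractPoly (Closure T.Graph botPt d) topPt c b f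
        (contractPoly (Closure T.Graph topPt b) botPt d a h g) ∈
      circleIdeal (Closure (Closure T.Graph botPt d) topPt c) := by
  have e1 := tangle_bot_second T c b d a a.arcs
  rw [tangle_top_first] at e1
  have e2 := tangle_top_second T c b d a b.arcs
  rw [tangle_bot_first] at e2
  have : Fintype (P ⊕ₗ Qᵒᵈ) := Fintype.ofFinite _
  have hv := (tangleSystem T c b d a).valid_append b a rfl b.valid_arcs a.valid_arcs
  have hp := (tangleSystem T c b d a).prod_perm List.perm_append_comm hv
  have hs := surg_append b a b.arcs a.arcs
  have hm := circleIdeal_map_le (R' := Closure (Closure T.Graph botPt d) topPt c) tangleCollapse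
    (tangleSystem_map T c b d a hs.1 hs.2.1 _ _ _ (fun x => SameCircle.of (.arc x))
      (fun x => SameCircle.of (.inner (.inner rfl)))
      (fun x => SameCircle.of (.inner (.arc x))) (fun x hx => absurd (b.surg_arcs x) hx)
      (fun x _ => rfl) (fun x hx => absurd (a.surg_arcs x) hx) (fun x _ => rfl)) hp
  change rename tangleCollapse _ ∈ _ at hm
  rw [map_sub, e1, e2] at hm
  simp only [contractPoly_eq]
  have := Ideal.mul_mem_left _ (-(rename topPt f * rename botPt h * g)) hm
  convert this using 1
  ring

end TangleSystem

end Tangle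

section Count

theorem card_quot_join {V : Type} [Finite V] {R R' : V → V → Prop} {a b : V}
    (h1 : ∀ x y, SameCircle R x y → SameCircle R' x y) (h2 : SameCircle R' a b)
    (h3 : ¬ SameCircle R a b)
    (h4 : ∀ x y, SameCircle R' x y → Join (SameCircle R) a b x y) :
    Nat.card (Quot R) = Nat.card (Quot R') + 1 := by
  classical
  have hfin : Finite (Quot R) := inferInstance
  have hfin' : Finite (Quot R') := inferInstance
  let π : Quot R → Quot R' := Quot.lift (Quot.mk R') (fun x y h => h1 x y (SameCircle.of h))
  have hb : Function.Bijective (fun x : {x : Quot R // x ≠ Quot.mk R b} => π x.1) := by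
    constructor
    · rintro ⟨x, hx⟩ ⟨y, hy⟩ hxy
      induction x using Quot.ind with | _ x
      induction y using Quot.ind with | _ y
      apply Subtype.ext
      rcases h4 x y hxy with h | ⟨_, h⟩ | ⟨h, _⟩
      · exact h
      · exact absurd h.symm hy
      · exact absurd h hx
    · intro z
      induction z using Quot.ind with | _ z
      by_cases hz : SameCircle R z b
      · exact ⟨⟨Quot.mk R a, h3⟩, h2.trans (h1 _ _ hz).symm⟩
      · exact ⟨⟨Quot.mk R z, hz⟩, rfl⟩
  rw [← Nat.card_congr (Equiv.ofBijective _ hb), ← Finite.card_option]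
  exact (Nat.card_congr (Equiv.optionSubtypeNe (Quot.mk R b))).symm

theorem card_quot_eq {V W : Type} {R : V → V → Prop} {R' : W → W → Prop} (f : V → W) (g : W → V)
    (hf : ∀ x y, R x y → SameCircle R' (f x) (f y))
    (hg : ∀ x y, R' x y → SameCircle R (g x) (g y))
    (hgf : ∀ x, SameCircle R (g (f x)) x) (hfg : ∀ x, SameCircle R' (f (g x)) x) :
    Nat.card (Quot R) = Nat.card (Quot R') := by
  refine Nat.card_congr ⟨Quot.lift (fun x => Quot.mk R' (f x)) hf,
    Quot.lift (fun x => Quot.mk R (g x)) hg, ?_, ?_⟩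
  · intro x
    induction x using Quot.ind with | _ x
    exact hgf x
  · intro x
    induction x using Quot.ind with | _ x
    exact hfg x

/-- The weights of the variables: the degree of `X` exceeds that of `1` by `2`. -/
def two (V : Type) : V → ℤ := fun _ => 2

open MvPolynomial

theorem rename_weight {V W : Type} (φ : V → W) {f : MvPolynomial V ℤ} {n : ℤ}
    (hf : IsWeightedHomogeneous (two V) f n) :
    IsWeightedHomogeneous (two W) (rename φ f) n := by
  classical
  have h1 : f = ∑ d ∈ f.support, monomial d (coeff d f) := (support_sum_monomial_coeff f).symm
  rw [h1, map_sum]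
  refine IsWeightedHomogeneous.sum _ _ _ ?_
  intro d hd
  rw [rename_monomial]
  apply isWeightedHomogeneous_monomial
  have h2 := hf (mem_support_iff.1 hd)
  have h3 : ∀ (U : Type) (d : U →₀ ℕ), Finsupp.weight (two U) d = (2 : ℤ) * (d.degree : ℤ) := by
    intro U d
    rw [Finsupp.weight_apply, Finsupp.sum, Finsupp.degree_apply, Nat.cast_sum, Finset.mul_sum]
    refine Finset.sum_congr rfl (fun i _ => ?_)
    simp [two, mul_comm]
  rw [h3] at h2 ⊢
  rw [← h2, Finsupp.degree_mapDomain]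

theorem saddleFactor_weight {V : Type} (R : V → V → Prop) (a b : V) :
    (SameCircle R a b → IsWeightedHomogeneous (two V) (saddleFactor R a b) 0) ∧
    (¬ SameCircle R a b → IsWeightedHomogeneous (two V) (saddleFactor R a b) 2) := by
  constructor
  · intro h; rw [saddleFactor, if_pos h]; exact isWeightedHomogeneous_one _ _
  · intro h; rw [saddleFactor, if_neg h]
    exact (isWeightedHomogeneous_X ℤ (two V) a).add (isWeightedHomogeneous_X ℤ (two V) b)

theorem SurgerySystem.prod_weight {V K : Type} [Fintype V] (σ : SurgerySystem V K) (L : List K)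
    (hL : σ.Valid L) : IsWeightedHomogeneous (two V) (σ.prod L)
      ((Nat.card (Quot (σ.Rel L)) : ℤ) - Nat.card (Quot (σ.Rel [])) + L.length) := by
  induction L with
  | nil => simpa [prod] using isWeightedHomogeneous_one ℤ (two V)
  | cons k L ih =>
    have h0 := List.pairwise_cons.1 hL
    have hk : ¬ Surg σ.β L k := by
      rintro (h' | h')
      · exact (h0.1 _ h').1 rfl
      · exact (h0.1 _ h').2 (σ.ββ k).symm
    have ih := ih h0.2
    rw [prod]
    rcases σ.saddle L k hk with ⟨h1, h2, h3⟩ | ⟨h1, h2, h3⟩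
    · have hc := card_quot_join h3
        (SameCircle.of (.vert k (Or.inl (List.mem_cons_self ..)))) h2
        (fun x y h => σ.SameCircle_ge L k hk h)
      convert ((saddleFactor_weight _ _ _).1 h1).mul ih using 1
      rw [hc]; push_cast [List.length_cons]; ring
    · have hc := card_quot_join h3 (SameCircle.of (.arc k false hk)) h1
        (fun x y h => σ.SameCircle_le L k h)
      convert ((saddleFactor_weight _ _ _).2 h1).mul ih using 1
      rw [hc]; push_cast [List.length_cons]; ring

theorem Matching.length_arcs {P : Type} [LinearOrder P] [Fintype P] (b : Matching P) :
    2 * b.arcs.length = Fintype.card P := by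
  classical
  have h1 : b.arcs.length = (Finset.univ.filter (fun p => p < b p)).card := Finset.length_sort _
  have h2 : (Finset.univ.filter (fun p => p < b p)).card =
      (Finset.univ.filter (fun p => ¬ p < b p)).card := by
    refine Finset.card_bij' (fun p _ => b p) (fun p _ => b p) ?_ ?_ (fun p _ => b.invol p)
      (fun p _ => b.invol p)
    · intro p hp
      simp only [Finset.mem_filter, Finset.mem_univ, true_and, b.invol] at hp ⊢
      exact hp.le.not_gt
    · intro p hp
      simp only [Finset.mem_filter, Finset.mem_univ, true_and, b.invol] at hp ⊢
      exact lt_of_le_of_ne (not_lt.1 hp) (b.ne p)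
  have h3 := Finset.card_filter_add_card_filter_not (s := (Finset.univ : Finset P))
    (fun p => p < b p)
  rw [Finset.card_univ] at h3
  omega

variable {P V : Type} [LinearOrder P] [Fintype P] {R : V → V → Prop} {bd : P → V}

theorem card_contracting_nil [Finite V] (c b : Matching P) :
    Nat.card (Quot (Contracting R bd c b [])) =
      Nat.card (Quot (Closure b.Graph id c)) + Nat.card (Quot (Closure R bd b)) := by
  have hn : ∀ x, ¬ Surg b [] x := by simp [Surg]
  rw [← Nat.card_sum]
  refine Nat.card_congr ⟨Quot.lift
    (Sum.elim (fun p => Sum.inl (Quot.mk _ p)) (fun v => Sum.inr (Quot.mk _ v))) ?_,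
    Sum.elim (Quot.lift (fun p => Quot.mk _ (.inl p)) ?_)
      (Quot.lift (fun v => Quot.mk _ (.inr v)) ?_), ?_, ?_⟩
  · intro x y h
    cases h with
    | upper p => exact congrArg Sum.inl (Quot.sound (.arc p))
    | lower h => exact congrArg Sum.inr (Quot.sound (.inner h))
    | arcUpper p h => exact congrArg Sum.inl (Quot.sound (.inner rfl))
    | arcLower p h => exact congrArg Sum.inr (Quot.sound (.arc p))
    | vertical p h => exact absurd h (hn p)
  · intro x y h
    cases h with
    | inner h => cases h; exact Quot.sound (.arcUpper x (hn x))
    | arc p => exact Quot.sound (.upper p)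
  · intro x y h
    cases h with
    | inner h => exact Quot.sound (.lower h)
    | arc p => exact Quot.sound (.arcLower p (hn p))
  · intro x
    induction x using Quot.ind with | _ x
    rcases x with x | x <;> rfl
  · rintro (x | x) <;> induction x using Quot.ind <;> rfl

theorem card_contracting_arcs (c b : Matching P) :
    Nat.card (Quot (Contracting R bd c b b.arcs)) = Nat.card (Quot (Closure R bd c)) := by
  have hn : ∀ x, Surg b b.arcs x := b.surg_arcs
  refine card_quot_eq (collapse bd) Sum.inr ?_ ?_ ?_ (fun x => rfl)
  · intro x y h
    cases h with
    | upper p => exact SameCircle.of (.arc p)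
    | lower h => exact SameCircle.of (.inner h)
    | arcUpper p h => exact absurd (hn p) h
    | arcLower p h => exact absurd (hn p) h
    | vertical p h => rfl
  · intro x y h
    cases h with
    | inner h => exact SameCircle.of (.lower h)
    | arc p =>
      exact (SameCircle.of (.vertical p (hn p))).symm.trans ((SameCircle.of (.upper p)).trans
        (SameCircle.of (.vertical _ (hn _))))
  · rintro (x | x)
    · exact (SameCircle.of (.vertical x (hn x))).symm
    · rfl

/-- The degree of a contraction map. -/
theorem Regular.contractPoly_weight [Fintype V] (ρ : Regular R bd) (c b : Matching P)
    {f : MvPolynomial P ℤ} {g : MvPolynomial V ℤ} {i j : ℤ}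
    (hf : IsWeightedHomogeneous (two P) f i) (hg : IsWeightedHomogeneous (two V) g j) :
    IsWeightedHomogeneous (two V) (contractPoly R bd c b f g)
      (i + j + (Nat.card (Quot (Closure R bd c)) - (Nat.card (Quot (Closure b.Graph id c)) +
        Nat.card (Quot (Closure R bd b))) + (Fintype.card P / 2 : ℕ))) := by
  have h1 : ∀ L, saddles R bd c b L = (ρ.system c b).prod L := by
    intro L
    induction L with
    | nil => rfl
    | cons p L ih =>
      rw [saddles, SurgerySystem.prod, ih]
      have := Regular.rename_saddleFactor id id (ρ.system_rel c b (p :: L)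
        (x := Sum.inl p) (y := Sum.inl (b p))).symm rfl rfl
      simp only [rename_id, AlgHom.coe_id, id_eq] at this
      rw [this]
      rfl
  have h2 : ∀ L, Nat.card (Quot ((ρ.system c b).Rel L)) =
      Nat.card (Quot (Contracting R bd c b L)) := fun L =>
    card_quot_eq id id (fun x y h => (ρ.system_rel c b L).1 (SameCircle.of h))
      (fun x y h => (ρ.system_rel c b L).2 (SameCircle.of h)) (fun _ => rfl) (fun _ => rfl)
  have h3 := (ρ.system c b).prod_weight b.arcs b.valid_arcs
  rw [← h1, h2, h2, card_contracting_nil, card_contracting_arcs] at h3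
  have h4 : Fintype.card P / 2 = b.arcs.length := by
    rw [← b.length_arcs]; omega
  rw [contractPoly, h4]
  refine rename_weight _ ?_
  convert ((rename_weight Sum.inl hf).mul (rename_weight Sum.inr hg)).mul h3 using 1
  push_cast
  ring

end Count

/-- The number of circles of a closed diagram. -/
noncomputable def circles {V : Type} (R : V → V → Prop) : ℕ := Nat.card (Quot R)

/-- The value of the two-dimensional TQFT on the closed diagram with vertices `V` and edges `R`:
the tensor product of copies of `ℤ[X]/(X²)` over its circles, presented as the ring generated
by one element of square zero for each vertex, with the elements of the vertices of a
circle identified. -/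
abbrev TQFT {V : Type} (R : V → V → Prop) : Type := MvPolynomial V ℤ ⧸ circleIdeal R

/-- The degree `n` part of the value of the TQFT with the grading shifted up by `s`. Here
`1` and `X` have degrees `-1` and `1` in each tensor factor, so that `1` has degree
`s` minus the number of circles, and multiplication by `X` increases the degree by `2`. -/
noncomputable def TQFT.deg {V : Type} (R : V → V → Prop) (s n : ℤ) : AddSubgroup (TQFT R) :=
  (MvPolynomial.weightedHomogeneousSubmodule ℤ (two V) (n - s + circles R)).toAddSubgroup.map
    (Ideal.Quotient.mk (circleIdeal R)).toAddMonoidHom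

/-- Projections showing that a family of subgroups is a direct sum decomposition. -/
def HasProj {M : Type} [AddCommGroup M] (gr : ℤ → AddSubgroup M) : Prop :=
  (∃ π : ℤ → M →+ M, (∀ n, ∀ x ∈ gr n, π n x = x) ∧ ∀ m n, m ≠ n → ∀ x ∈ gr m, π n x = 0) ∧
    ∀ x, x ∈ ⨆ n, gr n

theorem HasProj.isInternal {M : Type} [AddCommGroup M] {gr : ℤ → AddSubgroup M}
    (h : HasProj gr) : DirectSum.IsInternal gr := by
  classical
  obtain ⟨⟨π, h1, h2⟩, h3⟩ := h
  constructor
  · rw [injective_iff_map_eq_zero]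
    intro x hx
    ext n
    have h4 : π n (DirectSum.coeAddMonoidHom gr x) = (x n : M) := by
      induction x using DirectSum.induction_on with
      | zero => simp
      | of i y =>
        rw [DirectSum.coeAddMonoidHom_of]
        by_cases hi : i = n
        · subst hi
          rw [h1 _ _ y.2, DirectSum.of_eq_same]
        · rw [h2 _ _ hi _ y.2, DirectSum.of_eq_of_ne _ _ _ (Ne.symm hi)]
          rfl
      | add x y hx' hy' =>
        rw [map_add, map_add, DirectSum.add_apply]
        have e1 : ∀ x : DirectSum ℤ (fun i => gr i),
            π n (DirectSum.coeAddMonoidHom gr x) = (x n : M) := by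
          intro x
          induction x using DirectSum.induction_on with
          | zero => simp
          | of i y =>
            rw [DirectSum.coeAddMonoidHom_of]
            by_cases hi : i = n
            · subst hi
              rw [h1 _ _ y.2, DirectSum.of_eq_same]
            · rw [h2 _ _ hi _ y.2, DirectSum.of_eq_of_ne _ _ _ (Ne.symm hi)]
              rfl
          | add x y hx hy => rw [map_add, map_add, DirectSum.add_apply, hx, hy]; rfl
        rw [e1, e1]; rfl
    rw [← h4, hx, map_zero]
    rfl
  · intro x
    have : x ∈ (DirectSum.coeAddMonoidHom gr).range := by
      have h5 : (⨆ n, gr n) ≤ (DirectSum.coeAddMonoidHom gr).range := by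
        refine iSup_le (fun n y hy => ⟨DirectSum.of (fun i => gr i) n ⟨y, hy⟩, ?_⟩)
        rw [DirectSum.coeAddMonoidHom_of]
      exact h5 (h3 x)
    exact this

section Grading

open MvPolynomial

attribute [local instance] MvPolynomial.weightedGradedAlgebra

theorem circleIdeal_homogeneous {V : Type} (R : V → V → Prop) :
    (circleIdeal R).IsHomogeneous (weightedHomogeneousSubmodule ℤ (two V)) := by
  refine Ideal.homogeneous_span _ _ ?_
  rintro _ (⟨v, rfl⟩ | ⟨v, w, _, rfl⟩)
  · exact ⟨_, (isWeightedHomogeneous_X ℤ (two V) v).pow 2⟩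
  · exact ⟨2, (isWeightedHomogeneous_X ℤ (two V) v).sub (isWeightedHomogeneous_X ℤ (two V) w)⟩

theorem TQFT.hasProj {V : Type} (R : V → V → Prop) (s : ℤ) : HasProj (TQFT.deg R s) := by
  classical
  let I := circleIdeal R
  let e := Submodule.Quotient.restrictScalarsEquiv ℤ I
  let p : ℤ → TQFT R →+ TQFT R := fun n =>
    ((e.toLinearMap ∘ₗ Submodule.mapQ (I.restrictScalars ℤ) (I.restrictScalars ℤ)
      (weightedHomogeneousComponent (two V) (n - s + circles R))
      (fun f hf => weightedHomogeneousComponent_mem_of_mem ℤ (two V) (circleIdeal_homogeneous R)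
        hf _)) ∘ₗ e.symm.toLinearMap).toAddMonoidHom
  have hp : ∀ n f, p n (Ideal.Quotient.mk I f) =
      Ideal.Quotient.mk I (weightedHomogeneousComponent (two V) (n - s + circles R) f) :=
    fun n f => rfl
  refine ⟨⟨p, ?_, ?_⟩, ?_⟩
  · rintro n _ ⟨f, hf, rfl⟩
    exact (hp n f).trans (congrArg _ (weightedHomogeneousComponent_eq_self hf))
  · rintro m n hmn _ ⟨f, hf, rfl⟩
    refine (hp n f).trans ?_
    rw [IsWeightedHomogeneous.weightedHomogeneousComponent_ne (m := m - s + circles R)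
      _ hf (by intro h; apply hmn; linarith), map_zero]
  · intro x
    obtain ⟨f, rfl⟩ := Ideal.Quotient.mk_surjective x
    rw [f.as_sum, map_sum]
    refine AddSubgroup.sum_mem _ (fun d _ => ?_)
    refine AddSubgroup.mem_iSup_of_mem (Finsupp.weight (two V) d + s - circles R) ?_
    refine ⟨monomial d (f.coeff d), ?_, rfl⟩
    have h := isWeightedHomogeneous_monomial (two V) d (f.coeff d) rfl
    have e : Finsupp.weight (two V) d + s - circles R - s + circles R =
        Finsupp.weight (two V) d := by ring
    rw [e]
    exact h

/-- Graded pieces of a finite product. -/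
def piDeg {ι : Type} {M : ι → Type} [∀ i, AddCommGroup (M i)] (gr : ∀ i, ℤ → AddSubgroup (M i))
    (n : ℤ) : AddSubgroup (∀ i, M i) :=
  AddSubgroup.pi Set.univ (fun i => gr i n)

theorem mem_piDeg {ι : Type} {M : ι → Type} [∀ i, AddCommGroup (M i)]
    {gr : ∀ i, ℤ → AddSubgroup (M i)} {n : ℤ} {x : ∀ i, M i} :
    x ∈ piDeg gr n ↔ ∀ i, x i ∈ gr i n := by
  simp [piDeg, AddSubgroup.mem_pi]

theorem HasProj.pi {ι : Type} [Finite ι] {M : ι → Type} [∀ i, AddCommGroup (M i)]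
    {gr : ∀ i, ℤ → AddSubgroup (M i)} (h : ∀ i, HasProj (gr i)) : HasProj (piDeg gr) := by
  classical
  have := Fintype.ofFinite ι
  choose π h1 h2 using fun i => (h i).1
  refine ⟨⟨fun n => AddMonoidHom.mk' (fun x i => π i n (x i)) (fun x y => by
    funext i; simp), ?_, ?_⟩, ?_⟩
  · intro n x hx
    funext i
    exact h1 i n _ (mem_piDeg.1 hx i)
  · intro m n hmn x hx
    funext i
    exact h2 i m n hmn _ (mem_piDeg.1 hx i)
  · intro x
    rw [← Finset.univ_sum_single x]
    refine AddSubgroup.sum_mem _ (fun i _ => ?_)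
    have h3 := (h i).2 (x i)
    have h4 : (⨆ n, gr i n) ≤ (⨆ n, piDeg gr n).comap (AddMonoidHom.single M i) := by
      refine iSup_le (fun n y hy => AddSubgroup.mem_iSup_of_mem n (mem_piDeg.2 fun j => ?_))
      by_cases hj : j = i
      · subst hj; simpa using hy
      · simp [Pi.single_eq_of_ne hj]
    exact h4 h3

end Grading

section Contract

variable {P V : Type} [LinearOrder P] [Fintype P] (R : V → V → Prop) (bd : P → V)

/-- The map `F(W(c) b) × F(W(b) u) → F(W(c) u)` induced by the contraction cobordism, where `u` is
the open diagram with edges `R` and boundary points `bd p`. -/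
noncomputable def contract (c b : Matching P) (x : TQFT (Closure b.Graph id c))
    (y : TQFT (Closure R bd b)) : TQFT (Closure R bd c) :=
  Quotient.map₂ (contractPoly R bd c b) (by
    intro f f' hf g g' hg
    have hf' := (Submodule.quotientRel_def _).1 hf
    have hg' := (Submodule.quotientRel_def _).1 hg
    refine (Submodule.quotientRel_def _).2 ?_
    have h1 := contractPoly_mem_left R bd c b g hf'
    have h2 := contractPoly_mem_right R bd c b f' hg'
    have h3 := Ideal.add_mem _ h1 h2
    simp only [contractPoly_eq, map_sub] at h3 ⊢
    convert h3 using 1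
    ring) x y

theorem contract_mk (c b : Matching P) (f : MvPolynomial P ℤ) (g : MvPolynomial V ℤ) :
    contract R bd c b (Ideal.Quotient.mk _ f) (Ideal.Quotient.mk _ g) =
      Ideal.Quotient.mk _ (contractPoly R bd c b f g) := rfl

theorem contract_add (c b : Matching P) (x : TQFT (Closure b.Graph id c))
    (y y' : TQFT (Closure R bd b)) :
    contract R bd c b x (y + y') = contract R bd c b x y + contract R bd c b x y' := by
  obtain ⟨f, rfl⟩ := Ideal.Quotient.mk_surjective x
  obtain ⟨g, rfl⟩ := Ideal.Quotient.mk_surjective y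
  obtain ⟨g', rfl⟩ := Ideal.Quotient.mk_surjective y'
  rw [← map_add, contract_mk, contract_mk, contract_mk, ← map_add]
  refine congrArg _ ?_
  simp only [contractPoly_eq]
  ring

theorem add_contract (c b : Matching P) (x x' : TQFT (Closure b.Graph id c))
    (y : TQFT (Closure R bd b)) :
    contract R bd c b (x + x') y = contract R bd c b x y + contract R bd c b x' y := by
  obtain ⟨f, rfl⟩ := Ideal.Quotient.mk_surjective x
  obtain ⟨f', rfl⟩ := Ideal.Quotient.mk_surjective x'
  obtain ⟨g, rfl⟩ := Ideal.Quotient.mk_surjective y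
  rw [← map_add, contract_mk, contract_mk, contract_mk, ← map_add]
  refine congrArg _ ?_
  simp only [contractPoly_eq, map_add]
  ring

/-- The contraction map as a biadditive map. -/
noncomputable def contractHom (c b : Matching P) :
    TQFT (Closure b.Graph id c) →+ TQFT (Closure R bd b) →+ TQFT (Closure R bd c) :=
  AddMonoidHom.mk' (fun x => AddMonoidHom.mk' (contract R bd c b x) (contract_add R bd c b x))
    (fun x x' => by ext y; exact add_contract R bd c b x x' y)

theorem contractHom_mk (c b : Matching P) (f : MvPolynomial P ℤ) (g : MvPolynomial V ℤ) :
    contractHom R bd c b (Ideal.Quotient.mk _ f) (Ideal.Quotient.mk _ g) =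
      Ideal.Quotient.mk _ (contractPoly R bd c b f g) := rfl

variable {R bd}

theorem contractHom_assoc [Fintype V] (ρ : Regular R bd) (d c b : Matching P)
    (x : TQFT (Closure c.Graph id d)) (y : TQFT (Closure b.Graph id c))
    (z : TQFT (Closure R bd b)) :
    contractHom R bd d b (contractHom b.Graph id d c x y) z =
      contractHom R bd d c x (contractHom R bd c b y z) := by
  obtain ⟨f, rfl⟩ := Ideal.Quotient.mk_surjective x
  obtain ⟨g, rfl⟩ := Ideal.Quotient.mk_surjective y
  obtain ⟨h, rfl⟩ := Ideal.Quotient.mk_surjective z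
  simp only [contractHom_mk]
  exact Ideal.Quotient.eq.2 (ρ.contractPoly_assoc d c b f g h)

theorem contractHom_one_left (b : Matching P) (y : TQFT (Closure R bd b)) :
    contractHom R bd b b 1 y = y := by
  obtain ⟨g, rfl⟩ := Ideal.Quotient.mk_surjective y
  rw [← map_one (Ideal.Quotient.mk _), contractHom_mk, contractPoly_one_left]

theorem contractHom_one_right (c a : Matching P) (x : TQFT (Closure a.Graph id c)) :
    contractHom a.Graph id c a x 1 = x := by
  obtain ⟨g, rfl⟩ := Ideal.Quotient.mk_surjective x
  rw [← map_one (Ideal.Quotient.mk _), contractHom_mk, contractPoly_one_right]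

theorem contractHom_deg [Fintype V] (ρ : Regular R bd) (c b : Matching P) {s i j : ℤ}
    {x : TQFT (Closure b.Graph id c)} {y : TQFT (Closure R bd b)}
    (hx : x ∈ TQFT.deg _ (Fintype.card P / 2 : ℕ) i) (hy : y ∈ TQFT.deg _ s j) :
    contractHom R bd c b x y ∈ TQFT.deg _ s (i + j) := by
  obtain ⟨f, hf, rfl⟩ := hx
  obtain ⟨g, hg, rfl⟩ := hy
  refine ⟨_, ?_, (contractHom_mk R bd c b f g).symm⟩
  have := ρ.contractPoly_weight c b hf hg
  have e : i - (Fintype.card P / 2 : ℕ) + circles (Closure b.Graph id c) +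
      (j - s + circles (Closure R bd b)) + (Nat.card (Quot (Closure R bd c)) -
      (Nat.card (Quot (Closure b.Graph id c)) + Nat.card (Quot (Closure R bd b))) +
      (Fintype.card P / 2 : ℕ)) = i + j - s + circles (Closure R bd c) := by
    unfold circles; ring
  rw [e] at this
  exact this

end Contract

/-- The identification of the values of the TQFT on two equal diagrams. -/
noncomputable def TQFT.cast {V : Type} {R R' : V → V → Prop} (h : R = R') : TQFT R ≃+ TQFT R' :=
  (Ideal.quotEquivOfEq (congrArg circleIdeal h)).toAddEquiv

theorem TQFT.cast_mk {V : Type} {R R' : V → V → Prop} (h : R = R') (f : MvPolynomial V ℤ) :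
    TQFT.cast h (Ideal.Quotient.mk _ f) = Ideal.Quotient.mk _ f := rfl

theorem TQFT.cast_deg {V : Type} {R R' : V → V → Prop} (h : R = R') {s n : ℤ} {x : TQFT R}
    (hx : x ∈ TQFT.deg R s n) : TQFT.cast h x ∈ TQFT.deg R' s n := by
  subst h
  obtain ⟨f, hf, rfl⟩ := hx
  exact ⟨f, hf, rfl⟩

instance TQFT.finite {V : Type} [Finite V] (R : V → V → Prop) : Module.Finite ℤ (TQFT R) := by
  have h1 : Algebra.FiniteType ℤ (TQFT R) := Algebra.FiniteType.of_surjective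
    (Ideal.Quotient.mkₐ ℤ (circleIdeal R)) Ideal.Quotient.mk_surjective
  have h2 : Algebra.IsIntegral ℤ (TQFT R) := by
    refine ⟨fun x => ?_⟩
    obtain ⟨f, rfl⟩ := Ideal.Quotient.mk_surjective x
    induction f using MvPolynomial.induction_on with
    | C n => exact isIntegral_algebraMap (x := n)
    | add f g hf hg => rw [map_add]; exact hf.add hg
    | mul_X f v hf =>
      rw [map_mul]
      refine hf.mul (IsIntegral.of_pow (n := 2) two_pos ?_)
      rw [← map_pow, Ideal.Quotient.eq_zero_iff_mem.2 (X_sq_mem v)]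
      exact isIntegral_zero
  exact Algebra.IsIntegral.finite

/-- Matchings as open diagrams. -/
def Matching.regular {P : Type} [LinearOrder P] [Fintype P] (a : Matching P) :
    Regular a.Graph id where
  o := a
  e := id
  col := Matching.colour
  oo := a.invol
  co := a.colour_ne
  inj := Function.injective_id
  ee x hx := absurd rfl (hx x)
  rel_o _ := rfl
  rel_e x hx := absurd rfl (hx x)
  rel _ _ h := Or.inl h
  col_bd b p := b.colour_ne p

section ArcRing

variable {P : Type} [LinearOrder P] [Fintype P]

/-- The arc ring on the points `P`: the direct sum, over crossingless matchings `c` and `a`, of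
the values of the TQFT on the diagrams `W(c) a`. -/
def ArcRing (P : Type) [LinearOrder P] : Type :=
  ∀ c a : Matching P, TQFT (Closure a.Graph id c)

namespace ArcRing

noncomputable instance : AddCommGroup (ArcRing P) :=
  inferInstanceAs (AddCommGroup (∀ c a : Matching P, TQFT (Closure a.Graph id c)))

theorem add_apply (x y : ArcRing P) (c a : Matching P) : (x + y) c a = x c a + y c a := rfl

theorem zero_apply (c a : Matching P) : (0 : ArcRing P) c a = 0 := rfl

noncomputable instance : Mul (ArcRing P) :=
  ⟨fun x y c a => ∑ b, contractHom a.Graph id c b (x c b) (y b a)⟩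

theorem mul_apply (x y : ArcRing P) (c a : Matching P) :
    (x * y) c a = ∑ b, contractHom a.Graph id c b (x c b) (y b a) := rfl

open Classical in
noncomputable instance : One (ArcRing P) := ⟨fun c a => if c = a then 1 else 0⟩

theorem one_self (a : Matching P) : (1 : ArcRing P) a a = 1 := if_pos rfl

theorem one_ne {c a : Matching P} (h : c ≠ a) : (1 : ArcRing P) c a = 0 := if_neg h

noncomputable instance : Ring (ArcRing P) where
  __ := (inferInstance : AddCommGroup (ArcRing P))
  __ := (inferInstance : Mul (ArcRing P))
  __ := (inferInstance : One (ArcRing P))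
  left_distrib x y z := by
    funext c a
    simp only [mul_apply, add_apply, map_add, Finset.sum_add_distrib]
  right_distrib x y z := by
    funext c a
    simp only [mul_apply, add_apply, map_add, AddMonoidHom.add_apply, Finset.sum_add_distrib]
  zero_mul x := by
    funext c a
    simp [mul_apply, zero_apply]
  mul_zero x := by
    funext c a
    simp [mul_apply, zero_apply]
  one_mul x := by
    funext c a
    rw [mul_apply, Finset.sum_eq_single c]
    · rw [one_self, contractHom_one_left]
    · intro b _ hb
      rw [one_ne hb.symm, map_zero]; rfl
    · simp
  mul_one x := by
    funext c a
    rw [mul_apply, Finset.sum_eq_single a]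
    · rw [one_self, contractHom_one_right]
    · intro b _ hb
      rw [one_ne hb, map_zero]
    · simp
  mul_assoc x y z := by
    funext d a
    simp only [mul_apply, map_sum, AddMonoidHom.finsetSum_apply]
    rw [Finset.sum_comm]
    refine Finset.sum_congr rfl fun c _ => Finset.sum_congr rfl fun b _ => ?_
    exact contractHom_assoc a.regular _ _ _ _ _ _

/-- The grading of the arc ring; it is shifted up by half the number of points, so that `1` has
degree `0`. -/
noncomputable def deg (P : Type) [LinearOrder P] [Fintype P] : ℤ → AddSubgroup (ArcRing P) :=
  piDeg fun c => piDeg fun a => TQFT.deg (Closure a.Graph id c) (Fintype.card P / 2 : ℕ)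

theorem mem_deg {n : ℤ} {x : ArcRing P} : x ∈ deg P n ↔ ∀ c a,
    x c a ∈ TQFT.deg (Closure a.Graph id c) (Fintype.card P / 2 : ℕ) n :=
  mem_piDeg.trans (forall_congr' fun _ => mem_piDeg)

theorem hasProj : HasProj (deg P) :=
  HasProj.pi fun _ => HasProj.pi fun _ => TQFT.hasProj _ _

theorem mul_mem {m n : ℤ} {x y : ArcRing P} (hx : x ∈ deg P m) (hy : y ∈ deg P n) :
    x * y ∈ deg P (m + n) :=
  mem_deg.2 fun c a => AddSubgroup.sum_mem _ fun b _ =>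
    contractHom_deg a.regular c b (mem_deg.1 hx c b) (mem_deg.1 hy b a)

end ArcRing

end ArcRing

section TangleModule

variable {P Q : Type} [LinearOrder P] [Fintype P] [LinearOrder Q] [Fintype Q]

/-- The open diagram obtained from a flat tangle by closing its bottom. -/
def FlatTangle.regularTop (T : FlatTangle P Q) (a : Matching P) :
    Regular (Closure T.Graph botPt a) (topPt : Q → P ⊕ₗ Qᵒᵈ) where
  o := T
  e x := Sum.elim (fun p => botPt (a p)) (fun _ => x) (ofLex x)
  col := Matching.colour
  oo := T.invol
  co := T.colour_ne
  inj := topPt_injective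
  ee x hx := by
    obtain ⟨p, rfl⟩ | ⟨q, rfl⟩ := botPt_or_topPt x
    · exact ⟨fun q => (botPt_ne_topPt _ q).symm, congrArg botPt (a.invol p), colour_bot_ne a p⟩
    · exact absurd rfl (hx q)
  rel_o x := .inner rfl
  rel_e x hx := by
    obtain ⟨p, rfl⟩ | ⟨q, rfl⟩ := botPt_or_topPt x
    · exact .arc p
    · exact absurd rfl (hx q)
  rel x y h := by
    cases h with
    | inner h => exact Or.inl h
    | arc p => exact Or.inr ⟨fun q => (botPt_ne_topPt _ q).symm, rfl⟩
  col_bd b p := colour_top_ne b p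

/-- The open diagram obtained from a flat tangle by closing its top. -/
def FlatTangle.regularBot (T : FlatTangle P Q) (b : Matching Q) :
    Regular (Closure T.Graph topPt b) (botPt : P → P ⊕ₗ Qᵒᵈ) where
  o := T
  e x := Sum.elim (fun _ => x) (fun q => topPt (b (OrderDual.ofDual q))) (ofLex x)
  col := Matching.colour
  oo := T.invol
  co := T.colour_ne
  inj := botPt_injective
  ee x hx := by
    obtain ⟨p, rfl⟩ | ⟨q, rfl⟩ := botPt_or_topPt x
    · exact absurd rfl (hx p)
    · exact ⟨fun p => botPt_ne_topPt p _, congrArg topPt (b.invol q), colour_top_ne b q⟩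
  rel_o x := .inner rfl
  rel_e x hx := by
    obtain ⟨p, rfl⟩ | ⟨q, rfl⟩ := botPt_or_topPt x
    · exact absurd rfl (hx p)
    · exact .arc q
  rel x y h := by
    cases h with
    | inner h => exact Or.inl h
    | arc q => exact Or.inr ⟨fun p => botPt_ne_topPt p _, rfl⟩
  col_bd a p := colour_bot_ne a p

/-- The order in which the two ends of a flat tangle are closed is irrelevant. -/
theorem FlatTangle.closure_comm (T : FlatTangle P Q) (b : Matching Q) (a : Matching P) :
    Closure (Closure T.Graph botPt a) topPt b = Closure (Closure T.Graph topPt b) botPt a := by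
  funext x y
  refine propext ⟨?_, ?_⟩
  · rintro ((h | ⟨p⟩) | ⟨q⟩)
    · exact .inner (.inner h)
    · exact .arc p
    · exact .inner (.arc q)
  · rintro ((h | ⟨p⟩) | ⟨q⟩)
    · exact .inner (.inner h)
    · exact .arc p
    · exact .inner (.arc q)

/-- The bimodule of a flat tangle `T`: the direct sum, over crossingless matchings `b` of its top
points and `a` of its bottom points, of the values of the TQFT on the diagrams `W(b) T a`. -/
def TangleModule (T : FlatTangle P Q) : Type :=
  ∀ (b : Matching Q) (a : Matching P), TQFT (Closure (Closure T.Graph botPt a) topPt b)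

namespace TangleModule

variable {T : FlatTangle P Q}

noncomputable instance : AddCommGroup (TangleModule T) :=
  inferInstanceAs (AddCommGroup (∀ (b : Matching Q) (a : Matching P),
    TQFT (Closure (Closure T.Graph botPt a) topPt b)))

theorem add_apply (x y : TangleModule T) (b : Matching Q) (a : Matching P) :
    (x + y) b a = x b a + y b a := rfl

theorem zero_apply (b : Matching Q) (a : Matching P) : (0 : TangleModule T) b a = 0 := rfl

/-- The contraction `F(W(b) T a) × F(W(a) d) → F(W(b) T d)`, with the factors exchanged. -/
noncomputable def contractBot (T : FlatTangle P Q) (b : Matching Q) (d a : Matching P) :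
    TQFT (Closure d.Graph id a) →+ TQFT (Closure (Closure T.Graph botPt a) topPt b) →+
      TQFT (Closure (Closure T.Graph botPt d) topPt b) :=
  AddMonoidHom.mk' (fun h => ((TQFT.cast (T.closure_comm b d).symm).toAddMonoidHom.comp
      (contractHom (Closure T.Graph topPt b) botPt d a (TQFT.cast (closure_graph_symm a d) h))).comp
      (TQFT.cast (T.closure_comm b a)).toAddMonoidHom)
    (fun h h' => by ext x; simp)

theorem contractBot_mk (b : Matching Q) (d a : Matching P) (f : MvPolynomial P ℤ)
    (g : MvPolynomial (P ⊕ₗ Qᵒᵈ) ℤ) :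
    contractBot T b d a (Ideal.Quotient.mk _ f) (Ideal.Quotient.mk _ g) =
      Ideal.Quotient.mk _ (contractPoly (Closure T.Graph topPt b) botPt d a f g) := rfl

theorem contractBot_one (b : Matching Q) (a : Matching P)
    (x : TQFT (Closure (Closure T.Graph botPt a) topPt b)) : contractBot T b a a 1 x = x := by
  have h1 : TQFT.cast (closure_graph_symm a a) (1 : TQFT (Closure a.Graph id a)) = 1 := rfl
  change TQFT.cast (T.closure_comm b a).symm (contractHom _ _ a a (TQFT.cast _ _) (TQFT.cast _ x)) = x
  rw [h1, contractHom_one_left]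
  exact (TQFT.cast (T.closure_comm b a)).symm_apply_apply x

theorem contractBot_mul (b : Matching Q) (e d a : Matching P) (f : TQFT (Closure d.Graph id a))
    (g : TQFT (Closure e.Graph id d)) (x : TQFT (Closure (Closure T.Graph botPt a) topPt b)) :
    contractBot T b e a (contractHom e.Graph id a d f g) x =
      contractBot T b e d g (contractBot T b d a f x) := by
  obtain ⟨f, rfl⟩ := Ideal.Quotient.mk_surjective f
  obtain ⟨g, rfl⟩ := Ideal.Quotient.mk_surjective g
  obtain ⟨x, rfl⟩ := Ideal.Quotient.mk_surjective x
  simp only [contractHom_mk, contractBot_mk]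
  have : Fintype (P ⊕ₗ Qᵒᵈ) := Fintype.ofFinite _
  rw [contractPoly_symm]
  have h := (T.regularBot b).contractPoly_assoc e d a g f x
  rw [← T.closure_comm] at h
  exact Ideal.Quotient.eq.2 h

theorem contractBot_comm (c b : Matching Q) (d a : Matching P) (f : TQFT (Closure b.Graph id c))
    (h : TQFT (Closure d.Graph id a)) (x : TQFT (Closure (Closure T.Graph botPt a) topPt b)) :
    contractBot T c d a h (contractHom (Closure T.Graph botPt a) topPt c b f x) =
      contractHom (Closure T.Graph botPt d) topPt c b f (contractBot T b d a h x) := by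
  obtain ⟨f, rfl⟩ := Ideal.Quotient.mk_surjective f
  obtain ⟨h, rfl⟩ := Ideal.Quotient.mk_surjective h
  obtain ⟨x, rfl⟩ := Ideal.Quotient.mk_surjective x
  simp only [contractHom_mk, contractBot_mk]
  exact Ideal.Quotient.eq.2 (contractPoly_comm T c b d a f x h)

theorem contractBot_deg (b : Matching Q) (d a : Matching P) {s i j : ℤ}
    {h : TQFT (Closure d.Graph id a)} {x : TQFT (Closure (Closure T.Graph botPt a) topPt b)}
    (hh : h ∈ TQFT.deg _ (Fintype.card P / 2 : ℕ) i) (hx : x ∈ TQFT.deg _ s j) :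
    contractBot T b d a h x ∈ TQFT.deg _ s (i + j) := by
  have : Fintype (P ⊕ₗ Qᵒᵈ) := Fintype.ofFinite _
  exact TQFT.cast_deg (T.closure_comm b d).symm (contractHom_deg (T.regularBot b) d a 
    (TQFT.cast_deg (closure_graph_symm a d) hh) (TQFT.cast_deg (T.closure_comm b a) hx))

noncomputable instance : SMul (ArcRing Q) (TangleModule T) :=
  ⟨fun h x c a => ∑ b, contractHom (Closure T.Graph botPt a) topPt c b (h c b) (x b a)⟩

theorem smul_apply (h : ArcRing Q) (x : TangleModule T) (c : Matching Q) (a : Matching P) :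
    (h • x) c a = ∑ b, contractHom (Closure T.Graph botPt a) topPt c b (h c b) (x b a) := rfl

noncomputable instance : Module (ArcRing Q) (TangleModule T) where
  one_smul x := by
    funext c a
    rw [smul_apply, Finset.sum_eq_single c]
    · rw [ArcRing.one_self, contractHom_one_left]
    · intro b _ hb
      rw [ArcRing.one_ne hb.symm, map_zero]; rfl
    · simp
  mul_smul x y z := by
    funext d a
    have : Fintype (P ⊕ₗ Qᵒᵈ) := Fintype.ofFinite _
    simp only [smul_apply, ArcRing.mul_apply, map_sum, AddMonoidHom.finsetSum_apply]
    rw [Finset.sum_comm]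
    refine Finset.sum_congr rfl fun c _ => Finset.sum_congr rfl fun b _ => ?_
    exact contractHom_assoc (T.regularTop a) _ _ _ _ _ _
  smul_zero h := by
    funext c a
    simp [smul_apply, zero_apply]
  smul_add h x y := by
    funext c a
    simp only [smul_apply, add_apply, map_add, Finset.sum_add_distrib]
  add_smul h h' x := by
    funext c a
    simp only [smul_apply, ArcRing.add_apply, add_apply, map_add, AddMonoidHom.add_apply,
      Finset.sum_add_distrib]
  zero_smul x := by
    funext c a
    simp [smul_apply, zero_apply, ArcRing.zero_apply]

noncomputable instance : SMul (ArcRing P)ᵐᵒᵖ (TangleModule T) :=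
  ⟨fun h x b d => ∑ a, contractBot T b d a (h.unop a d) (x b a)⟩

theorem op_smul_apply (h : (ArcRing P)ᵐᵒᵖ) (x : TangleModule T) (b : Matching Q)
    (d : Matching P) : (h • x) b d = ∑ a, contractBot T b d a (h.unop a d) (x b a) := rfl

/-- The right action of the arc ring of the bottom points. -/
noncomputable instance : Module (ArcRing P)ᵐᵒᵖ (TangleModule T) where
  one_smul x := by
    funext b d
    rw [op_smul_apply, Finset.sum_eq_single d]
    · rw [MulOpposite.unop_one, ArcRing.one_self, contractBot_one]
    · intro a _ ha
      rw [MulOpposite.unop_one, ArcRing.one_ne ha, map_zero]; rfl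
    · simp
  mul_smul h h' x := by
    funext b e
    simp only [op_smul_apply, MulOpposite.unop_mul, ArcRing.mul_apply, map_sum,
      AddMonoidHom.finsetSum_apply]
    rw [Finset.sum_comm]
    refine Finset.sum_congr rfl fun d _ => Finset.sum_congr rfl fun a _ => ?_
    exact contractBot_mul _ _ _ _ _ _ _
  smul_zero h := by
    funext c a
    simp [op_smul_apply, zero_apply]
  smul_add h x y := by
    funext c a
    simp only [op_smul_apply, add_apply, map_add, Finset.sum_add_distrib]
  add_smul h h' x := by
    funext c a
    simp only [op_smul_apply, MulOpposite.unop_add, ArcRing.add_apply, add_apply, map_add,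
      AddMonoidHom.add_apply, Finset.sum_add_distrib]
  zero_smul x := by
    funext c a
    simp [op_smul_apply, zero_apply, ArcRing.zero_apply]

instance : SMulCommClass (ArcRing Q) (ArcRing P)ᵐᵒᵖ (TangleModule T) where
  smul_comm f h x := by
    funext c d
    simp only [smul_apply, op_smul_apply, map_sum]
    rw [Finset.sum_comm]
    refine Finset.sum_congr rfl fun a _ => Finset.sum_congr rfl fun b _ => ?_
    exact (contractBot_comm _ _ _ _ _ _ _).symm

/-- The grading of the bimodule of a flat tangle, shifted up by half the number of its bottom
points. -/
noncomputable def deg (T : FlatTangle P Q) : ℤ → AddSubgroup (TangleModule T) :=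
  piDeg fun b => piDeg fun a =>
    TQFT.deg (Closure (Closure T.Graph botPt a) topPt b) (Fintype.card P / 2 : ℕ)

theorem mem_deg {n : ℤ} {x : TangleModule T} : x ∈ deg T n ↔ ∀ b a,
    x b a ∈ TQFT.deg (Closure (Closure T.Graph botPt a) topPt b) (Fintype.card P / 2 : ℕ) n :=
  mem_piDeg.trans (forall_congr' fun _ => mem_piDeg)

theorem hasProj : HasProj (deg T) :=
  HasProj.pi fun _ => HasProj.pi fun _ => TQFT.hasProj _ _

theorem smul_mem {m n : ℤ} {h : ArcRing Q} {x : TangleModule T} (hh : h ∈ ArcRing.deg Q m)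
    (hx : x ∈ deg T n) : h • x ∈ deg T (m + n) := by
  have : Fintype (P ⊕ₗ Qᵒᵈ) := Fintype.ofFinite _
  exact mem_deg.2 fun c a => AddSubgroup.sum_mem _ fun b _ =>
    contractHom_deg (T.regularTop a) c b (ArcRing.mem_deg.1 hh c b) (mem_deg.1 hx b a)

theorem op_smul_mem {m n : ℤ} {h : ArcRing P} {x : TangleModule T} (hh : h ∈ ArcRing.deg P m)
    (hx : x ∈ deg T n) : MulOpposite.op h • x ∈ deg T (n + m) := by
  rw [add_comm]
  exact mem_deg.2 fun b d => AddSubgroup.sum_mem _ fun a _ =>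
    contractBot_deg b d a (ArcRing.mem_deg.1 hh a d) (mem_deg.1 hx b a)

end TangleModule

end TangleModule

theorem HasProj.exists_hom {M N : Type} [AddCommGroup M] [AddCommGroup N]
    {gr : ℤ → AddSubgroup M} (h : HasProj gr) (A : ∀ i, gr i →+ N) :
    ∃ B : M →+ N, ∀ i (x : gr i), B x = A i x := by
  classical
  let e := AddEquiv.ofBijective (DirectSum.coeAddMonoidHom gr) h.isInternal
  refine ⟨(DirectSum.toAddMonoid A).comp e.symm.toAddMonoidHom, fun i x => ?_⟩
  have : e.symm (x : M) = DirectSum.of (fun i => gr i) i x := by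
    rw [AddEquiv.symm_apply_eq]
    exact (DirectSum.coeAddMonoidHom_of gr i x).symm
  change DirectSum.toAddMonoid A (e.symm (x : M)) = _
  rw [this, DirectSum.toAddMonoid_of]

theorem hasProj_of_isInternal {M : Type} [AddCommGroup M] {gr : ℤ → AddSubgroup M}
    (h : DirectSum.IsInternal gr) : HasProj gr := by
  classical
  let e := AddEquiv.ofBijective (DirectSum.coeAddMonoidHom gr) h
  have he : ∀ n (x : gr n), e.symm (x : M) = DirectSum.of (fun i => gr i) n x := by
    intro n x
    rw [AddEquiv.symm_apply_eq]
    exact (DirectSum.coeAddMonoidHom_of gr n x).symm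
  refine ⟨⟨fun n => AddMonoidHom.mk' (fun x => (e.symm x n : M)) (fun x y => by
    rw [map_add, DirectSum.add_apply]; rfl), ?_, ?_⟩, ?_⟩
  · intro n x hx
    change ((e.symm x n : gr n) : M) = x
    rw [he n ⟨x, hx⟩, DirectSum.of_eq_same]
  · intro m n hmn x hx
    change ((e.symm x n : gr n) : M) = 0
    rw [he m ⟨x, hx⟩, DirectSum.of_eq_of_ne _ _ _ hmn.symm]
    rfl
  · intro x
    obtain ⟨y, rfl⟩ := e.surjective x
    change DirectSum.coeAddMonoidHom gr y ∈ _
    induction y using DirectSum.induction_on with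
    | zero => simp
    | of i y =>
      rw [DirectSum.coeAddMonoidHom_of]
      exact AddSubgroup.mem_iSup_of_mem i y.2
    | add x y hx hy => rw [map_add]; exact add_mem hx hy

theorem hom_ext_of_iSup {M N : Type} [AddCommGroup M] [AddCommGroup N] {gr : ℤ → AddSubgroup M}
    (h : ∀ x, x ∈ ⨆ n, gr n) {f g : M →+ N} (hfg : ∀ n, ∀ x ∈ gr n, f x = g x) (x : M) :
    f x = g x := by
  have : (⨆ n, gr n) ≤ f.eqLocus g := iSup_le fun n y hy => hfg n y hy
  exact this (h x)

/-- Finitely generated graded modules over the ring `H` with the grading `𝓗`. -/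
structure GrMod {H : Type} [Ring H] (𝓗 : ℤ → AddSubgroup H) where
  carrier : Type
  [addCommGroup : AddCommGroup carrier]
  [module : Module H carrier]
  gr : ℤ → AddSubgroup carrier
  internal : DirectSum.IsInternal gr
  smul_mem : ∀ {m n : ℤ} {h : H} {x : carrier}, h ∈ 𝓗 m → x ∈ gr n → h • x ∈ gr (m + n)
  finite : Module.Finite H carrier

namespace GrMod

open CategoryTheory

variable {H : Type} [Ring H] {𝓗 : ℤ → AddSubgroup H}

attribute [instance] addCommGroup module finite

/-- Grading-preserving module homomorphisms. -/
@[ext] structure Hom (M N : GrMod 𝓗) where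
  toLin : M.carrier →ₗ[H] N.carrier
  map_mem : ∀ {n : ℤ} {x : M.carrier}, x ∈ M.gr n → toLin x ∈ N.gr n

instance : Category (GrMod 𝓗) where
  Hom := Hom
  id M := ⟨LinearMap.id, fun h => h⟩
  comp f g := ⟨g.toLin ∘ₗ f.toLin, fun h => g.map_mem (f.map_mem h)⟩

theorem internal_shift {M : Type} [AddCommGroup M] {gr : ℤ → AddSubgroup M}
    (h : DirectSum.IsInternal gr) (j : ℤ) : DirectSum.IsInternal (fun d => gr (d - j)) := by
  refine HasProj.isInternal ?_
  obtain ⟨⟨π, h1, h2⟩, h3⟩ := hasProj_of_isInternal h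
  refine ⟨⟨fun n => π (n - j), fun n => h1 _, fun m n hmn => h2 _ _ (by simpa using hmn)⟩, ?_⟩
  intro x
  have : (⨆ n, gr n) ≤ ⨆ n, gr (n - j) := iSup_le fun n => by
    have := le_iSup (fun n => gr (n - j)) (n + j)
    simpa using this
  exact this (h3 x)

/-- The functor raising the grading by `j`: the degree `d` part of `M{j}` is the degree
`d - j` part of `M`. -/
def shift (j : ℤ) : GrMod 𝓗 ⥤ GrMod 𝓗 where
  obj M :=
    { carrier := M.carrier
      gr := fun d => M.gr (d - j)
      internal := internal_shift M.internal j
      smul_mem := fun {m n h x} hh hx => by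
        have := M.smul_mem hh hx
        rwa [← add_sub_assoc] at this
      finite := M.finite }
  map f := ⟨f.toLin, fun h => f.map_mem h⟩

/-- The zero module. -/
def zero (𝓗 : ℤ → AddSubgroup H) : GrMod 𝓗 where
  carrier := PUnit
  gr _ := ⊥
  internal := HasProj.isInternal
    ⟨⟨fun _ => 0, fun _ _ _ => rfl, fun _ _ _ _ _ => rfl⟩, fun _ => zero_mem _⟩
  smul_mem _ _ := rfl
  finite := inferInstance

end GrMod

/-- Graded bimodules over the graded rings `L` (on the left) and `H` (on the right) which are
finitely generated as left modules. -/
structure GrBimod {L H : Type} [Ring L] [Ring H] (𝓛 : ℤ → AddSubgroup L)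
    (𝓗 : ℤ → AddSubgroup H) where
  carrier : Type
  [addCommGroup : AddCommGroup carrier]
  [moduleLeft : Module L carrier]
  [moduleRight : Module Hᵐᵒᵖ carrier]
  [smulComm : SMulCommClass L Hᵐᵒᵖ carrier]
  gr : ℤ → AddSubgroup carrier
  internal : DirectSum.IsInternal gr
  smul_mem : ∀ {m n : ℤ} {l : L} {x : carrier}, l ∈ 𝓛 m → x ∈ gr n → l • x ∈ gr (m + n)
  op_smul_mem : ∀ {m n : ℤ} {h : H} {x : carrier}, h ∈ 𝓗 m → x ∈ gr n →
    MulOpposite.op h • x ∈ gr (n + m)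
  finite : Module.Finite L carrier

namespace GrBimod

open CategoryTheory TensorProduct

variable {L H : Type} [Ring L] [Ring H] {𝓛 : ℤ → AddSubgroup L} {𝓗 : ℤ → AddSubgroup H}

attribute [instance] addCommGroup moduleLeft moduleRight smulComm finite

variable (T : GrBimod 𝓛 𝓗) (M : GrMod 𝓗)

/-- The relations `xh ⊗ m = x ⊗ hm`. -/
def rels : Submodule L (T.carrier ⊗[ℤ] M.carrier) :=
  Submodule.span L {z | ∃ (x : T.carrier) (h : H) (m : M.carrier),
    z = (MulOpposite.op h • x) ⊗ₜ[ℤ] m - x ⊗ₜ[ℤ] (h • m)}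

/-- The tensor product `T ⊗_H M`, as a left `L`-module. -/
abbrev Tens : Type := (T.carrier ⊗[ℤ] M.carrier) ⧸ T.rels M

variable {M}

/-- The class of `x ⊗ m`. -/
def tmul (x : T.carrier) (m : M.carrier) : Tens T M := (T.rels M).mkQ (x ⊗ₜ[ℤ] m)

theorem op_smul_tmul (x : T.carrier) (h : H) (m : M.carrier) :
    T.tmul (MulOpposite.op h • x) m = T.tmul x (h • m) :=
  (Submodule.Quotient.eq _).2 (Submodule.subset_span ⟨x, h, m, rfl⟩)

theorem smul_tmul (l : L) (x : T.carrier) (m : M.carrier) :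
    l • T.tmul x m = T.tmul (l • x) m := rfl

/-- The universal map. -/
def tmulHom : T.carrier →+ M.carrier →+ Tens T M :=
  AddMonoidHom.mk' (fun x => AddMonoidHom.mk' (T.tmul x) (fun m m' => by
    rw [tmul, TensorProduct.tmul_add, map_add]; rfl)) (fun x x' => by
    ext m
    change T.tmul (x + x') m = T.tmul x m + T.tmul x' m
    rw [tmul, TensorProduct.add_tmul, map_add]; rfl)

theorem tens_induction {p : Tens T M → Prop} (z : Tens T M) (h0 : p 0)
    (h1 : ∀ x m, p (T.tmul x m)) (h2 : ∀ z w, p z → p w → p (z + w)) : p z := by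
  obtain ⟨z, rfl⟩ := Submodule.mkQ_surjective _ z
  induction z using TensorProduct.induction_on with
  | zero => rw [map_zero]; exact h0
  | tmul x m => exact h1 x m
  | add z w hz hw => rw [map_add]; exact h2 _ _ hz hw

theorem exists_lift {N : Type} [AddCommGroup N] (B : T.carrier →+ M.carrier →+ N)
    (hB : ∀ (x : T.carrier) (h : H) (m : M.carrier),
      B (MulOpposite.op h • x) m = B x (h • m)) :
    ∃ F : Tens T M →+ N, ∀ x m, F (T.tmul x m) = B x m := by
  let B' : T.carrier ⊗[ℤ] M.carrier →+ N := TensorProduct.liftAddHom B (fun r m n => by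
    rw [map_zsmul, map_zsmul, AddMonoidHom.smul_apply])
  have key : ∀ z ∈ T.rels M, ∀ l : L, B' (l • z) = 0 := by
    intro z hz
    induction hz using Submodule.span_induction with
    | mem z hz =>
      obtain ⟨x, h, m, rfl⟩ := hz
      intro l
      rw [smul_sub, TensorProduct.smul_tmul', TensorProduct.smul_tmul', map_sub, sub_eq_zero,
        smul_comm]
      exact hB _ _ _
    | zero => intro l; rw [smul_zero, map_zero]
    | add z w _ _ hz hw => intro l; rw [smul_add, map_add, hz, hw, add_zero]
    | smul r z _ hz => intro l; rw [smul_smul]; exact hz _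
  refine ⟨QuotientAddGroup.lift (T.rels M).toAddSubgroup B' (fun z hz => ?_), fun x m => rfl⟩
  have := key z hz 1
  rwa [one_smul] at this

variable (M)

/-- The grading of the tensor product: the degree `n` part is spanned by the products of
homogeneous elements whose degrees add up to `n`. -/
def tensGr (n : ℤ) : AddSubgroup (Tens T M) :=
  AddSubgroup.closure {z | ∃ (i j : ℤ) (x : T.carrier) (m : M.carrier),
    i + j = n ∧ x ∈ T.gr i ∧ m ∈ M.gr j ∧ z = T.tmul x m}

variable {M}

theorem tmul_mem {i j n : ℤ} {x : T.carrier} {m : M.carrier} (h : i + j = n) (hx : x ∈ T.gr i)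
    (hm : m ∈ M.gr j) : T.tmul x m ∈ T.tensGr M n :=
  AddSubgroup.subset_closure ⟨i, j, x, m, h, hx, hm, rfl⟩

theorem exists_proj (h𝓗 : ∀ h, h ∈ ⨆ n, 𝓗 n) (n : ℤ) : ∃ F : Tens T M →+ Tens T M,
    (∀ i j x m, x ∈ T.gr i → m ∈ M.gr j → i + j = n → F (T.tmul x m) = T.tmul x m) ∧
    (∀ i j x m, x ∈ T.gr i → m ∈ M.gr j → i + j ≠ n → F (T.tmul x m) = 0) := by
  obtain ⟨⟨π, h1, h2⟩, h3⟩ := hasProj_of_isInternal M.internal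
  have hT := hasProj_of_isInternal T.internal
  obtain ⟨B, hB⟩ := hT.exists_hom (N := M.carrier →+ Tens T M) (fun i =>
    AddMonoidHom.mk' (fun x => (T.tmulHom (M := M) x).comp (π (n - i))) (fun x y => by
      ext m; simp))
  have hB1 : ∀ i x m, x ∈ T.gr i → B x m = T.tmul x (π (n - i) m) := fun i x m hx => by
    rw [show x = ((⟨x, hx⟩ : T.gr i) : T.carrier) from rfl, hB]; rfl
  have hbal : ∀ (x : T.carrier) (h : H) (m : M.carrier), B (MulOpposite.op h • x) m = B x (h • m) := by
    intro x h m
    refine hom_ext_of_iSup hT.2 (f := (B.flip m).comp (DistribSMul.toAddMonoidHom _ (MulOpposite.op h)))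
      (g := B.flip (h • m)) ?_ x
    intro i x hx
    change B (MulOpposite.op h • x) m = B x (h • m)
    refine hom_ext_of_iSup h𝓗
      (f := (B.flip m).comp (AddMonoidHom.mk' (fun h : H => MulOpposite.op h • x) (fun a b => by
        rw [MulOpposite.op_add, add_smul])))
      (g := (B x).comp (AddMonoidHom.mk' (fun h : H => h • m) (fun a b => add_smul a b m))) ?_ h
    intro j h hh
    change B (MulOpposite.op h • x) m = B x (h • m)
    refine hom_ext_of_iSup h3 (f := B (MulOpposite.op h • x))
      (g := (B x).comp (DistribSMul.toAddMonoidHom _ h)) ?_ m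
    intro k m hm
    change B (MulOpposite.op h • x) m = B x (h • m)
    rw [hB1 _ _ _ (T.op_smul_mem hh hx), hB1 _ _ _ hx, op_smul_tmul]
    by_cases hk : k = n - (i + j)
    · subst hk
      rw [h1 _ _ hm, h1 (n - i) _ (by convert M.smul_mem hh hm using 1; congr 1; ring)]
    · rw [h2 _ _ hk _ hm, h2 (j + k) (n - i) (by intro h; apply hk; linarith) _
        (M.smul_mem hh hm), smul_zero]
  obtain ⟨F, hF⟩ := T.exists_lift B hbal
  refine ⟨F, fun i j x m hx hm hij => ?_, fun i j x m hx hm hij => ?_⟩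
  · rw [hF, hB1 _ _ _ hx, h1 _ _ (by rwa [← hij, add_sub_cancel_left])]
  · rw [hF, hB1 _ _ _ hx, h2 j _ (by intro h; apply hij; linarith) _ hm]
    exact map_zero (T.tmulHom x)

theorem tens_internal (h𝓗 : ∀ h, h ∈ ⨆ n, 𝓗 n) : DirectSum.IsInternal (T.tensGr M) := by
  refine HasProj.isInternal ?_
  choose F hF1 hF2 using T.exists_proj (M := M) h𝓗
  refine ⟨⟨F, ?_, ?_⟩, ?_⟩
  · intro n x hx
    have : T.tensGr M n ≤ (F n).eqLocus (AddMonoidHom.id _) := by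
      refine (AddSubgroup.closure_le _).2 ?_
      rintro _ ⟨i, j, x, m, h, hx, hm, rfl⟩
      exact hF1 _ i j x m hx hm h
    exact this hx
  · intro m n hmn x hx
    have : T.tensGr M m ≤ (F n).ker := by
      refine (AddSubgroup.closure_le _).2 ?_
      rintro _ ⟨i, j, x, m, h, hx, hm, rfl⟩
      exact hF2 _ i j x m hx hm (fun h' => hmn (h ▸ h'))
    exact this hx
  · intro z
    refine T.tens_induction z (zero_mem _) (fun x m => ?_) (fun _ _ => add_mem)
    have hT := (hasProj_of_isInternal T.internal).2 x
    have hM := (hasProj_of_isInternal M.internal).2 m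
    have k1 : ∀ i, ∀ x ∈ T.gr i, (⨆ n, M.gr n) ≤ (⨆ n, T.tensGr M n).comap (T.tmulHom x) :=
      fun i x hx => iSup_le fun j m hm => AddSubgroup.mem_iSup_of_mem (i + j)
        (T.tmul_mem rfl hx hm)
    have k2 : (⨆ n, T.gr n) ≤ (⨆ n, T.tensGr M n).comap ((T.tmulHom (M := M)).flip m) :=
      iSup_le fun i x hx => k1 i x hx hM
    exact k2 hT

theorem tens_smul_mem {m n : ℤ} {l : L} {z : Tens T M} (hl : l ∈ 𝓛 m) (hz : z ∈ T.tensGr M n) :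
    l • z ∈ T.tensGr M (m + n) := by
  have : T.tensGr M n ≤ (T.tensGr M (m + n)).comap (DistribSMul.toAddMonoidHom _ l) := by
    refine (AddSubgroup.closure_le _).2 ?_
    rintro _ ⟨i, j, x, y, h, hx, hy, rfl⟩
    exact T.tmul_mem (by rw [← h, add_assoc]) (T.smul_mem hl hx) hy
  exact this hz

theorem tens_finite : Module.Finite L (Tens T M) := by
  obtain ⟨n, s, hs⟩ := Module.Finite.exists_fin (R := H) (M := M.carrier)
  let f : Fin n → T.carrier →ₗ[L] Tens T M := fun b =>
    { toFun := fun x => T.tmul x (s b)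
      map_add' := fun x y => by
        rw [tmul, TensorProduct.add_tmul, map_add]; rfl
      map_smul' := fun l x => rfl }
  refine ⟨?_⟩
  have h1 : (⨆ b, LinearMap.range (f b)) = ⊤ := by
    refine eq_top_iff.2 fun z _ => ?_
    refine T.tens_induction z (zero_mem _) (fun x m => ?_) (fun _ _ => add_mem)
    have hm : m ∈ Submodule.span H (Set.range s) := hs ▸ Submodule.mem_top
    induction hm using Submodule.span_induction generalizing x with
    | mem m hm =>
      obtain ⟨b, rfl⟩ := hm
      exact Submodule.mem_iSup_of_mem b ⟨x, rfl⟩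
    | zero =>
      have := map_zero (T.tmulHom (M := M) x)
      change T.tmul x 0 = 0 at this
      rw [this]
      exact zero_mem _
    | add m m' _ _ h h' =>
      have := map_add (T.tmulHom x) m m'
      change T.tmul x (m + m') = _ at this
      rw [this]
      exact add_mem (h x) (h' x)
    | smul r m _ h => rw [← op_smul_tmul]; exact h _
  rw [← h1]
  exact Submodule.fg_iSup _ fun b => Module.Finite.iff_fg.1 inferInstance

variable {M' : GrMod 𝓗}

/-- The map `T ⊗_H M → T ⊗_H M'` induced by a homomorphism `M → M'`. -/
def tensMap (f : M.carrier →ₗ[H] M'.carrier) : Tens T M →ₗ[L] Tens T M' :=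
  Submodule.mapQ _ _
    (TensorProduct.AlgebraTensorModule.lTensor L T.carrier (f.toAddMonoidHom.toIntLinearMap))
    (Submodule.span_le.2 (by
      rintro _ ⟨x, h, m, rfl⟩
      refine Submodule.subset_span ⟨x, h, f m, ?_⟩
      rw [map_sub]
      change (MulOpposite.op h • x) ⊗ₜ[ℤ] f m - x ⊗ₜ[ℤ] f (h • m) = _
      rw [f.map_smul]))

theorem tensMap_tmul (f : M.carrier →ₗ[H] M'.carrier) (x : T.carrier) (m : M.carrier) :
    T.tensMap f (T.tmul x m) = T.tmul x (f m) := rfl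

theorem tensMap_id (M : GrMod 𝓗) : T.tensMap (LinearMap.id (R := H) (M := M.carrier)) =
    LinearMap.id := by
  refine LinearMap.ext fun z => T.tens_induction (p := fun z => T.tensMap LinearMap.id z = z) z
    (map_zero _) (fun x m => rfl) (fun z w hz hw => ?_)
  rw [map_add, hz, hw]

theorem tensMap_comp {M'' : GrMod 𝓗} (f : M.carrier →ₗ[H] M'.carrier)
    (g : M'.carrier →ₗ[H] M''.carrier) :
    T.tensMap (g ∘ₗ f) = T.tensMap g ∘ₗ T.tensMap f := by
  refine LinearMap.ext fun z => T.tens_induction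
    (p := fun z => T.tensMap (g ∘ₗ f) z = T.tensMap g (T.tensMap f z)) z ?_ (fun x m => rfl)
    (fun z w hz hw => ?_)
  · rw [map_zero, map_zero, map_zero]
  · rw [map_add, map_add, map_add, hz, hw]

/-- The functor of tensor product with a graded bimodule. -/
def tensor (h𝓗 : ∀ h, h ∈ ⨆ n, 𝓗 n) : GrMod 𝓗 ⥤ GrMod 𝓛 where
  obj M :=
    { carrier := Tens T M
      gr := T.tensGr M
      internal := T.tens_internal h𝓗
      smul_mem := T.tens_smul_mem
      finite := T.tens_finite }
  map {M M'} f := ⟨T.tensMap f.toLin, fun {n z} hz => by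
    have : T.tensGr M n ≤ (T.tensGr M' n).comap (T.tensMap f.toLin).toAddMonoidHom := by
      refine (AddSubgroup.closure_le _).2 ?_
      rintro _ ⟨i, j, x, m, h, hx, hm, rfl⟩
      exact T.tmul_mem h hx (f.map_mem hm)
    exact this hz⟩
  map_id M := GrMod.Hom.ext (T.tensMap_id M)
  map_comp f g := GrMod.Hom.ext (T.tensMap_comp f.toLin g.toLin)

end GrBimod

section Bimodule

open CategoryTheory

variable {P Q : Type} [LinearOrder P] [Fintype P] [LinearOrder Q] [Fintype Q]

instance TangleModule.finite (T : FlatTangle P Q) :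
    Module.Finite (ArcRing Q) (TangleModule T) := by
  have : Finite (P ⊕ₗ Qᵒᵈ) := inferInstanceAs (Finite (P ⊕ Q))
  have h : Module.Finite ℤ (∀ (b : Matching Q) (a : Matching P),
    TQFT (Closure (Closure T.Graph botPt a) topPt b)) := inferInstance
  have h' : Module.Finite ℤ (TangleModule T) := h
  exact Module.Finite.of_restrictScalars_finite ℤ (ArcRing Q) (TangleModule T)

/-- The bimodule of a flat tangle as a graded bimodule. -/
noncomputable def FlatTangle.bimodule (T : FlatTangle P Q) :
    GrBimod (ArcRing.deg Q) (ArcRing.deg P) where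
  carrier := TangleModule T
  gr := TangleModule.deg T
  internal := TangleModule.hasProj.isInternal
  smul_mem := TangleModule.smul_mem
  op_smul_mem := TangleModule.op_smul_mem
  finite := TangleModule.finite T

/-- The functor of tensor product with the bimodule of a flat tangle. -/
noncomputable def FlatTangle.functor (T : FlatTangle P Q) :
    GrMod (ArcRing.deg P) ⥤ GrMod (ArcRing.deg Q) :=
  T.bimodule.tensor ArcRing.hasProj.2

end Bimodule

section Weights

open CategoryTheory

variable {n : ℕ}

/-- The positions at which a sequence of integers takes the value `1`. -/
abbrev Points (w : Fin n → ℤ) : Type := {j : Fin n // w j = 1}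

/-- Two sequences that are equal away from the positions `i` and `i + 1`, and such that for both
of these positions exactly one of the sequences takes the value `1`. -/
def Adjacent (i : ℕ) (w v : Fin n → ℤ) : Prop :=
  (∀ j : Fin n, j.val ≠ i → j.val ≠ i + 1 → w j = v j) ∧
    ∀ j : Fin n, j.val = i ∨ j.val = i + 1 → (w j = 1 ↔ v j ≠ 1)

/-- The end point at position `j`, which is at the bottom or at the top. -/
def stepPt {w v : Fin n → ℤ} (j : Fin n) (h : w j ≠ 1 → v j = 1) : Points w ⊕ₗ (Points v)ᵒᵈ :=
  if h' : w j = 1 then botPt ⟨j, h'⟩ else topPt ⟨j, h h'⟩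

/-- The other one of the two positions `i` and `i + 1`. -/
def otherPos {i : ℕ} (hi : i + 1 < n) (j : Fin n) : Fin n :=
  if j.val = i then ⟨i + 1, hi⟩ else ⟨i, Nat.lt_of_succ_lt hi⟩

theorem otherPos_local {i : ℕ} (hi : i + 1 < n) (j : Fin n) :
    (otherPos hi j).val = i ∨ (otherPos hi j).val = i + 1 := by
  unfold otherPos
  split
  · exact Or.inr rfl
  · exact Or.inl rfl

theorem otherPos_otherPos {i : ℕ} (hi : i + 1 < n) {j : Fin n} (h : j.val = i ∨ j.val = i + 1) :
    otherPos hi (otherPos hi j) = j := by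
  unfold otherPos
  ext
  rcases h with h | h <;> simp [h]

namespace Adjacent

variable {i : ℕ} {w v : Fin n → ℤ} (h : Adjacent i w v) (hi : i + 1 < n)

theorem exists_pt (h : Adjacent i w v) {j : Fin n} (hj : j.val = i ∨ j.val = i + 1) : w j ≠ 1 → v j = 1 := by
  intro h'
  by_contra h''
  exact h' ((h.2 j hj).2 h'')

/-- The end point of the step tangle at one of the positions `i` and `i + 1`. -/
def pt (j : Fin n) (hj : j.val = i ∨ j.val = i + 1) : Points w ⊕ₗ (Points v)ᵒᵈ :=
  stepPt j (h.exists_pt hj)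

/-- The end point joined to a given one: this exchanges the two end points at the positions
`i` and `i + 1`, and away from them joins each bottom point to the top point above it. -/
def partner (x : Points w ⊕ₗ (Points v)ᵒᵈ) : Points w ⊕ₗ (Points v)ᵒᵈ :=
  Sum.elim
    (fun p : Points w => if hp : p.1.val = i ∨ p.1.val = i + 1
      then h.pt (otherPos hi p.1) (otherPos_local hi p.1)
      else topPt ⟨p.1, by rw [← h.1 p.1 (fun e => hp (Or.inl e)) (fun e => hp (Or.inr e))]
                          exact p.2⟩)
    (fun q : Points v => if hq : q.1.val = i ∨ q.1.val = i + 1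
      then h.pt (otherPos hi q.1) (otherPos_local hi q.1)
      else botPt ⟨q.1, by rw [h.1 q.1 (fun e => hq (Or.inl e)) (fun e => hq (Or.inr e))]
                          exact q.2⟩)
    (Sum.map id OrderDual.ofDual (ofLex x))

theorem bot_eq_pt (p : Points w) (hp : p.1.val = i ∨ p.1.val = i + 1) :
    botPt p = h.pt p.1 hp := by
  rw [pt, stepPt, dif_pos p.2]

theorem top_eq_pt (q : Points v) (hq : q.1.val = i ∨ q.1.val = i + 1) :
    topPt q = h.pt q.1 hq := by
  rw [pt, stepPt, dif_neg (fun e => (h.2 q.1 hq).1 e q.2)]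

theorem partner_pt (j : Fin n) (hj : j.val = i ∨ j.val = i + 1) :
    h.partner hi (h.pt j hj) = h.pt (otherPos hi j) (otherPos_local hi j) := by
  by_cases e : w j = 1
  · rw [← h.bot_eq_pt ⟨j, e⟩ hj]
    exact dif_pos hj
  · rw [← h.top_eq_pt ⟨j, h.exists_pt hj e⟩ hj]
    exact dif_pos hj

theorem partner_bot (p : Points w) (hp : ¬ (p.1.val = i ∨ p.1.val = i + 1)) (hq : v p.1 = 1) :
    h.partner hi (botPt p) = topPt ⟨p.1, hq⟩ := dif_neg hp

theorem partner_top (q : Points v) (hq : ¬ (q.1.val = i ∨ q.1.val = i + 1)) (hp : w q.1 = 1) :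
    h.partner hi (topPt q) = botPt ⟨q.1, hp⟩ := dif_neg hq

theorem eq_one_iff (h : Adjacent i w v) {j : Fin n} (hj : ¬ (j.val = i ∨ j.val = i + 1)) : w j = 1 ↔ v j = 1 := by
  rw [h.1 j (fun e => hj (Or.inl e)) (fun e => hj (Or.inr e))]

theorem cases_pt (x : Points w ⊕ₗ (Points v)ᵒᵈ) :
    (∃ (p : Points w) (q : Points v), p.1 = q.1 ∧ ¬ (p.1.val = i ∨ p.1.val = i + 1) ∧
      ((x = botPt p ∧ h.partner hi x = topPt q) ∨ (x = topPt q ∧ h.partner hi x = botPt p))) ∨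
    ∃ j hj, x = h.pt j hj := by
  obtain ⟨p, rfl⟩ | ⟨q, rfl⟩ := botPt_or_topPt x
  · by_cases hp : p.1.val = i ∨ p.1.val = i + 1
    · exact Or.inr ⟨p.1, hp, h.bot_eq_pt p hp⟩
    · exact Or.inl ⟨p, ⟨p.1, (h.eq_one_iff hp).1 p.2⟩, rfl, hp,
        Or.inl ⟨rfl, h.partner_bot hi p hp _⟩⟩
  · by_cases hq : q.1.val = i ∨ q.1.val = i + 1
    · exact Or.inr ⟨q.1, hq, h.top_eq_pt q hq⟩
    · exact Or.inl ⟨⟨q.1, (h.eq_one_iff hq).2 q.2⟩, q, rfl, hq,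
        Or.inr ⟨rfl, h.partner_top hi q hq _⟩⟩

/-- The positions of the end points along the boundary. -/
def pos (x : Points w ⊕ₗ (Points v)ᵒᵈ) : ℕ :=
  Sum.elim (fun p : Points w => p.1.val) (fun q : Points v => 2 * n - q.1.val)
    (Sum.map id OrderDual.ofDual (ofLex x))

theorem pos_lt {x y : Points w ⊕ₗ (Points v)ᵒᵈ} (hxy : x < y) : pos x < pos y := by
  have hn : ∀ k : Fin n, k.val < n := fun k => k.2
  obtain ⟨p, rfl⟩ | ⟨q, rfl⟩ := botPt_or_topPt x <;>
  obtain ⟨p', rfl⟩ | ⟨q', rfl⟩ := botPt_or_topPt y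
  · have : p < p' := by simpa [botPt] using hxy
    exact this
  · have h1 := hn p.1
    have h2 := hn q'.1
    change p.1.val < 2 * n - q'.1.val
    omega
  · simp [botPt, topPt] at hxy
  · have h3 : q' < q := by simpa [topPt] using hxy
    have h3 : q'.1.val < q.1.val := h3
    have h1 := hn q.1
    have h2 := hn q'.1
    change 2 * n - q.1.val < 2 * n - q'.1.val
    omega

theorem pos_pt (j : Fin n) (hj : j.val = i ∨ j.val = i + 1) :
    pos (h.pt j hj) = j.val ∨ pos (h.pt j hj) = 2 * n - j.val := by
  by_cases e : w j = 1
  · rw [← h.bot_eq_pt ⟨j, e⟩ hj]; exact Or.inl rfl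
  · rw [← h.top_eq_pt ⟨j, h.exists_pt hj e⟩ hj]; exact Or.inr rfl

theorem cases_pos : ∃ P₀ P₁ : ℕ, (P₀ = i ∨ P₀ = 2 * n - i) ∧
    (P₁ = i + 1 ∨ P₁ = 2 * n - (i + 1)) ∧ ∀ x,
    (∃ k, k < n ∧ k ≠ i ∧ k ≠ i + 1 ∧ ((pos x = k ∧ pos (h.partner hi x) = 2 * n - k) ∨
      (pos x = 2 * n - k ∧ pos (h.partner hi x) = k))) ∨
    (pos x = P₀ ∧ pos (h.partner hi x) = P₁) ∨ (pos x = P₁ ∧ pos (h.partner hi x) = P₀) := by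
  refine ⟨pos (h.pt ⟨i, Nat.lt_of_succ_lt hi⟩ (Or.inl rfl)), pos (h.pt ⟨i + 1, hi⟩ (Or.inr rfl)),
    h.pos_pt _ _, h.pos_pt _ _, fun x => ?_⟩
  obtain ⟨p, q, hpq, hp, ⟨rfl, h2⟩ | ⟨rfl, h2⟩⟩ | ⟨j, hj, rfl⟩ := h.cases_pt hi x
  · refine Or.inl ⟨p.1.val, p.1.2, fun e => hp (Or.inl e), fun e => hp (Or.inr e), Or.inl ⟨rfl, ?_⟩⟩
    rw [h2, hpq]; rfl
  · refine Or.inl ⟨p.1.val, p.1.2, fun e => hp (Or.inl e), fun e => hp (Or.inr e), Or.inr ⟨?_, ?_⟩⟩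
    · rw [hpq]; rfl
    · rw [h2]; rfl
  · right
    rw [h.partner_pt hi j hj]
    obtain ⟨j, hjn⟩ := j
    rcases hj with e | e
    · change j = i at e
      subst e
      left
      refine ⟨rfl, ?_⟩
      congr 2
      simp [otherPos]
    · change j = i + 1 at e
      subst e
      right
      refine ⟨rfl, ?_⟩
      congr 2
      simp [otherPos]

/-- The flat tangle joining the end points at the positions `i` and `i + 1` to each other, and each
other bottom point to the top point above it. Depending on the sides of
the two end points at the positions `i` and `i + 1`, it moves a strand by one position, or is a
cup, or is a cap. -/
def tangle : FlatTangle (Points w) (Points v) where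
  toFun := h.partner hi
  invol x := by
    obtain ⟨p, q, hpq, hp, ⟨rfl, h2⟩ | ⟨rfl, h2⟩⟩ | ⟨j, hj, rfl⟩ := h.cases_pt hi x
    · rw [h2, h.partner_top hi q (hpq ▸ hp) (hpq ▸ p.2)]
      exact congrArg botPt (Subtype.ext hpq.symm)
    · rw [h2, h.partner_bot hi p hp (hpq ▸ q.2)]
      exact congrArg topPt (Subtype.ext hpq)
    · rw [h.partner_pt, h.partner_pt]
      congr 1
      exact otherPos_otherPos hi hj
  ne x hx := by
    obtain ⟨P₀, P₁, h0, h1, hP⟩ := h.cases_pos hi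
    have := hP x
    rw [hx] at this
    omega
  crossingless x y h1 h2 h3 := by
    obtain ⟨P₀, P₁, hP0, hP1, hP⟩ := h.cases_pos hi
    have hx := hP x
    have hy := hP y
    have e1 := pos_lt h1
    have e2 := pos_lt h2
    have e3 := pos_lt h3
    rcases hx with ⟨k, _, _, _, _⟩ | hx <;> rcases hy with ⟨l, _, _, _, _⟩ | hy <;> omega

end Adjacent

/-- The weights: sequences of integers between `0` and `2` with sum `2k`. -/
def IsWeight (k : ℕ) (w : Fin n → ℤ) : Prop :=
  (∀ j, 0 ≤ w j ∧ w j ≤ 2) ∧ ∑ j, w j = 2 * k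

/-- The simple root `α_i = (0, …, 0, 1, -1, 0, …, 0)`, with `1` at the position `i`. -/
def root {i : ℕ} (hi : i + 1 < n) : Fin n → ℤ :=
  Pi.single ⟨i, Nat.lt_of_succ_lt hi⟩ 1 - Pi.single ⟨i + 1, hi⟩ 1

theorem adjacent_of_isWeight {k i : ℕ} (hi : i + 1 < n) {w v : Fin n → ℤ} (hw : IsWeight k w)
    (hv : IsWeight k v) (h : v = w + root hi ∨ w = v + root hi) : Adjacent i w v := by
  have key : ∀ {w v : Fin n → ℤ}, IsWeight k w → IsWeight k v → v = w + root hi →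
      Adjacent i w v := by
    intro w v hw hv h
    have hr : ∀ j, v j = w j + root hi j := fun j => by rw [h]; rfl
    refine ⟨fun j h1 h2 => ?_, fun j hj => ?_⟩
    · have := hr j
      simp [root, Fin.ext_iff, h1, h2] at this
      exact this.symm
    · have h1 := hr j
      have h2 := hw.1 j
      have h3 := hv.1 j
      rcases hj with hj | hj
      · simp [root, Pi.single_apply, Fin.ext_iff, hj] at h1
        omega
      · simp [root, Pi.single_apply, Fin.ext_iff, hj] at h1
        omega
  rcases h with h | h
  · exact key hw hv h
  · obtain ⟨h1, h2⟩ := key hv hw h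
    refine ⟨fun j a b => (h1 j a b).symm, fun j hj => ?_⟩
    have := h2 j hj
    tauto

end Weights

section Categories

open CategoryTheory

variable (n k : ℕ)

/-- The weights, as a type. -/
abbrev Weight : Type := {w : Fin n → ℤ // IsWeight k w}

/-- The category `𝒞(w)` of finitely generated graded modules over the arc ring on the positions at
which the weight `w` takes the value `1`. -/
abbrev WeightCat (w : Weight n k) : Type 1 := GrMod (ArcRing.deg (Points w.1))

/-- The category `𝒞`, the direct sum of the categories `𝒞(w)` over the finite set of weights. -/
abbrev TotalCat : Type 1 := ∀ w : Weight n k, WeightCat n k w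

variable {n k}

/-- The functor `𝒞(w) ⥤ 𝒞(v)` for weights that differ by a simple root. -/
noncomputable def stepFunctor {i : ℕ} (hi : i + 1 < n) (w v : Weight n k)
    (h : v.1 = w.1 + root hi ∨ w.1 = v.1 + root hi) : WeightCat n k w ⥤ WeightCat n k v :=
  ((adjacent_of_isWeight hi w.2 v.2 h).tangle hi).functor

open Classical in
/-- The functor `E_i`, which maps `𝒞(w)` to `𝒞(w + α_i)` if `w + α_i` is a weight, and
to zero otherwise. Its component at the weight `v` is computed from the component at `v - α_i`. -/
noncomputable def functorE {i : ℕ} (hi : i + 1 < n) : TotalCat n k ⥤ TotalCat n k :=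
  Functor.pi' fun v =>
    if h : IsWeight k (v.1 - root hi) then
      Pi.eval (WeightCat n k) ⟨v.1 - root hi, h⟩ ⋙
        stepFunctor hi ⟨v.1 - root hi, h⟩ v (Or.inl (sub_add_cancel _ _).symm)
    else (Functor.const _).obj (GrMod.zero _)

open Classical in
/-- The functor `F_i`, which maps `𝒞(w)` to `𝒞(w - α_i)` if `w - α_i` is a weight, and
to zero otherwise. Its component at the weight `v` is computed from the component at `v + α_i`. -/
noncomputable def functorF {i : ℕ} (hi : i + 1 < n) : TotalCat n k ⥤ TotalCat n k :=
  Functor.pi' fun v =>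
    if h : IsWeight k (v.1 + root hi) then
      Pi.eval (WeightCat n k) ⟨v.1 + root hi, h⟩ ⋙
        stepFunctor hi ⟨v.1 + root hi, h⟩ v (Or.inr rfl)
    else (Functor.const _).obj (GrMod.zero _)

/-- The functor `K_i`, which raises the grading of the objects of `𝒞(w)` by `w_i - w_{i+1}`. -/
noncomputable def functorK {i : ℕ} (hi : i + 1 < n) : TotalCat n k ⥤ TotalCat n k :=
  Functor.pi fun w => GrMod.shift (w.1 ⟨i, Nat.lt_of_succ_lt hi⟩ - w.1 ⟨i + 1, hi⟩)

/-- The functor `K_i⁻¹`, which lowers the grading of the objects of `𝒞(w)` by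
`w_i - w_{i+1}`. -/
noncomputable def functorKinv {i : ℕ} (hi : i + 1 < n) : TotalCat n k ⥤ TotalCat n k :=
  Functor.pi fun w => GrMod.shift (-(w.1 ⟨i, Nat.lt_of_succ_lt hi⟩ - w.1 ⟨i + 1, hi⟩))

/-- The functor `{j}` raising the grading by `j`. -/
noncomputable def functorShift (j : ℤ) : TotalCat n k ⥤ TotalCat n k :=
  Functor.pi fun _ => GrMod.shift j

end Categories

end ArcAlgebra

open CategoryTheory ArcAlgebra

/-! The adjunctions come from duality of bimodules. For a flat tangle `T` from `P` to `Q` with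
mirror image `T'`, write F(T), F(T') for the bimodules and H_P, H_Q for the arc rings. The claim is
that F(T) and F(T') are dual over H_Q up to a shift by |Q|/2 - |P|/2: there is an H_Q-valued pairing
ε, balanced over H_P, with finite homogeneous dual bases x_i, y_i. Then m ↦ Σ y_i ⊗ (x_i ⊗ m) and x
⊗ (y ⊗ n) ↦ ε(x, y) n are the unit and the counit of an adjunction (`DualPair.adjunction`).

The pairing is first built over ℤ. The Frobenius trace of a closed diagram is a perfect form, and
multiplying after reflection and taking the trace pairs F(W(b)Ta) with F(W(a)T'b). Two facts make
this useful. The sum of the traces of the diagonal entries is a symmetrizing form θ on H_Q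
(`ArcRing.symmetricForm`), so an integral pairing B lifts uniquely to ε with B(lx, y) = θ(l ε(x, y))
(`SymmetricForm.exists_dualPair`). And the actions of the arc rings are adjoint under the pairing
(`FlatTangle.IsMirror.entryPairing_contract`).

Both facts rest on one topological computation, `tracePoly_contract_self`: for x in F(W(c)b) and y
in F(W(b)c), the trace of the product xy in F(W(c)c) is the trace in F(W(c)b) of x times the
reflection of y. The saddles from W(c)b ⊔ W(b)c to W(c)c sweep out a surface of genus zero, one
component for each circle of W(c)b, and a genus zero saddle surface is evaluated by the trace of its
set of components (`SurgerySystem.tracePoly_prod`). The general adjointness follows by associativity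
and reflection.

For the dual bases, closing the bottom of `T` by a matching a leaves a crossingless matching d(a) of
the top points together with closed circles (`FlatTangle.exists_induces`). Hence F(T) is the sum
over a of H_Q 1_{d(a)} ⊗ A^{⊗ closed circles}, a projective left module, whose generators are the
monomials in the closed circles; the complementary monomials, reflected, are dual to them.

The step tangles for λ → λ + α_i and back are mirror images. The number |Q|/2 - |P|/2 is then 1 -
(μ_i - μ_{i+1}) for E_i with target μ, and 1 + (λ_i - λ_{i+1}) for F_i with target λ
(`card_points`); this is the shift in the proposition. The components are assembled by
`nonempty_adjunction_of_components`. -/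

namespace ArcAlgebra

/-! ### The Frobenius trace on closed diagrams. -/

section Trace

open MvPolynomial

/-- The exponent in which each variable occurs exactly once. -/
noncomputable def ones (C : Type) [Finite C] : C →₀ ℕ := Finsupp.equivFunOnFinite.symm fun _ => 1

theorem ones_apply {C : Type} [Finite C] (c : C) : ones C c = 1 := rfl

/-- The trace of the Frobenius structure on the value of the TQFT on the closed diagram with edges
`R`, on polynomials: the coefficient of the product of the variables of the circles. -/
noncomputable def tracePoly {V : Type} [Finite V] (R : V → V → Prop) :
    MvPolynomial V ℤ →ₗ[ℤ] ℤ :=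
  lcoeff ℤ (ones (Quot R)) ∘ₗ (rename (Quot.mk R)).toLinearMap

variable {V : Type} [Finite V] {R R' : V → V → Prop}

theorem tracePoly_apply (f : MvPolynomial V ℤ) :
    tracePoly R f = coeff (ones (Quot R)) (rename (Quot.mk R) f) := rfl

/-- A multiple of a square never contains the product of distinct circle variables, and a difference
of adjacent variables dies once variables are indexed by circles. The induction over the span is run
for all multiples `h * g`, so that it passes through the ideal. -/
theorem tracePoly_of_mem {f : MvPolynomial V ℤ} (hf : f ∈ circleIdeal R) :
    tracePoly R f = 0 := by
  classical
  have key : ∀ g ∈ circleIdeal R, ∀ h, tracePoly R (h * g) = 0 := by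
    intro g hg
    refine Submodule.span_induction ?_ ?_ ?_ ?_ hg
    · rintro _ (⟨v, rfl⟩ | ⟨v, w, hvw, rfl⟩) h
      · rw [tracePoly_apply, map_mul, map_pow, rename_X, X_pow_eq_monomial, coeff_mul_monomial',
          if_neg]
        intro hle
        have := hle (Quot.mk R v)
        rw [Finsupp.single_eq_same, ones_apply] at this
        omega
      · rw [tracePoly_apply, map_mul, map_sub, rename_X, rename_X, Quot.sound hvw, sub_self,
          mul_zero, coeff_zero]
    · intro h; rw [mul_zero, map_zero]
    · intro x y _ _ hx hy h; rw [mul_add, map_add, hx, hy, add_zero]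
    · intro a x _ hx h; rw [smul_eq_mul, ← mul_assoc]; exact hx _
  simpa using key f hf 1

theorem tracePoly_eq_of_sub_mem {f g : MvPolynomial V ℤ} (h : f - g ∈ circleIdeal R) :
    tracePoly R f = tracePoly R g := by
  rw [← sub_eq_zero, ← map_sub]; exact tracePoly_of_mem h

/-- A bijection of the sets of circles carries the exponent with all entries 1 to itself, so the
coefficient is the same. -/
theorem tracePoly_rename {W : Type} [Finite W] {S : W → W → Prop} (φ : V → W)
    (e : Quot R ≃ Quot S) (he : ∀ v, e (Quot.mk R v) = Quot.mk S (φ v)) (f : MvPolynomial V ℤ) :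
    tracePoly S (rename φ f) = tracePoly R f := by
  have h1 : (Quot.mk S ∘ φ) = e ∘ Quot.mk R := funext fun v => (he v).symm
  have h2 : ones (Quot S) = (ones (Quot R)).mapDomain e := by
    ext q
    obtain ⟨q, rfl⟩ := e.surjective q
    rw [Finsupp.mapDomain_apply e.injective, ones_apply, ones_apply]
  rw [tracePoly_apply, tracePoly_apply, rename_rename, h1, ← rename_rename, h2,
    coeff_rename_mapDomain _ e.injective]

theorem tracePoly_congr (h : ∀ x y, SameCircle R x y ↔ SameCircle R' x y) (f : MvPolynomial V ℤ) :
    tracePoly R f = tracePoly R' f := by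
  have := tracePoly_rename (R := R) (S := R') id
    ⟨Quot.lift (Quot.mk R') fun x y hxy => (h x y).1 (SameCircle.of hxy),
      Quot.lift (Quot.mk R) fun x y hxy => (h x y).2 (SameCircle.of hxy),
      fun x => by induction x using Quot.ind; rfl, fun x => by induction x using Quot.ind; rfl⟩
    (fun v => rfl) f
  rw [rename_id, AlgHom.id_apply] at this
  exact this.symm

/-- A dotted diagram has nonzero trace only if every circle carries exactly one dot: tr(1) = 0,
tr(X) = 1 and X² = 0. -/
theorem tracePoly_monomial (m : V →₀ ℕ) [Decidable (∀ q, m.mapDomain (Quot.mk R) q = 1)] (c : ℤ) :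
    tracePoly R (monomial m c) = if ∀ q, m.mapDomain (Quot.mk R) q = 1 then c else 0 := by
  classical
  rw [tracePoly_apply, rename_monomial, coeff_monomial]
  have : (m.mapDomain (Quot.mk R) = ones (Quot R)) ↔ ∀ q, m.mapDomain (Quot.mk R) q = 1 :=
    ⟨fun h q => by rw [h, ones_apply], fun h => Finsupp.ext h⟩
  simp only [this]

/-- Merging two circles is adjoint to splitting them. -/
theorem tracePoly_merge {a b : V} (h1 : ∀ x y, SameCircle R x y → SameCircle R' x y)
    (h2 : SameCircle R' a b) (h3 : ¬ SameCircle R a b)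
    (h4 : ∀ x y, SameCircle R' x y → Join (SameCircle R) a b x y) (f : MvPolynomial V ℤ) :
    tracePoly R' f = tracePoly R ((X a + X b) * f) := by
  classical
  induction f using MvPolynomial.induction_on' with
  | add f g hf hg => rw [map_add, mul_add, map_add, hf, hg]
  | monomial m c =>
    -- `π` identifies the circles of `a` and `b` and is injective otherwise. Below, `n` counts the
    -- dots of the monomial on the circles before the merger.
    let π : Quot R → Quot R' := Quot.lift (Quot.mk R') (fun x y h => h1 x y (SameCircle.of h))
    set n := m.mapDomain (Quot.mk R) with hn
    have hm : m.mapDomain (Quot.mk R') = n.mapDomain π := by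
      rw [hn, ← Finsupp.mapDomain_comp]; rfl
    have hne : Quot.mk R a ≠ Quot.mk R b := h3
    have hπ : ∀ q q', π q = π q' → q = q' ∨ (q = Quot.mk R a ∧ q' = Quot.mk R b) ∨
        (q = Quot.mk R b ∧ q' = Quot.mk R a) := by
      intro q q' h
      induction q using Quot.ind with | _ x
      induction q' using Quot.ind with | _ y
      rcases h4 x y h with h | ⟨h, h'⟩ | ⟨h, h'⟩
      · exact Or.inl h
      · exact Or.inr (Or.inl ⟨h, h'.symm⟩)
      · exact Or.inr (Or.inr ⟨h, h'.symm⟩)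
    have := Fintype.ofFinite (Quot R)
    have hval : ∀ q, n.mapDomain π q = ∑ q', if π q' = q then n q' else 0 := by
      intro q
      rw [Finsupp.mapDomain, Finsupp.sum_fintype _ _ (by simp), Finsupp.finsetSum_apply]
      exact Finset.sum_congr rfl fun q' _ => Finsupp.single_apply
    have hva : n.mapDomain π (π (Quot.mk R a)) = n (Quot.mk R a) + n (Quot.mk R b) := by
      rw [hval, ← Finset.sum_filter]
      have : Finset.univ.filter (fun q' => π q' = π (Quot.mk R a)) =
          {Quot.mk R a, Quot.mk R b} := by
        ext q
        simp only [Finset.mem_filter, Finset.mem_univ, true_and, Finset.mem_insert,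
          Finset.mem_singleton]
        constructor
        · intro h
          rcases hπ q (Quot.mk R a) h with h | h | h
          · exact Or.inl h
          · exact absurd h.2 hne
          · exact Or.inr h.1
        · rintro (rfl | rfl)
          · rfl
          · exact h2.symm
      rw [this, Finset.sum_pair hne]
    have hvo : ∀ q, q ≠ Quot.mk R a → q ≠ Quot.mk R b → n.mapDomain π (π q) = n q := by
      intro q ha hb
      rw [hval, ← Finset.sum_filter]
      have : Finset.univ.filter (fun q' => π q' = π q) = {q} := by
        ext q'
        simp only [Finset.mem_filter, Finset.mem_univ, true_and, Finset.mem_singleton]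
        constructor
        · intro h
          rcases hπ q' q h with h | h | h
          · exact h
          · exact absurd h.2 hb
          · exact absurd h.2 ha
        · rintro rfl; rfl
      rw [this, Finset.sum_singleton]
    have hab : π (Quot.mk R b) = π (Quot.mk R a) := h2.symm
    -- After the merger: one dot in total on the two merged circles and one on each other circle.
    have hL : (∀ q, m.mapDomain (Quot.mk R') q = 1) ↔
        n (Quot.mk R a) + n (Quot.mk R b) = 1 ∧
          ∀ q, q ≠ Quot.mk R a → q ≠ Quot.mk R b → n q = 1 := by
      rw [hm]
      constructor
      · intro h
        exact ⟨by rw [← hva]; exact h _, fun q ha hb => by rw [← hvo q ha hb]; exact h _⟩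
      · rintro ⟨h, h'⟩ q
        induction q using Quot.ind with | _ x
        change n.mapDomain π (π (Quot.mk R x)) = 1
        by_cases ha : Quot.mk R x = Quot.mk R a
        · rw [ha, hva, h]
        by_cases hb : Quot.mk R x = Quot.mk R b
        · rw [hb, hab, hva, h]
        rw [hvo _ ha hb, h' _ ha hb]
    -- Before the merger, with one more dot at `u`: no dot of the monomial on the circle of `u` and
    -- one on the circle of `u'`. For `u = a` and `u = b` these are the two disjoint ways of having
    -- total 1 in `hL`, which is why the two terms of the splitting add up to the trace of the
    -- merger.
    have hR : ∀ u u', (u = a ∧ u' = b) ∨ (u = b ∧ u' = a) →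
        ((∀ q, (Finsupp.single u 1 + m).mapDomain (Quot.mk R) q = 1) ↔
        (n (Quot.mk R u) = 0 ∧ n (Quot.mk R u') = 1) ∧
          ∀ q, q ≠ Quot.mk R a → q ≠ Quot.mk R b → n q = 1) := by
      intro u u' hu
      have hne' : Quot.mk R u ≠ Quot.mk R u' := by
        rcases hu with ⟨rfl, rfl⟩ | ⟨rfl, rfl⟩
        · exact hne
        · exact hne.symm
      have hq : ∀ q, (q ≠ Quot.mk R a → q ≠ Quot.mk R b → n q = 1) ↔
          (q ≠ Quot.mk R u → q ≠ Quot.mk R u' → n q = 1) := by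
        rcases hu with ⟨rfl, rfl⟩ | ⟨rfl, rfl⟩ <;> intro q <;> tauto
      simp only [hq, Finsupp.mapDomain_add, Finsupp.mapDomain_single, Finsupp.add_apply, ← hn]
      constructor
      · intro h
        have e1 := h (Quot.mk R u)
        have e2 := h (Quot.mk R u')
        rw [Finsupp.single_eq_same] at e1
        rw [Finsupp.single_eq_of_ne hne'.symm] at e2
        refine ⟨⟨by omega, by omega⟩, fun q ha hb => ?_⟩
        have := h q
        rwa [Finsupp.single_eq_of_ne ha, zero_add] at this
      · rintro ⟨⟨e1, e2⟩, h⟩ q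
        by_cases ha : q = Quot.mk R u
        · subst ha; rw [Finsupp.single_eq_same, e1]
        by_cases hb : q = Quot.mk R u'
        · subst hb; rw [Finsupp.single_eq_of_ne hne'.symm, e2]
        rw [Finsupp.single_eq_of_ne ha, zero_add, h q ha hb]
    rw [add_mul, map_add, X, X, monomial_mul, monomial_mul, one_mul, tracePoly_monomial,
      tracePoly_monomial, tracePoly_monomial]
    simp only [hL, hR a b (Or.inl ⟨rfl, rfl⟩), hR b a (Or.inr ⟨rfl, rfl⟩)]
    by_cases h : ∀ q, q ≠ Quot.mk R a → q ≠ Quot.mk R b → n q = 1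
    · simp only [and_iff_left h]
      split_ifs <;> omega
    · rw [if_neg fun x => h x.2, if_neg fun x => h x.2, if_neg fun x => h x.2, add_zero]

/-- The monomial read off by the trace has one variable of weight 2 for each circle. All vanishing
statements by degree come from here. -/
theorem tracePoly_of_weight {f : MvPolynomial V ℤ} {n : ℤ}
    (hf : IsWeightedHomogeneous (two V) f n) (hn : n ≠ 2 * circles R) : tracePoly R f = 0 := by
  by_contra h
  apply hn
  have := Fintype.ofFinite (Quot R)
  have h1 := rename_weight (Quot.mk R) hf h
  rw [← h1, Finsupp.weight_apply, Finsupp.sum_fintype _ _ (by simp), circles,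
    Nat.card_eq_fintype_card]
  simp [ones_apply, two, mul_comm]

end Trace

end ArcAlgebra

namespace ArcAlgebra

/-! ### Closed components of open diagrams. -/

section ClosedComponents

open MvPolynomial

variable {P V : Type}

/-- The components of an open diagram that contain no boundary point. -/
def ClosedComp (R : V → V → Prop) (bd : P → V) : Type :=
  {κ : Quot R // ∀ p, κ ≠ Quot.mk R (bd p)}

variable {R : V → V → Prop} {bd : P → V}

/-- A vertex on a closed component. -/
noncomputable def ClosedComp.pt (κ : ClosedComp R bd) : V := κ.1.out

theorem ClosedComp.mk_pt (κ : ClosedComp R bd) : Quot.mk R κ.pt = κ.1 := Quot.out_eq _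

instance [Finite V] : Finite (ClosedComp R bd) :=
  inferInstanceAs (Finite {κ : Quot R // ∀ p, κ ≠ Quot.mk R (bd p)})

noncomputable instance [Finite V] : Fintype (ClosedComp R bd) := Fintype.ofFinite _

noncomputable instance : DecidableEq (ClosedComp R bd) := Classical.decEq _

/-- The product of the variables of the closed components in `S`. -/
noncomputable def closedMonomial (S : Finset (ClosedComp R bd)) : MvPolynomial V ℤ :=
  ∏ κ ∈ S, X κ.pt

/-- A common component contributes the square of its variable. -/
theorem closedMonomial_mul_mem {S S' : Finset (ClosedComp R bd)} (h : ¬ Disjoint S S') :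
    closedMonomial S * closedMonomial S' ∈ circleIdeal R := by
  obtain ⟨κ, h1, h2⟩ := Finset.not_disjoint_iff.1 h
  unfold closedMonomial
  rw [← Finset.mul_prod_erase S _ h1, ← Finset.mul_prod_erase S' _ h2]
  rw [show ∀ a b c : MvPolynomial V ℤ, a * b * (a * c) = b * c * a ^ 2 by intros; ring]
  exact Ideal.mul_mem_left _ _ (X_sq_mem _)

theorem closedMonomial_mul {S S' : Finset (ClosedComp R bd)} (h : Disjoint S S') :
    (closedMonomial S * closedMonomial S' : MvPolynomial V ℤ) = closedMonomial (S ∪ S') :=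
  (Finset.prod_union h).symm

/-- Modulo the relations of an open diagram, the polynomials are spanned by the products of
polynomials in the boundary points and of monomials in the closed components. -/
theorem closed_induction {p : MvPolynomial V ℤ → Prop} (f : MvPolynomial V ℤ)
    (hadd : ∀ f g, p f → p g → p (f + g)) (hI : ∀ f g, f - g ∈ circleIdeal R → p f → p g)
    (h : ∀ g (S : Finset (ClosedComp R bd)), p (rename bd g * closedMonomial S)) : p f := by
  -- Modulo the ideal, multiplication by one variable keeps the spanning set stable: the variable is
  -- absorbed into `g` if its component reaches the boundary, gives zero if its closed component is
  -- already in `S`, and enlarges `S` otherwise.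
  have hX : ∀ v g (S : Finset (ClosedComp R bd)), ∃ g',
      ∃ S' : Finset (ClosedComp R bd),
      rename bd g' * closedMonomial S' - X v * (rename bd g * closedMonomial S) ∈
        circleIdeal R := by
    intro v g S
    by_cases hv : ∃ q, Quot.mk R v = Quot.mk R (bd q)
    · obtain ⟨q, hq⟩ := hv
      refine ⟨X q * g, S, ?_⟩
      have := Ideal.mul_mem_right (rename bd g * closedMonomial S) _ (X_sub_mem (SameCircle.symm hq))
      convert this using 1
      rw [map_mul, rename_X]; ring
    · let κ : ClosedComp R bd := ⟨Quot.mk R v, fun q hq => hv ⟨q, hq⟩⟩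
      have hκ : SameCircle R κ.pt v := κ.mk_pt
      by_cases hS : κ ∈ S
      · refine ⟨0, ∅, ?_⟩
        have h1 : closedMonomial {κ} * closedMonomial S ∈ circleIdeal R :=
          closedMonomial_mul_mem (by simpa using hS)
        have h2 : (closedMonomial {κ} : MvPolynomial V ℤ) = X κ.pt := Finset.prod_singleton _ _
        rw [h2] at h1
        convert Ideal.sub_mem _ (Ideal.mul_mem_left _ (rename bd g * closedMonomial S)
          (X_sub_mem hκ)) (Ideal.mul_mem_left _ (rename bd g) h1) using 1
        rw [map_zero]; ring
      · refine ⟨g, insert κ S, ?_⟩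
        have h2 : (closedMonomial (insert κ S) : MvPolynomial V ℤ) = X κ.pt * closedMonomial S :=
          Finset.prod_insert hS
        rw [h2]
        convert Ideal.mul_mem_left _ (rename bd g * closedMonomial S) (X_sub_mem hκ) using 1
        ring
  -- The claim is strengthened to products with spanning elements, so that variables can be stripped
  -- off `f` one at a time.
  have key : ∀ g (S : Finset (ClosedComp R bd)), p (f * (rename bd g * closedMonomial S)) := by
    induction f using MvPolynomial.induction_on with
    | C n =>
      intro g S
      have := h (C n * g) S
      rwa [map_mul, rename_C, mul_assoc] at this
    | add f f' hf hf' => intro g S; rw [add_mul]; exact hadd _ _ (hf g S) (hf' g S)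
    | mul_X f v hf =>
      intro g S
      obtain ⟨g', S', h'⟩ := hX v g S
      refine hI _ _ ?_ (hf g' S')
      rw [mul_assoc, ← mul_sub]
      exact Ideal.mul_mem_left _ _ h'
  have h0 := key 1 ∅
  rwa [map_one, one_mul, closedMonomial, Finset.prod_empty, mul_one] at h0

theorem exists_closed_sum [Finite V] (f : MvPolynomial V ℤ) :
    ∃ G : Finset (ClosedComp R bd) → MvPolynomial P ℤ,
      f - ∑ S, rename bd (G S) * closedMonomial S ∈ circleIdeal R := by
  classical
  refine closed_induction (R := R) (bd := bd) (p := fun f => ∃ G : _ → MvPolynomial P ℤ,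
    f - ∑ S, rename bd (G S) * closedMonomial S ∈ circleIdeal R) f ?_ ?_ ?_
  · rintro f g ⟨G, hG⟩ ⟨G', hG'⟩
    refine ⟨fun S => G S + G' S, ?_⟩
    convert Ideal.add_mem _ hG hG' using 1
    simp only [map_add, add_mul, Finset.sum_add_distrib]
    ring
  · rintro f g h ⟨G, hG⟩
    refine ⟨G, ?_⟩
    convert Ideal.sub_mem _ hG h using 1
    ring
  · intro g S
    refine ⟨fun S' => if S' = S then g else 0, ?_⟩
    rw [Finset.sum_eq_single S]
    · simp
    · intro S' _ hS'; simp [hS']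
    · simp

theorem circleIdeal_le_closure [LinearOrder P] (c : Matching P) :
    circleIdeal R ≤ circleIdeal (Closure R bd c) := by
  intro f hf
  have := circleIdeal_map_le (R' := Closure R bd c) id (fun x y h => SameCircle.of (.inner h)) hf
  rwa [rename_id, AlgHom.id_apply] at this

variable [LinearOrder P]

/-- The open diagram with edges `R` and boundary points `bd p` consists of the arcs of `d` and of
closed components. -/
def Induces (R : V → V → Prop) (bd : P → V) (d : Matching P) : Prop :=
  ∀ p q, SameCircle R (bd p) (bd q) ↔ SameCircle d.Graph p q

variable {d : Matching P}

/-- The circles of the closure of an open diagram. -/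
theorem exists_closureEquiv (hd : Induces R bd d) (c : Matching P) :
    ∃ e : Quot (Closure R bd c) ≃ Quot (Closure d.Graph id c) ⊕ ClosedComp R bd,
      (∀ p, e (Quot.mk _ (bd p)) = .inl (Quot.mk _ p)) ∧
      ∀ κ : ClosedComp R bd, e (Quot.mk _ κ.pt) = .inr κ := by
  classical
  have hinj : ∀ p q, SameCircle R (bd p) (bd q) → SameCircle (Closure d.Graph id c) p q :=
    fun p q h => ((hd p q).1 h).map id fun x y h => SameCircle.of (.inner h)
  -- A vertex whose component meets the boundary goes to the circle of any boundary point met;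
  -- `hinj` makes the choice irrelevant. Any other vertex lies on a closed component, which the
  -- closing arcs do not touch.
  let f : V → Quot (Closure d.Graph id c) ⊕ ClosedComp R bd := fun v =>
    if h : ∃ p, Quot.mk R v = Quot.mk R (bd p) then .inl (Quot.mk _ h.choose)
    else .inr ⟨Quot.mk R v, fun p hp => h ⟨p, hp⟩⟩
  have f1 : ∀ v p, Quot.mk R v = Quot.mk R (bd p) → f v = .inl (Quot.mk _ p) := by
    intro v p hp
    have h : ∃ p, Quot.mk R v = Quot.mk R (bd p) := ⟨p, hp⟩
    simp only [f]
    rw [dif_pos h]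
    exact congrArg _ (hinj _ _ (h.choose_spec.symm.trans hp))
  have f2 : ∀ v (κ : ClosedComp R bd), Quot.mk R v = κ.1 → f v = .inr κ := by
    intro v κ hκ
    have h : ¬ ∃ p, Quot.mk R v = Quot.mk R (bd p) := by
      rintro ⟨p, hp⟩; exact κ.2 p (hκ.symm.trans hp)
    simp only [f]
    rw [dif_neg h]
    exact congrArg _ (Subtype.ext hκ)
  have hf : ∀ v w, Closure R bd c v w → f v = f w := by
    intro v w h
    cases h with
    | inner h =>
      by_cases hv : ∃ p, Quot.mk R v = Quot.mk R (bd p)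
      · obtain ⟨p, hp⟩ := hv
        rw [f1 v p hp, f1 w p ((Quot.sound h).symm.trans hp)]
      · rw [f2 v ⟨Quot.mk R v, fun p hp => hv ⟨p, hp⟩⟩ rfl,
          f2 w ⟨Quot.mk R v, fun p hp => hv ⟨p, hp⟩⟩ (Quot.sound h).symm]
    | arc p =>
      rw [f1 _ p rfl, f1 _ (c p) rfl]
      exact congrArg _ (Quot.sound (.arc p))
  refine ⟨⟨Quot.lift f hf, Sum.elim (Quot.lift (fun p => Quot.mk _ (bd p)) ?_)
    (fun κ => Quot.mk _ κ.pt), ?_, ?_⟩, fun p => f1 _ p rfl, fun κ => f2 _ κ κ.mk_pt⟩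
  · intro p q h
    cases h with
    | inner h =>
      have h1 := (hd p q).2 (SameCircle.of h)
      exact h1.map id fun x y h => SameCircle.of (.inner h)
    | arc p => exact Quot.sound (.arc p)
  · intro x
    induction x using Quot.ind with | _ v
    have inner : ∀ w w', SameCircle R w w' → Quot.mk (Closure R bd c) w = Quot.mk _ w' :=
      fun w w' h => h.map id fun x y h => SameCircle.of (.inner h)
    by_cases hv : ∃ p, Quot.mk R v = Quot.mk R (bd p)
    · obtain ⟨p, hp⟩ := hv
      change Sum.elim _ _ (f v) = _
      rw [f1 v p hp]
      exact inner _ _ hp.symm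
    · let κ : ClosedComp R bd := ⟨Quot.mk R v, fun p hp => hv ⟨p, hp⟩⟩
      change Sum.elim _ _ (f v) = _
      rw [f2 v κ rfl]
      exact inner _ _ κ.mk_pt
  · rintro (x | κ)
    · induction x using Quot.ind with | _ p
      exact f1 _ p rfl
    · exact f2 _ κ κ.mk_pt

theorem circles_closure [Finite V] [Finite P] (hd : Induces R bd d) (c : Matching P) :
    circles (Closure R bd c) =
      circles (Closure d.Graph id c) + Fintype.card (ClosedComp R bd) := by
  obtain ⟨e, -⟩ := exists_closureEquiv hd c
  rw [circles, Nat.card_congr e, Nat.card_sum, Nat.card_eq_fintype_card (α := ClosedComp R bd)]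
  rfl

/-- The closed components are tensor factors disjoint from the circles through the boundary. Each of
them must carry its dot, which forces `S` to be everything; what remains is the trace of the closure
of the induced matching. -/
theorem tracePoly_closed [Finite V] [Finite P] (hd : Induces R bd d) (c : Matching P)
    (g : MvPolynomial P ℤ) (S : Finset (ClosedComp R bd)) :
    tracePoly (Closure R bd c) (rename bd g * closedMonomial S) =
      if S = Finset.univ then tracePoly (Closure d.Graph id c) g else 0 := by
  classical
  obtain ⟨e, e1, e2⟩ := exists_closureEquiv hd c
  let E := Quot (Closure d.Graph id c) ⊕ ClosedComp R bd
  -- Transport along `e` puts the two factors into disjoint sets of variables, where the exponents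
  -- can be compared separately.
  have h1 : tracePoly (Closure R bd c) (rename bd g * closedMonomial S) =
      coeff (ones E) (rename Sum.inl (rename (Quot.mk (Closure d.Graph id c)) g) *
        monomial (∑ κ ∈ S, Finsupp.single (Sum.inr κ : E) 1) 1) := by
    have h2 : ones E = (ones (Quot (Closure R bd c))).mapDomain e := by
      ext q
      obtain ⟨q, rfl⟩ := e.surjective q
      rw [Finsupp.mapDomain_apply e.injective, ones_apply, ones_apply]
    rw [tracePoly_apply, h2, ← coeff_rename_mapDomain e e.injective, map_mul, map_mul,
      closedMonomial, map_prod, map_prod, rename_rename, rename_rename, rename_rename]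
    congr 2
    · congr 2
      exact funext fun p => e1 p
    · rw [monomial_sum_one]
      refine Finset.prod_congr rfl fun κ _ => ?_
      rw [rename_X, rename_X, e2]
      rfl
  rw [h1]
  clear h1
  induction g using MvPolynomial.induction_on' with
  | add g g' hg hg' =>
    rw [map_add, map_add, add_mul, coeff_add, hg, hg', map_add]
    split_ifs <;> simp
  | monomial m n =>
    rw [rename_monomial, rename_monomial, monomial_mul, mul_one, coeff_monomial,
      tracePoly_monomial, ← ite_and]
    congr 1
    rw [eq_iff_iff]
    set m' := m.mapDomain (Quot.mk (Closure d.Graph id c))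
    have hl : ∀ q, (m'.mapDomain (Sum.inl : _ → E) +
        ∑ κ ∈ S, Finsupp.single (Sum.inr κ : E) 1 : E →₀ ℕ)
        (.inl q) = m' q := by
      intro q
      rw [Finsupp.add_apply, Finsupp.mapDomain_apply Sum.inl_injective, Finsupp.finsetSum_apply,
        Finset.sum_eq_zero, add_zero]
      intro κ _
      exact Finsupp.single_eq_of_ne (by simp)
    have hr : ∀ κ, (m'.mapDomain (Sum.inl : _ → E) +
        ∑ κ ∈ S, Finsupp.single (Sum.inr κ : E) 1 : E →₀ ℕ)
        (.inr κ) = if κ ∈ S then 1 else 0 := by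
      intro κ
      rw [Finsupp.add_apply, Finsupp.mapDomain_of_notMem_range _ _ (by simp), zero_add,
        Finsupp.finsetSum_apply]
      have h : ∀ x, (Sum.inr x : E) = .inr κ ↔ x = κ := fun x => Sum.inr_injective.eq_iff
      simp only [Finsupp.single_apply, h, Finset.sum_ite_eq']
    constructor
    · intro h
      refine ⟨Finset.eq_univ_iff_forall.2 fun κ => ?_, fun q => ?_⟩
      · have := hr κ
        rw [h, ones_apply] at this
        by_contra h'
        rw [if_neg h'] at this
        exact one_ne_zero this
      · rw [← hl q, h, ones_apply]
    · rintro ⟨hS, hm⟩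
      ext q
      rcases q with q | κ
      · rw [hl, hm, ones_apply]
      · rw [hr, hS, if_pos (Finset.mem_univ _), ones_apply]

/-- The monomial of `S` and that of its complement are dual to each other: overlapping sets give a
square, and disjoint sets with a proper union leave a circle without a dot. The dual bases of the
bimodules have this form. -/
theorem tracePoly_closed_mul [Finite V] [Finite P] (hd : Induces R bd d) (c : Matching P)
    (g : MvPolynomial P ℤ) (S S' : Finset (ClosedComp R bd)) :
    tracePoly (Closure R bd c) (rename bd g * (closedMonomial S * closedMonomial S')) =
      if S' = Sᶜ then tracePoly (Closure d.Graph id c) g else 0 := by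
  by_cases h : Disjoint S S'
  · rw [closedMonomial_mul h, tracePoly_closed hd c]
    congr 1
    rw [eq_iff_iff]
    constructor
    · intro h'
      exact (IsCompl.of_eq (Finset.disjoint_iff_inter_eq_empty.1 h) h').compl_eq.symm
    · rintro rfl; exact Finset.union_compl S
  · rw [if_neg]
    · exact tracePoly_of_mem (Ideal.mul_mem_left _ _ (circleIdeal_le_closure c
        (closedMonomial_mul_mem h)))
    · rintro rfl; exact h disjoint_compl_right

end ClosedComponents

/-! ### Perfectness of the trace form. -/

section Nondegenerate

open MvPolynomial

/-- The matching of the empty set. -/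
def emptyMatching : Matching Empty := ⟨id, fun p => p.elim, fun p => p.elim, fun p => p.elim⟩

variable {V : Type} [Finite V] {R : V → V → Prop}

/-- A closed diagram is an open one without boundary points, all of whose circles are closed
components. The closed monomials are then a basis over ℤ, and polynomials in the boundary points are
constants. -/
theorem tracePoly_circle_mul (S S' : Finset (ClosedComp R Empty.elim)) (g : MvPolynomial Empty ℤ) :
    tracePoly R (rename Empty.elim g * (closedMonomial S * closedMonomial S')) =
      if S' = Sᶜ then coeff 0 g else 0 := by
  have hd : Induces R Empty.elim emptyMatching := fun p => p.elim
  have h : ∀ x y, SameCircle R x y ↔ SameCircle (Closure R Empty.elim emptyMatching) x y := by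
    refine fun x y => ⟨fun h => h.map id fun x y h => SameCircle.of (.inner h),
      fun h => h.map id ?_⟩
    rintro x y (h | ⟨⟨⟩⟩)
    exact SameCircle.of h
  rw [tracePoly_congr h, tracePoly_closed_mul hd, eq_C_of_isEmpty g, coeff_zero_C]
  congr 1
  rw [tracePoly_apply, rename_C]
  -- The empty diagram has no circles, so its trace is the constant coefficient.
  have : ones (Quot (Closure (emptyMatching).Graph id emptyMatching)) = 0 := by
    ext q
    induction q using Quot.ind with | _ q
    exact q.elim
  rw [this, coeff_zero_C]

/-- Expanded in closed monomials modulo the ideal, the coefficient at `S` is recovered by pairing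
with the monomial of the complement of `S`, so all coefficients vanish. -/
theorem mem_of_tracePoly {f : MvPolynomial V ℤ} (h : ∀ g, tracePoly R (g * f) = 0) :
    f ∈ circleIdeal R := by
  obtain ⟨G, hG⟩ := exists_closed_sum (R := R) (bd := (Empty.elim : Empty → V)) f
  have h0 : ∀ S, G S = 0 := by
    intro S
    have h1 := tracePoly_eq_of_sub_mem (R := R) (by
      have := Ideal.mul_mem_left _ (closedMonomial Sᶜ) hG
      rwa [mul_sub] at this)
    rw [h, Finset.mul_sum, map_sum, Finset.sum_eq_single S] at h1
    · have h2 := tracePoly_circle_mul S Sᶜ (G S)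
      rw [if_pos rfl] at h2
      rw [eq_C_of_isEmpty (G S), ← h2, ← map_zero C]
      congr 1
      rw [h1]
      congr 1
      ring
    · intro S' _ hS
      have h2 := tracePoly_circle_mul S' Sᶜ (G S')
      rw [if_neg fun h => hS (compl_injective h).symm] at h2
      rw [← h2]
      congr 1
      ring
    · simp
  simpa [h0] using hG

end Nondegenerate

/-- The trace of the Frobenius structure on the value of the TQFT on a closed diagram. -/
noncomputable def TQFT.trace {V : Type} [Finite V] (R : V → V → Prop) : TQFT R →+ ℤ :=
  QuotientAddGroup.lift (circleIdeal R).toAddSubgroup (tracePoly R).toAddMonoidHom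
    fun _ hf => tracePoly_of_mem hf

namespace TQFT

open MvPolynomial

variable {V : Type} [Finite V] {R : V → V → Prop}

theorem trace_mk (f : MvPolynomial V ℤ) :
    trace R (Ideal.Quotient.mk _ f) = tracePoly R f := rfl

theorem eq_zero_of_trace {x : TQFT R} (h : ∀ y, trace R (y * x) = 0) : x = 0 := by
  obtain ⟨f, rfl⟩ := Ideal.Quotient.mk_surjective x
  exact Ideal.Quotient.eq_zero_iff_mem.2 (mem_of_tracePoly fun g => h (Ideal.Quotient.mk _ g))

/-- The trace form is perfect. -/
theorem exists_trace_eq (l : TQFT R →+ ℤ) : ∃ z, ∀ x, l x = trace R (x * z) := by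
  classical
  let m : Finset (ClosedComp R (Empty.elim : Empty → V)) → TQFT R :=
    fun S => Ideal.Quotient.mk _ (closedMonomial S)
  -- The expansion of `l` in the basis dual to the `m S`, which is formed by the `m Sᶜ`.
  refine ⟨∑ S, l (m S) • m Sᶜ, fun x => ?_⟩
  obtain ⟨f, rfl⟩ := Ideal.Quotient.mk_surjective x
  refine closed_induction (R := R) (bd := (Empty.elim : Empty → V))
    (p := fun f => l (Ideal.Quotient.mk _ f) = trace R (Ideal.Quotient.mk _ f * _)) f ?_ ?_ ?_
  · intro f g hf hg
    rw [map_add, map_add, hf, hg, add_mul, map_add]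
  · intro f g h hf
    rwa [Ideal.Quotient.eq.2 h] at hf
  · intro g S
    have hg : (Ideal.Quotient.mk (circleIdeal R) (rename Empty.elim g * closedMonomial S)) =
        coeff 0 g • m S := by
      conv_lhs => rw [eq_C_of_isEmpty g]
      rw [rename_C, ← smul_eq_C_mul]
      exact map_zsmul _ _ _
    rw [hg, map_zsmul, smul_mul_assoc, map_zsmul]
    congr 1
    rw [Finset.mul_sum, map_sum, Finset.sum_eq_single S]
    · rw [mul_smul_comm, map_zsmul, ← map_mul, trace_mk]
      have := tracePoly_circle_mul S Sᶜ 1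
      rw [if_pos rfl, map_one, one_mul, coeff_zero_one] at this
      rw [this, smul_eq_mul, mul_one]
    · intro S' _ hS
      rw [mul_smul_comm, map_zsmul, ← map_mul, trace_mk]
      have := tracePoly_circle_mul S S'ᶜ 1
      rw [if_neg fun h => hS (compl_injective h), map_one, one_mul] at this
      rw [this, smul_zero]
    · simp

end TQFT

end ArcAlgebra

namespace ArcAlgebra

/-! ### Evaluation of genus zero saddle surfaces. -/

open MvPolynomial

theorem tracePoly_rename_of_inverse {V W : Type} [Finite V] [Finite W] {R : V → V → Prop}
    {S : W → W → Prop} (φ : V → W) (ψ : W → V)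
    (hφ : ∀ x y, R x y → SameCircle S (φ x) (φ y)) (hψ : ∀ x y, S x y → SameCircle R (ψ x) (ψ y))
    (h1 : ∀ x, SameCircle R (ψ (φ x)) x) (h2 : ∀ x, SameCircle S (φ (ψ x)) x)
    (f : MvPolynomial V ℤ) : tracePoly S (rename φ f) = tracePoly R f := by
  refine tracePoly_rename φ ⟨Quot.lift (fun x => Quot.mk S (φ x)) hφ,
    Quot.lift (fun x => Quot.mk R (ψ x)) hψ, ?_, ?_⟩ (fun v => rfl) f
  · intro x
    induction x using Quot.ind with | _ x
    exact h1 x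
  · intro x
    induction x using Quot.ind with | _ x
    exact h2 x

namespace SurgerySystem

variable {V K : Type} (σ : SurgerySystem V K)

/-- The edges of the initial diagram together with the surgered arcs of `L`: its components are
those of the surface swept out by the surgeries. -/
def Trace (L : List K) (x y : V) : Prop :=
  σ.Rel [] x y ∨ ∃ k, Surg σ.β L k ∧ x = σ.pt k false ∧ y = σ.pt k true

theorem not_surg_nil (k : K) : ¬ Surg σ.β [] k := by simp [Surg]

/-- The circles after the surgeries are boundary circles of the swept surface, so points on one of
them lie on one component. -/
theorem trace_of_rel (L : List K) {x y : V} (h : SameCircle (σ.Rel L) x y) :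
    SameCircle (σ.Trace L) x y := by
  refine h.map id fun x y h => ?_
  cases h with
  | o x => exact SameCircle.of (Or.inl (.o x))
  | e x h => exact SameCircle.of (Or.inl (.e x h))
  | arc k l h => exact SameCircle.of (Or.inl (.arc k l (σ.not_surg_nil k)))
  | vert k h => exact SameCircle.of (Or.inr ⟨k, h, rfl, rfl⟩)

theorem trace_cons (L : List K) (k : K) {x y : V} (h : SameCircle (σ.Trace L) x y) :
    SameCircle (σ.Trace (k :: L)) x y := by
  refine h.map id ?_
  rintro x y (h | ⟨j, hj, rfl, rfl⟩)
  · exact SameCircle.of (Or.inl h)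
  · exact SameCircle.of (Or.inr ⟨j, hj.imp (List.mem_cons_of_mem _) (List.mem_cons_of_mem _),
      rfl, rfl⟩)

theorem trace_arc (L : List K) (k : K) (l : Bool) :
    SameCircle (σ.Trace L) (σ.pt k l) (σ.pt (σ.β k) l) :=
  SameCircle.of (Or.inl (.arc k l (σ.not_surg_nil k)))

/-- One more saddle joins at most two components. The surgery adds vertical edges at both ends of
the arc, but the two strands of the arc are still present in the trace, so the second edge connects
nothing new. -/
theorem trace_join (L : List K) (k : K) {x y : V} (h : SameCircle (σ.Trace (k :: L)) x y) :
    Join (SameCircle (σ.Trace L)) (σ.pt k false) (σ.pt k true) x y := by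
  refine SameCircle.join ?_ h
  rintro x y (h | ⟨j, hj, rfl, rfl⟩)
  · exact Or.inl (SameCircle.of (Or.inl h))
  · by_cases hL : Surg σ.β L j
    · exact Or.inl (SameCircle.of (Or.inr ⟨j, hL, rfl, rfl⟩))
    · have : j = k ∨ σ.β j = k := by
        simp only [Surg, List.mem_cons] at hj hL
        tauto
      rcases this with rfl | rfl
      · exact Or.inr (Or.inl ⟨rfl, rfl⟩)
      · exact Or.inr (Or.inl ⟨σ.trace_arc L j false, (σ.trace_arc L j true).symm⟩)

theorem circles_congr {V : Type} {R R' : V → V → Prop}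
    (h : ∀ x y, SameCircle R x y ↔ SameCircle R' x y) : circles R = circles R' :=
  card_quot_eq id id (fun x y hxy => (h x y).1 (SameCircle.of hxy))
    (fun x y hxy => (h x y).2 (SameCircle.of hxy)) (fun _ => rfl) (fun _ => rfl)

/-- If the surface swept out by the surgeries has genus zero, then a dotted version of it is
evaluated by the trace of its set of components. -/
theorem tracePoly_prod [Fintype V] (L : List K) (hL : σ.Valid L) :
    circles (σ.Rel []) + circles (σ.Rel L) ≤ 2 * circles (σ.Trace L) + L.length ∧
    (circles (σ.Rel []) + circles (σ.Rel L) = 2 * circles (σ.Trace L) + L.length →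
      ∀ f, tracePoly (σ.Rel L) (σ.prod L * f) = tracePoly (σ.Trace L) f) := by
  -- The count is Euler characteristic: saddles contribute -1 each, and a component of genus g with
  -- r boundary circles contributes 2 - 2g - r. The inequality says that the genus is nonnegative,
  -- and equality that it vanishes.
  induction L with
  | nil =>
    have h : ∀ x y, SameCircle (σ.Rel []) x y ↔ SameCircle (σ.Trace []) x y := by
      refine fun x y => ⟨σ.trace_of_rel [], fun h => h.map id ?_⟩
      rintro x y (h | ⟨k, hk, -⟩)
      · exact SameCircle.of h
      · exact absurd hk (σ.not_surg_nil k)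
    rw [circles_congr h]
    refine ⟨by simp; omega, fun _ f => ?_⟩
    rw [prod, one_mul, tracePoly_congr h]
  | cons k L ih =>
    have h0 := List.pairwise_cons.1 hL
    have hk : ¬ Surg σ.β L k := by
      rintro (h' | h')
      · exact (h0.1 _ h').1 rfl
      · exact (h0.1 _ h').2 (σ.ββ k).symm
    obtain ⟨ih1, ih2⟩ := ih h0.2
    have hv : Surg σ.β (k :: L) k := Or.inl (List.mem_cons_self ..)
    rw [List.length_cons]
    rcases σ.saddle L k hk with ⟨h1, h2, h3⟩ | ⟨h1, h2, h3⟩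
    · have hc : circles (σ.Rel L) = circles (σ.Rel (k :: L)) + 1 :=
        card_quot_join h3 (SameCircle.of (.vert k hv)) h2 (fun x y h => σ.SameCircle_ge L k hk h)
      -- Merging two circles of the same component adds a handle; the inequality becomes strict and
      -- there is nothing to evaluate. Otherwise two components merge.
      by_cases hs : SameCircle (σ.Trace L) (σ.pt k false) (σ.pt k true)
      · have hE : ∀ x y, SameCircle (σ.Trace (k :: L)) x y ↔ SameCircle (σ.Trace L) x y := by
          refine fun x y => ⟨fun h => ?_, σ.trace_cons L k⟩
          rcases σ.trace_join L k h with h | ⟨h, h'⟩ | ⟨h, h'⟩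
          · exact h
          · exact h.trans (hs.trans h')
          · exact h.trans (hs.symm.trans h')
        rw [circles_congr hE]
        exact ⟨by omega, fun h => by omega⟩
      · have hv' : SameCircle (σ.Trace (k :: L)) (σ.pt k false) (σ.pt k true) :=
          SameCircle.of (Or.inr ⟨k, hv, rfl, rfl⟩)
        have hE : circles (σ.Trace L) = circles (σ.Trace (k :: L)) + 1 :=
          card_quot_join (fun x y => σ.trace_cons L k) hv' hs (fun x y => σ.trace_join L k)
        refine ⟨by omega, fun h f => ?_⟩
        -- The merger of circles turns into the factor `X a + X b` for the earlier diagram; by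
        -- induction this is evaluated on the components, where the same factor turns back into the
        -- merger of two components.
        rw [prod, saddleFactor, if_pos h1, one_mul, tracePoly_merge h3
          (SameCircle.of (.vert k hv)) h2 (fun x y h => σ.SameCircle_ge L k hk h),
          mul_left_comm, ih2 (by omega), ← tracePoly_merge (fun x y => σ.trace_cons L k) hv' hs
          (fun x y => σ.trace_join L k)]
    · have hc : circles (σ.Rel (k :: L)) = circles (σ.Rel L) + 1 :=
        card_quot_join h3 (SameCircle.of (.arc k false hk)) h1
          (fun x y h => σ.SameCircle_le L k h)
      have hs := σ.trace_of_rel L h2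
      have hE : ∀ x y, SameCircle (σ.Trace (k :: L)) x y ↔ SameCircle (σ.Trace L) x y := by
        refine fun x y => ⟨fun h => ?_, σ.trace_cons L k⟩
        rcases σ.trace_join L k h with h | ⟨h, h'⟩ | ⟨h, h'⟩
        · exact h
        · exact h.trans (hs.trans h')
        · exact h.trans (hs.symm.trans h')
      rw [circles_congr hE]
      refine ⟨by omega, fun h f => ?_⟩
      -- A split already carries the factor `X a + X b`, which undoes it under the trace; the
      -- components do not change.
      rw [prod, saddleFactor, if_neg h1, mul_assoc, ← tracePoly_merge h3
        (SameCircle.of (.arc k false hk)) h1 (fun x y h => σ.SameCircle_le L k h),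
        ih2 (by omega), tracePoly_congr hE]

end SurgerySystem

/-! ### Self-adjointness of the contraction maps. -/

section SelfDuality

variable {P V : Type} [LinearOrder P] [Fintype P]

/-- Each circle of W(c)c is an arc doubled, and is represented by the left end of that arc. -/
theorem circles_self (c : Matching P) : circles (Closure c.Graph id c) = Fintype.card P / 2 := by
  classical
  have h : Nat.card {p : P // p < c p} = circles (Closure c.Graph id c) := by
    refine Nat.card_congr ⟨fun p => Quot.mk _ p.1, Quot.lift (fun p =>
      if h : p < c p then ⟨p, h⟩ else ⟨c p, by
        rw [c.invol]; exact lt_of_le_of_ne (not_lt.1 h) (c.ne p)⟩) ?_, ?_, ?_⟩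
    · have key : ∀ p q, q = c p → (if h : p < c p then ⟨p, h⟩ else ⟨c p, by
          rw [c.invol]; exact lt_of_le_of_ne (not_lt.1 h) (c.ne p)⟩ : {p : P // p < c p}) =
          if h : q < c q then ⟨q, h⟩ else ⟨c q, by
          rw [c.invol]; exact lt_of_le_of_ne (not_lt.1 h) (c.ne q)⟩ := by
        rintro p _ rfl
        apply Subtype.ext
        rcases lt_or_gt_of_ne (c.ne p) with h | h
        · rw [dif_neg h.not_gt, dif_pos (by rwa [c.invol])]
        · rw [dif_pos h, dif_neg (by rw [c.invol]; exact h.not_gt)]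
          exact (c.invol p).symm
      intro p q hpq
      cases hpq with
      | inner h => exact key p q h
      | arc p => exact key p _ rfl
    · rintro ⟨p, hp⟩
      exact dif_pos hp
    · intro x
      induction x using Quot.ind with | _ p
      change Quot.mk _ (Subtype.val (if h : p < c p then (⟨p, h⟩ : {p : P // p < c p}) else
        ⟨c p, _⟩)) = Quot.mk _ p
      split_ifs
      · rfl
      · exact (Quot.sound (.arc p)).symm
  have h1 : c.arcs.length = (Finset.univ.filter (fun p => p < c p)).card := Finset.length_sort _
  rw [← h, Nat.card_eq_fintype_card, Fintype.card_subtype, ← h1, ← c.length_arcs]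
  omega

/-- The factor by which the product differs from a contraction. -/
noncomputable def saddlePoly (R : V → V → Prop) (bd : P → V) (c b : Matching P) :
    MvPolynomial V ℤ :=
  rename (collapse bd) (saddles R bd c b b.arcs)

theorem contractPoly_eq_mul (R : V → V → Prop) (bd : P → V) (c b : Matching P)
    (f : MvPolynomial P ℤ) (g : MvPolynomial V ℤ) :
    contractPoly R bd c b f g = rename bd f * g * saddlePoly R bd c b :=
  contractPoly_eq R bd c b f g

theorem Regular.saddles_eq_prod {R : V → V → Prop} {bd : P → V} (ρ : Regular R bd)
    (c b : Matching P) (L : List P) : saddles R bd c b L = (ρ.system c b).prod L := by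
  induction L with
  | nil => rfl
  | cons p L ih =>
    rw [saddles, SurgerySystem.prod, ih]
    have := Regular.rename_saddleFactor id id (ρ.system_rel c b (p :: L)
      (x := Sum.inl p) (y := Sum.inl (b p))).symm rfl rfl
    simp only [rename_id, AlgHom.coe_id, id_eq] at this
    rw [this]
    rfl

/-- The trace of a product in the arc ring. -/
theorem tracePoly_contract_self (c b : Matching P) (f : MvPolynomial P ℤ) :
    tracePoly (Closure c.Graph id c) (f * saddlePoly c.Graph id c b) =
      tracePoly (Closure b.Graph id c) f := by
  -- The saddles of the product F(W(c)b) ⊗ F(W(b)c) → F(W(c)c). The maps `hφ`, `hψ` and `hinv`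
  -- identify the components of the swept surface with the circles of W(c)b.
  let σ := c.regular.system c b
  have hn : ∀ x, Surg b b.arcs x := b.surg_arcs
  have hrel : ∀ x y, SameCircle (σ.Rel b.arcs) x y ↔
      SameCircle (Contracting c.Graph id c b b.arcs) x y := fun x y => c.regular.system_rel c b _
  have hφ : ∀ x y, Closure b.Graph id c x y → SameCircle (σ.Trace b.arcs) (.inl x) (.inl y) := by
    intro x y h
    cases h with
    | inner h => cases h; exact σ.trace_arc b.arcs x false
    | arc p => exact SameCircle.of (Or.inl (.o (Sum.inl p)))
  have hψ : ∀ x y, σ.Trace b.arcs x y →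
      SameCircle (Closure b.Graph id c) (collapse id x) (collapse id y) := by
    rintro x y (h | ⟨k, -, rfl, rfl⟩)
    · have := (c.regular.system_rel c b []).1 (SameCircle.of h)
      refine this.map (collapse id) ?_
      intro x y h
      cases h with
      | upper p => exact SameCircle.of (.arc p)
      | lower h => cases h; exact SameCircle.of (.arc _)
      | arcUpper p h => exact SameCircle.of (.inner rfl)
      | arcLower p h => exact SameCircle.of (.inner rfl)
      | vertical p h => rfl
    · rfl
  have hinv : ∀ x, SameCircle (σ.Trace b.arcs) (.inl (collapse id x)) x := by
    rintro (x | x)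
    · rfl
    · exact SameCircle.of (Or.inr ⟨x, hn x, rfl, rfl⟩)
  -- The circle counts `c0`, `c1` and `cE` give equality in `SurgerySystem.tracePoly_prod`: with N
  -- circles in W(c)b and m arcs, 2N + m = 2N + m. Hence the genus is zero.
  have c0 : circles (σ.Rel []) = 2 * circles (Closure b.Graph id c) := by
    have h1 : circles (σ.Rel []) = circles (Contracting c.Graph id c b []) :=
      SurgerySystem.circles_congr fun x y => c.regular.system_rel c b []
    have h2 := card_contracting_nil (R := c.Graph) (bd := id) c b
    have h3 : circles (Closure c.Graph id b) = circles (Closure b.Graph id c) := by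
      rw [closure_graph_symm b c]
    unfold circles at h1 h3 ⊢
    omega
  have c1 : circles (σ.Rel b.arcs) = b.arcs.length := by
    have h1 := SurgerySystem.circles_congr hrel
    have h2 := card_contracting_arcs (R := c.Graph) (bd := id) c b
    have h3 := circles_self c
    have h4 := b.length_arcs
    unfold circles at h1 h3 ⊢
    omega
  have cE : circles (σ.Trace b.arcs) = circles (Closure b.Graph id c) :=
    card_quot_eq (collapse id) Sum.inl hψ hφ hinv (fun _ => rfl)
  have key := (σ.tracePoly_prod b.arcs b.valid_arcs).2 (by omega) (rename Sum.inl f)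
  rw [tracePoly_rename_of_inverse Sum.inl (collapse id) hφ hψ (fun _ => rfl) hinv,
    tracePoly_congr hrel, ← Regular.saddles_eq_prod] at key
  have e : f * saddlePoly c.Graph id c b =
      rename (collapse id) (saddles c.Graph id c b b.arcs * rename Sum.inl f) := by
    rw [map_mul, rename_rename, mul_comm]
    congr 1
    exact (rename_id_apply f).symm
  -- It remains to identify the fully surgered diagram with W(c)c by collapsing the vertical
  -- segments.
  rw [← key, e, tracePoly_rename_of_inverse (collapse id) Sum.inr ?_ ?_ ?_ (fun _ => rfl)]
  · intro x y h
    cases h with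
    | upper p => exact SameCircle.of (.arc p)
    | lower h => exact SameCircle.of (.inner h)
    | arcUpper p h => exact absurd (hn p) h
    | arcLower p h => exact absurd (hn p) h
    | vertical p h => rfl
  · intro x y h
    cases h with
    | inner h => exact SameCircle.of (.lower h)
    | arc p =>
      exact (SameCircle.of (.vertical p (hn p))).symm.trans ((SameCircle.of (.upper p)).trans
        (SameCircle.of (.vertical _ (hn _))))
  · rintro (x | x)
    · exact (SameCircle.of (.vertical x (hn x))).symm
    · rfl

/-- The symmetry of the product under reflection, applied to the units. -/
theorem saddlePoly_symm (a e d : Matching P) :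
    saddlePoly a.Graph id e d = saddlePoly e.Graph id a d := by
  have := contractPoly_symm a d e 1 1
  simpa [contractPoly_eq_mul] using this

/-- Cyclic symmetry of a triple product. Both bracketings of an element of F(W(c)d) with units of
F(W(d)b) and F(W(b)c) have the same trace in F(W(c)c), and `tracePoly_contract_self` evaluates one
on W(c)b and the other on W(c)d. -/
theorem tracePoly_saddle_rotate (b c d : Matching P) (f : MvPolynomial P ℤ) :
    tracePoly (Closure b.Graph id c) (f * saddlePoly b.Graph id c d) =
      tracePoly (Closure d.Graph id c) (f * saddlePoly d.Graph id c b) := by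
  have h := tracePoly_eq_of_sub_mem (c.regular.contractPoly_assoc c d b f 1 1)
  simp only [contractPoly_eq_mul, map_one, mul_one, map_mul, rename_id_apply, one_mul] at h
  rw [tracePoly_contract_self, mul_assoc, mul_comm (saddlePoly _ _ _ _), ← mul_assoc,
    mul_assoc f] at h
  rw [h, saddlePoly_symm d c b]
  have := tracePoly_contract_self c d (f * saddlePoly c.Graph id d b)
  rw [← this]
  congr 1
  ring

/-- The rotation conjugated by reflections. This is the adjointness of contractions when the open
diagram is itself a matching. -/
theorem tracePoly_saddle_swap (d c b : Matching P) (f : MvPolynomial P ℤ) :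
    tracePoly (Closure d.Graph id c) (f * saddlePoly d.Graph id c b) =
      tracePoly (Closure d.Graph id b) (f * saddlePoly d.Graph id b c) := by
  rw [closure_graph_symm, saddlePoly_symm, tracePoly_saddle_rotate, closure_graph_symm,
    saddlePoly_symm]

/-- The saddles of a contraction only depend on how the boundary points are connected. -/
theorem contracting_iff {W : Type} {R : V → V → Prop} {bd : P → V} {S : W → W → Prop} {bd' : P → W}
    (h : ∀ p q, SameCircle R (bd p) (bd q) ↔ SameCircle S (bd' p) (bd' q)) (c b : Matching P)
    (L : List P) (p q : P) : SameCircle (Contracting R bd c b L) (.inl p) (.inl q) ↔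
      SameCircle (Contracting S bd' c b L) (.inl p) (.inl q) := by
  classical
  have key : ∀ {V W : Type} {R : V → V → Prop} {bd : P → V} {S : W → W → Prop} {bd' : P → W},
      (∀ p q, SameCircle R (bd p) (bd q) → SameCircle S (bd' p) (bd' q)) →
      SameCircle (Contracting R bd c b L) (.inl p) (.inl q) →
      SameCircle (Contracting S bd' c b L) (.inl p) (.inl q) := by
    intro V W R bd S bd' h hpq
    have low : ∀ p q, SameCircle R (bd p) (bd q) →
        SameCircle (Contracting S bd' c b L) (.inr (bd' p)) (.inr (bd' q)) :=
      fun p q hpq => (h p q hpq).map Sum.inr fun x y h => SameCircle.of (.lower h)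
    -- A vertex of the lower diagram goes to the circle of any boundary point on its component.
    -- Closed components of the two diagrams need not correspond, and all of them go to `none`.
    let g : V → Option (Quot (Contracting S bd' c b L)) := fun v =>
      if h : ∃ p, SameCircle R v (bd p) then some (Quot.mk _ (.inr (bd' h.choose))) else none
    have g1 : ∀ v p, SameCircle R v (bd p) → g v = some (Quot.mk _ (.inr (bd' p))) := by
      intro v p hp
      have h : ∃ p, SameCircle R v (bd p) := ⟨p, hp⟩
      simp only [g]
      rw [dif_pos h]
      exact congrArg some (low _ _ (h.choose_spec.symm.trans hp))
    have g2 : ∀ v w, R v w → g v = g w := by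
      intro v w hvw
      by_cases hv : ∃ p, SameCircle R v (bd p)
      · obtain ⟨p, hp⟩ := hv
        rw [g1 v p hp, g1 w p ((SameCircle.of hvw).symm.trans hp)]
      · have hw : ¬ ∃ p, SameCircle R w (bd p) := fun ⟨p, hp⟩ =>
          hv ⟨p, (SameCircle.of hvw).trans hp⟩
        simp only [g]
        rw [dif_neg hv, dif_neg hw]
    have := SameCircle.lift (Sum.elim (fun p => some (Quot.mk (Contracting S bd' c b L) (.inl p))) g)
      (fun x y hxy => by
        cases hxy with
        | upper p => exact congrArg some (Quot.sound (.upper p))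
        | lower h => exact g2 _ _ h
        | arcUpper p h => exact congrArg some (Quot.sound (.arcUpper p h))
        | arcLower p h =>
          exact (g1 _ p rfl).trans ((congrArg some (Quot.sound (.arcLower p h))).trans
            (g1 _ (b p) rfl).symm)
        | vertical p h =>
          exact (congrArg some (Quot.sound (.vertical p h))).trans (g1 _ p rfl).symm) hpq
    exact Option.some_injective _ this
  exact ⟨key fun p q => (h p q).1, key fun p q => (h p q).2⟩

/-- This is applied twice: to replace an open diagram by the matching that it induces, and to
compare a tangle with its mirror image. -/
theorem rename_saddlePoly {W U : Type} {R : V → V → Prop} {bd : P → V} {S : W → W → Prop}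
    {bd' : P → W} (h : ∀ p q, SameCircle R (bd p) (bd q) ↔ SameCircle S (bd' p) (bd' q))
    (c b : Matching P) (φ : V → U) (ψ : W → U) (hφ : ∀ p, φ (bd p) = ψ (bd' p)) :
    rename φ (saddlePoly R bd c b) = rename ψ (saddlePoly S bd' c b) := by
  unfold saddlePoly
  rw [rename_rename, rename_rename]
  induction b.arcs with
  | nil => simp [saddles]
  | cons p L ih =>
    rw [saddles, saddles, map_mul, map_mul, ih]
    congr 1
    exact Regular.rename_saddleFactor _ _ (contracting_iff h c b _ _ _) (hφ _) (hφ _)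

theorem saddlePoly_of_induces {R : V → V → Prop} {bd : P → V} {d : Matching P}
    (hd : Induces R bd d) (c b : Matching P) :
    saddlePoly R bd c b = rename bd (saddlePoly d.Graph id c b) := by
  have := rename_saddlePoly hd c b id bd (fun _ => rfl)
  rwa [rename_id_apply] at this

/-- Contraction along the induced matching is right multiplication by the idempotent of `d`, hence
free of any factor. It makes the generators of the bimodule behave like a free basis over the
summands of the arc ring. -/
theorem saddlePoly_self {R : V → V → Prop} {bd : P → V} {d : Matching P} (hd : Induces R bd d)
    (c : Matching P) : saddlePoly R bd c d = 1 := by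
  have := contractPoly_one_right c d 1
  rw [contractPoly_eq_mul, map_one, one_mul, one_mul] at this
  rw [saddlePoly_of_induces hd, this, map_one]

/-- Contraction with an element of the arc ring is adjoint to contraction with its reflection. -/
theorem tracePoly_saddlePoly [Finite V] {R : V → V → Prop} {bd : P → V} {d : Matching P}
    (hd : Induces R bd d) (c b : Matching P) (f : MvPolynomial V ℤ) :
    tracePoly (Closure R bd c) (f * saddlePoly R bd c b) =
      tracePoly (Closure R bd b) (f * saddlePoly R bd b c) := by
  rw [saddlePoly_of_induces hd, saddlePoly_of_induces hd]
  -- The saddle polynomials only involve boundary variables, so the closed components split off as a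
  -- common factor and the claim reduces to the one for the induced matching `d`.
  refine closed_induction (R := R) (bd := bd) (p := fun f => tracePoly (Closure R bd c)
    (f * _) = tracePoly (Closure R bd b) (f * _)) f ?_ ?_ ?_
  · intro f g hf hg
    rw [add_mul, add_mul, map_add, map_add, hf, hg]
  · intro f g h hf
    rw [← tracePoly_eq_of_sub_mem (f := f * _), hf, tracePoly_eq_of_sub_mem]
    all_goals
      rw [← sub_mul]
      exact Ideal.mul_mem_right _ _ (circleIdeal_le_closure _ h)
  · intro g S
    simp only [mul_right_comm _ (closedMonomial S), ← map_mul (rename bd), tracePoly_closed hd,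
      tracePoly_saddle_swap d c b]

end SelfDuality

end ArcAlgebra

namespace ArcAlgebra

/-! ### Closing one end of a flat tangle. -/

section InducedMatching

/-- Two unions of arcs of a crossingless matching are unlinked. -/
theorem Matching.sum_lt_eq_zero {L : Type} [LinearOrder L] [Fintype L] (M : Matching L)
    {C D : Finset L} (hCD : Disjoint C D) (hC : ∀ x ∈ C, M x ∈ C) (hD : ∀ x ∈ D, M x ∈ D) :
    ∑ x ∈ C, ∑ z ∈ D, (if x < z then 1 else 0 : ZMod 2) = 0 := by
  rw [Finset.sum_comm]
  -- Points of `C` to the left of an arc of `D` count twice, hence not at all modulo 2; those under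
  -- the arc are matched with each other by `M`, since no arc crosses.
  have key : ∀ z ∈ D, z < M z → ∑ x ∈ C, (if x < z then 1 else 0 : ZMod 2) +
      ∑ x ∈ C, (if x < M z then 1 else 0 : ZMod 2) = 0 := by
    intro z hz hlt
    rw [← Finset.sum_add_distrib]
    have h1 : ∀ x ∈ C, ((if x < z then 1 else 0) + (if x < M z then 1 else 0) : ZMod 2) =
        if z < x ∧ x < M z then 1 else 0 := by
      intro x hx
      have hne : x ≠ z := fun h => Finset.disjoint_left.1 hCD hx (h ▸ hz)
      rcases lt_or_gt_of_ne hne with h | h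
      · rw [if_pos h, if_pos (h.trans hlt), if_neg fun h' => lt_asymm h h'.1]
        rfl
      · rw [if_neg h.not_gt, zero_add]
        simp only [h, true_and]
    rw [Finset.sum_congr rfl h1, ← Finset.sum_filter]
    refine Finset.sum_involution (fun x _ => M x) (fun _ _ => by decide) (fun x _ _ => M.ne x)
      (fun x hx => ?_) (fun x _ => M.invol x)
    rw [Finset.mem_filter] at hx ⊢
    exact ⟨hC x hx.1, M.between hx.2.1 hx.2.2⟩
  refine Finset.sum_involution (fun z _ => M z) (fun z hz => ?_) (fun z _ _ => M.ne z)
    (fun z hz => hD z hz) (fun z _ => M.invol z)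
  rcases lt_or_gt_of_ne (M.ne z) with h | h
  · have := key (M z) (hD z hz) (by rwa [M.invol])
    rwa [M.invol, add_comm] at this
  · exact key z hz h

variable {P Q : Type} [LinearOrder P] [LinearOrder Q] [Fintype P] [Fintype Q]

/-- The diagram obtained from a flat tangle by closing its bottom consists of a crossingless
matching of the top points and of circles. -/
theorem FlatTangle.exists_induces (T : FlatTangle P Q) (a : Matching P) :
    ∃ d : Matching Q, Induces (Closure T.Graph botPt a) topPt d := by
  classical
  have : Fintype (P ⊕ₗ Qᵒᵈ) := Fintype.ofFinite _
  let R := Closure T.Graph botPt a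
  let ρ : Regular R (topPt : Q → P ⊕ₗ Qᵒᵈ) := T.regularTop a
  have e_bot : ∀ p, ρ.e (botPt p) = botPt (a p) := fun _ => rfl
  have e_top : ∀ q, ρ.e (topPt q) = topPt q := fun _ => rfl
  -- The involution `ρ.e` is the arcs of `a` on the bottom points and fixes the top points, which
  -- are therefore the ends of the components. At most two ends (`ends`) and at least a second one
  -- (`other`) give the involution `f`.
  have hr : ∀ x y, SameCircle (fun x y => y = ρ.o x ∨ y = ρ.e x) x y ↔ SameCircle R x y := by
    refine fun x y => ⟨fun h => h.map id ?_, fun h => h.map id ?_⟩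
    · rintro x y (rfl | rfl)
      · exact SameCircle.of (ρ.rel_o x)
      · obtain ⟨p, rfl⟩ | ⟨q, rfl⟩ := botPt_or_topPt x
        · exact SameCircle.of (.arc p)
        · rfl
    · intro x y h
      rcases ρ.rel x y h with h | h
      · exact SameCircle.of (Or.inl h)
      · exact SameCircle.of (Or.inr h.2)
  have hee : ∀ x, ρ.e (ρ.e x) = x := by
    intro x
    obtain ⟨p, rfl⟩ | ⟨q, rfl⟩ := botPt_or_topPt x
    · rw [e_bot, e_bot, a.invol]
    · rw [e_top, e_top]
  have hec : ∀ x, ρ.e x ≠ x → ρ.col (ρ.e x) ≠ ρ.col x := by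
    intro x hx
    obtain ⟨p, rfl⟩ | ⟨q, rfl⟩ := botPt_or_topPt x
    · exact colour_bot_ne a p
    · exact absurd (e_top q) hx
  have ends : ∀ q r s : Q, SameCircle R (topPt q) (topPt r) → SameCircle R (topPt q) (topPt s) →
      q = r ∨ q = s ∨ r = s := by
    intro q r s h1 h2
    exact (ends_le_two ρ.o ρ.e ρ.oo hee (e_top q) (e_top r) (e_top s) ((hr _ _).2 h1)
      ((hr _ _).2 h2)).imp (fun h => topPt_injective h) (Or.imp (fun h => topPt_injective h)
      (fun h => topPt_injective h))
  have other : ∀ q : Q, ∃ r, r ≠ q ∧ SameCircle R (topPt q) (topPt r) := by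
    intro q
    obtain ⟨b, hb, hc, h⟩ := exists_other_end ρ.o ρ.e ρ.col ρ.oo hee ρ.co hec (e_top q)
    obtain ⟨p, rfl⟩ | ⟨r, rfl⟩ := botPt_or_topPt b
    · exact absurd (botPt_injective hb) (a.ne p)
    · exact ⟨r, fun e => hc (by rw [e]), (hr _ _).1 h⟩
  choose f hne hf using other
  have hff : ∀ q, f (f q) = q := by
    intro q
    rcases ends q (f q) (f (f q)) (hf q) ((hf q).trans (hf _)) with h | h | h
    · exact absurd h.symm (hne q)
    · exact h.symm
    · exact absurd h.symm (hne (f q))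
  have huniq : ∀ q r, SameCircle R (topPt q) (topPt r) → r = q ∨ r = f q := by
    intro q r h
    rcases ends q (f q) r (hf q) h with h | h | h
    · exact absurd h.symm (hne q)
    · exact Or.inl h.symm
    · exact Or.inr h.symm
  -- A combinatorial substitute for the Jordan curve theorem. The components of `q` and of `r` are
  -- unions of arcs of `T`, and their bottom points are unions of arcs of `a`; both crossing numbers
  -- vanish modulo 2, and the difference is the crossing number of the top ends.
  have cross : ∀ q r, q < r → r < f q → ¬ f q < f r := by
    intro q r h1 h2 h3
    let D : Q → Finset P := fun q => Finset.univ.filter fun p => SameCircle R (topPt q) (botPt p)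
    let C : Q → Finset (P ⊕ₗ Qᵒᵈ) := fun q => Finset.univ.filter fun x => SameCircle R (topPt q) x
    have hdisj : ∀ x, SameCircle R (topPt q) x → ¬ SameCircle R (topPt r) x := by
      intro x hx hx'
      rcases huniq q r (hx.trans hx'.symm) with rfl | rfl
      · exact lt_irrefl _ h1
      · exact lt_irrefl _ h2
    have hsum : ∀ q (F : P ⊕ₗ Qᵒᵈ → ZMod 2), ∑ x ∈ C q, F x =
        ∑ p ∈ D q, F (botPt p) + (F (topPt q) + F (topPt (f q))) := by
      intro q F
      have hC : C q = (D q).map ⟨botPt, botPt_injective⟩ ∪ {topPt q, topPt (f q)} := by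
        ext x
        simp only [C, D, Finset.mem_filter, Finset.mem_univ, true_and, Finset.mem_union,
          Finset.mem_map, Function.Embedding.coeFn_mk, Finset.mem_insert, Finset.mem_singleton]
        constructor
        · intro h
          obtain ⟨p, rfl⟩ | ⟨s, rfl⟩ := botPt_or_topPt x
          · exact Or.inl ⟨p, h, rfl⟩
          · exact Or.inr ((huniq q s h).imp (congrArg _) (congrArg _))
        · rintro (⟨p, h, rfl⟩ | rfl | rfl)
          · exact h
          · rfl
          · exact hf q
      rw [hC, Finset.sum_union, Finset.sum_map, Finset.sum_pair]
      · rfl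
      · exact fun h => hne q (topPt_injective h).symm
      · rw [Finset.disjoint_left]
        intro x hx hx'
        simp only [Finset.mem_map, Function.Embedding.coeFn_mk, Finset.mem_insert,
          Finset.mem_singleton] at hx hx'
        obtain ⟨p, -, rfl⟩ := hx
        rcases hx' with h | h <;> exact botPt_ne_topPt _ _ h
    have s1 : ∑ x ∈ C q, ∑ z ∈ C r, (if x < z then 1 else 0 : ZMod 2) = 0 := by
      refine Matching.sum_lt_eq_zero T ?_ ?_ ?_
      · rw [Finset.disjoint_left]
        intro x hx hx'
        simp only [C, Finset.mem_filter, Finset.mem_univ, true_and] at hx hx'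
        exact hdisj x hx hx'
      all_goals
        intro x hx
        simp only [C, Finset.mem_filter, Finset.mem_univ, true_and] at hx ⊢
        exact hx.trans (SameCircle.of (.inner rfl))
    have s2 : ∑ x ∈ D q, ∑ z ∈ D r, (if x < z then 1 else 0 : ZMod 2) = 0 := by
      refine a.sum_lt_eq_zero ?_ ?_ ?_
      · rw [Finset.disjoint_left]
        intro x hx hx'
        simp only [D, Finset.mem_filter, Finset.mem_univ, true_and] at hx hx'
        exact hdisj _ hx hx'
      all_goals
        intro x hx
        simp only [D, Finset.mem_filter, Finset.mem_univ, true_and] at hx ⊢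
        exact hx.trans (SameCircle.of (.arc x))
    have bb : ∀ p p' : P, (botPt p : P ⊕ₗ Qᵒᵈ) < botPt p' ↔ p < p' := fun p p' => by simp [botPt]
    have bt : ∀ (p : P) (q : Q), (botPt p : P ⊕ₗ Qᵒᵈ) < topPt q := fun p q => by
      simp [botPt, topPt]
    have tb : ∀ (p : P) (q : Q), ¬ (topPt q : P ⊕ₗ Qᵒᵈ) < botPt p := fun p q => (bt p q).not_gt
    have tt : ∀ q q' : Q, (topPt q : P ⊕ₗ Qᵒᵈ) < topPt q' ↔ q' < q := fun q q' => by simp [topPt]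
    have h11 : (1 + 1 : ZMod 2) = 0 := rfl
    -- Bottom points precede both top ends of the other component, a contribution of 1 + 1 = 0.
    -- Among top ends the order is reversed, and only the pair (`f q`, `r`) counts, so the sum would
    -- be 1.
    simp only [hsum, bb, bt, tb, tt, if_true, if_false, h11, add_zero, s2, zero_add,
      Finset.sum_const_zero, h2, h1.not_gt, h3.not_gt, ((h1.trans h2).trans h3).not_gt] at s1
    exact one_ne_zero s1
  refine ⟨⟨f, hff, hne, cross⟩, fun q r => ⟨fun h => ?_, fun h => ?_⟩⟩
  · rcases huniq q r h with rfl | rfl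
    · rfl
    · exact SameCircle.of rfl
  · refine h.map topPt ?_
    rintro q _ rfl
    exact hf q

end InducedMatching

end ArcAlgebra

namespace ArcAlgebra

/-! ### Adjunctions from bimodules with dual bases. -/

section DualBasis

open MulOpposite

variable {L H : Type} [Ring L] [Ring H] {𝓛 : ℤ → AddSubgroup L} {𝓗 : ℤ → AddSubgroup H}

namespace GrBimod

variable (T : GrBimod 𝓛 𝓗) {M : GrMod 𝓗}

theorem tmul_sum {ι : Type} (s : Finset ι) (x : T.carrier) (m : ι → M.carrier) :
    T.tmul x (∑ i ∈ s, m i) = ∑ i ∈ s, T.tmul x (m i) :=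
  map_sum (T.tmulHom x) m s

theorem sum_tmul {ι : Type} (s : Finset ι) (x : ι → T.carrier) (m : M.carrier) :
    T.tmul (∑ i ∈ s, x i) m = ∑ i ∈ s, T.tmul (x i) m :=
  map_sum ((T.tmulHom (M := M)).flip m) x s

theorem tmul_add (x : T.carrier) (m m' : M.carrier) :
    T.tmul x (m + m') = T.tmul x m + T.tmul x m' :=
  map_add (T.tmulHom x) m m'

theorem tmul_zero (x : T.carrier) : T.tmul x (0 : M.carrier) = 0 := map_zero (T.tmulHom x)

theorem hom_ext {N : Type} [AddCommGroup N] {f g : Tens T M →+ N}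
    (h : ∀ x m, f (T.tmul x m) = g (T.tmul x m)) : f = g :=
  AddMonoidHom.ext fun z => T.tens_induction (p := fun z => f z = g z) z
    ((map_zero f).trans (map_zero g).symm) h fun z w hz hw => by rw [map_add, map_add, hz, hw]

end GrBimod

/-- Graded bimodules `T` and `T'` that are dual by a pairing of degree `s` with values in `L`, with
dual bases consisting of homogeneous elements. -/
structure DualPair (T : GrBimod 𝓛 𝓗) (T' : GrBimod 𝓗 𝓛) (s : ℤ) where
  ε : T.carrier →+ T'.carrier →+ L
  smul_left : ∀ (l : L) x y, ε (l • x) y = l * ε x y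
  smul_right : ∀ (l : L) x y, ε x (op l • y) = ε x y * l
  balanced : ∀ (h : H) x y, ε (op h • x) y = ε x (h • y)
  deg : ∀ {i j x y}, x ∈ T.gr i → y ∈ T'.gr j → ε x y ∈ 𝓛 (i + j + s)
  ι : Type
  [fintype : Fintype ι]
  x : ι → T.carrier
  y : ι → T'.carrier
  d : ι → ℤ
  x_mem : ∀ i, x i ∈ T.gr (d i)
  y_mem : ∀ i, y i ∈ T'.gr (-s - d i)
  sum_left : ∀ z, ∑ i, ε z (y i) • x i = z
  sum_right : ∀ z, ∑ i, op (ε (x i) z) • y i = z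

namespace DualPair

attribute [instance] DualPair.fintype

variable {T : GrBimod 𝓛 𝓗} {T' : GrBimod 𝓗 𝓛} {s : ℤ} (D : DualPair T T' s)
  (h𝓗 : ∀ h, h ∈ ⨆ n, 𝓗 n) (h𝓛 : ∀ l, l ∈ ⨆ n, 𝓛 n) (j k : ℤ)

/-- The expansion of h y_i in the y_{i'}, whose coefficients ε(x_{i'}, h y_i) = ε(x_{i'} h, y_i) are
moved across the tensor sign. -/
theorem smul_tmul_y {X : GrMod 𝓛} (h : H) (i : D.ι) (n : X.carrier) : h • T'.tmul (D.y i) n =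
    ∑ i', T'.tmul (D.y i') (D.ε (op h • D.x i') (D.y i) • n) := by
  rw [T'.smul_tmul]
  conv_lhs => rw [← D.sum_right (h • D.y i)]
  rw [T'.sum_tmul]
  refine Finset.sum_congr rfl fun i' _ => ?_
  rw [T'.op_smul_tmul, D.balanced]

/-- The unit of the adjunction, on a module. -/
def unitLin (M : GrMod 𝓗) : M.carrier →ₗ[H]
    T'.Tens ((GrMod.shift j).obj ((T.tensor h𝓗).obj M)) where
  toFun m := ∑ i, T'.tmul (M := (GrMod.shift j).obj ((T.tensor h𝓗).obj M)) (D.y i)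
    (T.tmul (D.x i) m)
  map_add' m m' := by
    rw [← Finset.sum_add_distrib]
    refine Finset.sum_congr rfl fun i _ => ?_
    rw [T.tmul_add]
    exact T'.tmul_add _ _ _
  map_smul' h m := by
    rw [RingHom.id_apply, Finset.smul_sum]
    -- The canonical element Σ y_i ⊗ x_i is central for `H`: h Σ y_i ⊗ x_i = Σ y_{i'} ⊗ ε(x_{i'} h,
    -- y_i) x_i = Σ y_{i'} ⊗ x_{i'} h.
    have e1 := fun i => D.smul_tmul_y (X := (GrMod.shift j).obj ((T.tensor h𝓗).obj M)) h i
      (T.tmul (D.x i) m)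
    rw [Finset.sum_congr rfl fun i _ => e1 i, Finset.sum_comm]
    refine Finset.sum_congr rfl fun i' _ => ?_
    rw [← T.op_smul_tmul]
    conv_lhs => rw [← D.sum_left (op h • D.x i'), T.sum_tmul]
    exact T'.tmul_sum _ _ _

theorem unitLin_apply (M : GrMod 𝓗) (m : M.carrier) : D.unitLin h𝓗 j M m =
    ∑ i, T'.tmul (M := (GrMod.shift j).obj ((T.tensor h𝓗).obj M)) (D.y i) (T.tmul (D.x i) m) := rfl

/-- For fixed x, the rule y ⊗ n ↦ ε(x, y) n is balanced over `L`; the resulting maps are balanced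
over `H` in x and can be lifted once more. Shifts do not change the underlying modules, so they only
enter the types. -/
theorem exists_counit (N : GrMod 𝓛) : ∃ F : T.Tens ((GrMod.shift j ⋙ T'.tensor h𝓛 ⋙
    GrMod.shift k).obj N) →ₗ[L] N.carrier, ∀ x y (n : N.carrier), F (T.tmul (M := (GrMod.shift j ⋙
      T'.tensor h𝓛 ⋙ GrMod.shift k).obj N) x (T'.tmul (M := (GrMod.shift j).obj N) y n)) =
        D.ε x y • n := by
  have h1 : ∀ x, ∃ F : T'.Tens ((GrMod.shift j).obj N) →+ N.carrier, ∀ y (n : N.carrier),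
      F (T'.tmul (M := (GrMod.shift j).obj N) y n) = D.ε x y • n := by
    intro x
    obtain ⟨F, hF⟩ := T'.exists_lift (M := (GrMod.shift j).obj N) (N := N.carrier)
      (AddMonoidHom.mk' (fun y => AddMonoidHom.mk' (fun n : N.carrier => D.ε x y • n)
        (fun n n' => smul_add _ _ _)) (fun y y' => by
          ext n
          change D.ε x (y + y') • n = D.ε x y • n + D.ε x y' • n
          rw [map_add, add_smul])) (fun y l n => by
          change D.ε x (op l • y) • n = D.ε x y • (l • n : N.carrier)
          rw [D.smul_right, mul_smul])
    exact ⟨F, hF⟩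
  choose F hF using h1
  have hadd : ∀ x x', F (x + x') = F x + F x' := by
    intro x x'
    refine T'.hom_ext fun y n => ?_
    refine (hF _ y n).trans (Eq.trans ?_ (congrArg₂ (· + ·) (hF x y n) (hF x' y n)).symm)
    rw [map_add, AddMonoidHom.add_apply]
    exact add_smul _ _ _
  have hbal : ∀ (h : H) x (z : T'.Tens ((GrMod.shift j).obj N)), F (op h • x) z = F x (h • z) := by
    intro h x z
    refine DFunLike.congr_fun (f := F (op h • x)) (g := (F x).comp
      (DistribSMul.toAddMonoidHom _ h)) (T'.hom_ext fun y n => ?_) z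
    refine (hF _ y n).trans ?_
    rw [D.balanced]
    exact (hF x (h • y) n).symm
  have hlin : ∀ (l : L) x (z : T'.Tens ((GrMod.shift j).obj N)), F (l • x) z = l • F x z := by
    intro l x z
    refine DFunLike.congr_fun (f := F (l • x)) (g := (DistribSMul.toAddMonoidHom _ l).comp
      (F x)) (T'.hom_ext fun y n => ?_) z
    refine (hF _ y n).trans ?_
    rw [D.smul_left]
    refine (mul_smul _ _ _).trans ?_
    exact congrArg (l • ·) (hF x y n).symm
  obtain ⟨G, hG⟩ := T.exists_lift (M := (GrMod.shift j ⋙ T'.tensor h𝓛 ⋙ GrMod.shift k).obj N)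
    (N := N.carrier) (AddMonoidHom.mk' F hadd) (fun x h z => hbal h x z)
  refine ⟨{ toFun := G, map_add' := map_add G, map_smul' := fun l z => ?_ }, fun x y n => ?_⟩
  · refine DFunLike.congr_fun (f := G.comp (DistribSMul.toAddMonoidHom _ l))
      (g := (DistribSMul.toAddMonoidHom _ l).comp G) (T.hom_ext fun x z => ?_) z
    change G (T.tmul (l • x) z) = l • G (T.tmul x z)
    rw [hG, hG]
    exact hlin l x z
  · exact (hG x _).trans (hF x y n)

/-- The counit of the adjunction, on a module. -/
noncomputable def counitLin (N : GrMod 𝓛) : T.Tens ((GrMod.shift j ⋙ T'.tensor h𝓛 ⋙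
    GrMod.shift k).obj N) →ₗ[L] N.carrier := (D.exists_counit h𝓛 j k N).choose

theorem counitLin_tmul (N : GrMod 𝓛) (x : T.carrier) (y : T'.carrier) (n : N.carrier) :
    D.counitLin h𝓛 j k N (T.tmul (M := (GrMod.shift j ⋙
      T'.tensor h𝓛 ⋙ GrMod.shift k).obj N) x (T'.tmul (M := (GrMod.shift j).obj N) y n)) =
        D.ε x y • n := (D.exists_counit h𝓛 j k N).choose_spec x y n

variable {j k}

/-- Tensor products with dual bimodules are adjoint. -/
noncomputable def adjunction (hjk : j + k = s) :
    T.tensor h𝓗 ⊣ GrMod.shift j ⋙ T'.tensor h𝓛 ⋙ GrMod.shift k where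
  unit :=
    { app := fun M => ⟨D.unitLin h𝓗 j M, fun {n m} hm => by
        refine AddSubgroup.sum_mem _ fun i _ => ?_
        -- The degrees -s - d_i of y_i and d_i + n + j of the shifted x_i ⊗ m add up to n - k, which
        -- is degree n after the outer shift by k.
        refine T'.tmul_mem (i := -s - D.d i) (j := D.d i + n + j) (by linarith) (D.y_mem i) ?_
        refine T.tmul_mem (i := D.d i) (j := n) ?_ (D.x_mem i) hm
        ring⟩
      naturality := fun M M' f => by
        refine GrMod.Hom.ext (LinearMap.ext fun m => ?_)
        change D.unitLin h𝓗 j M' (f.toLin m) = T'.tensMap _ (D.unitLin h𝓗 j M m)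
        rw [unitLin_apply, unitLin_apply, map_sum]
        rfl }
  counit :=
    { app := fun N => ⟨D.counitLin h𝓛 j k N, fun {n z} hz => by
        have : T.tensGr ((GrMod.shift j ⋙ T'.tensor h𝓛 ⋙ GrMod.shift k).obj N) n ≤
            (N.gr n).comap (D.counitLin h𝓛 j k N).toAddMonoidHom := by
          refine (AddSubgroup.closure_le _).2 ?_
          rintro _ ⟨a, b, x, w, hab, hx, hw, rfl⟩
          have h2 : T'.tensGr ((GrMod.shift j).obj N) (b - k) ≤ (N.gr n).comap
              ((D.counitLin h𝓛 j k N).toAddMonoidHom.comp (T.tmulHom (M := (GrMod.shift j ⋙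
                T'.tensor h𝓛 ⋙ GrMod.shift k).obj N) x)) := by
            refine (AddSubgroup.closure_le _).2 ?_
            rintro _ ⟨c, e, y, m, hce, hy, hm, rfl⟩
            change D.counitLin h𝓛 j k N _ ∈ N.gr n
            refine (D.counitLin_tmul h𝓛 j k N x y m).symm ▸ ?_
            have h3 := N.smul_mem (D.deg hx hy) (show m ∈ N.gr (e - j) from hm)
            -- With a + b = n and c + e = b - k, the degree a + c + s + (e - j) of ε(x, y) m equals
            -- n because s = j + k.
            convert h3 using 1
            congr 1
            rw [← hjk, ← hab]
            linarith
          exact h2 hw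
        exact this hz⟩
      naturality := fun N N' f => by
        refine GrMod.Hom.ext (LinearMap.ext fun z => ?_)
        refine DFunLike.congr_fun (f := ((D.counitLin h𝓛 j k N').comp (T.tensMap ((GrMod.shift j ⋙
          T'.tensor h𝓛 ⋙ GrMod.shift k).map f).toLin)).toAddMonoidHom)
          (g := (f.toLin.comp (D.counitLin h𝓛 j k N)).toAddMonoidHom) (T.hom_ext fun x w => ?_) z
        refine T'.tens_induction (M := (GrMod.shift j).obj N)
          (p := fun w => D.counitLin h𝓛 j k N' (T.tmul (M := (GrMod.shift j ⋙
            T'.tensor h𝓛 ⋙ GrMod.shift k).obj N') x (T'.tensMap ((GrMod.shift j).map f).toLin w)) =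
            f.toLin (D.counitLin h𝓛 j k N (T.tmul (M := (GrMod.shift j ⋙
            T'.tensor h𝓛 ⋙ GrMod.shift k).obj N) x w))) w ?_ ?_ ?_
        · rw [map_zero]
          erw [T.tmul_zero, T.tmul_zero]
          rw [map_zero, map_zero, map_zero]
        · intro y n
          erw [T'.tensMap_tmul, counitLin_tmul, counitLin_tmul]
          exact (f.toLin.map_smul _ _).symm
        · intro w w' h h'
          rw [map_add]
          erw [T.tmul_add, T.tmul_add]
          rw [map_add, map_add, map_add]
          exact congrArg₂ (· + ·) h h' }
  left_triangle_components M := by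
    refine GrMod.Hom.ext (LinearMap.ext fun z => ?_)
    change D.counitLin h𝓛 j k _ (T.tensMap (D.unitLin h𝓗 j M) z) = z
    refine T.tens_induction (p := fun z => D.counitLin h𝓛 j k ((T.tensor h𝓗).obj M)
      (T.tensMap (M' := (GrMod.shift j ⋙ T'.tensor h𝓛 ⋙ GrMod.shift k).obj
        ((T.tensor h𝓗).obj M)) (D.unitLin h𝓗 j M) z) = z) z ?_ ?_ ?_
    · rw [map_zero, map_zero]; rfl
    · intro x m
      -- The first triangle identity is Σ ε(x, y_i) x_i = x.
      erw [T.tensMap_tmul, unitLin_apply, T.tmul_sum, map_sum]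
      conv_rhs => rw [← D.sum_left x, T.sum_tmul]
      exact Finset.sum_congr rfl fun i _ => D.counitLin_tmul h𝓛 j k _ _ _ _
    · intro z w hz hw
      rw [map_add, map_add, hz, hw]
      rfl
  right_triangle_components N := by
    refine GrMod.Hom.ext (LinearMap.ext fun z => ?_)
    refine T'.tens_induction (M := (GrMod.shift j).obj N) (p := fun z => T'.tensMap
      (M' := (GrMod.shift j).obj N)
      (M := (GrMod.shift j).obj ((T.tensor h𝓗).obj
        ((GrMod.shift j ⋙ T'.tensor h𝓛 ⋙ GrMod.shift k).obj N)))
      (D.counitLin h𝓛 j k N)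
      (D.unitLin h𝓗 j ((GrMod.shift j ⋙ T'.tensor h𝓛 ⋙ GrMod.shift k).obj N) z) = z) z ?_ ?_ ?_
    · erw [map_zero, map_zero]
    · intro y n
      -- The second triangle identity is Σ y_i ε(x_i, y) = y.
      erw [unitLin_apply, map_sum]
      conv_rhs => rw [← D.sum_right y, T'.sum_tmul]
      refine Finset.sum_congr rfl fun i _ => ?_
      erw [T'.tensMap_tmul, counitLin_tmul, T'.op_smul_tmul]
      rfl
    · intro z w hz hw
      erw [map_add, map_add, hz, hw]

end DualPair

end DualBasis

end ArcAlgebra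

namespace ArcAlgebra

/-! ### From integral pairings to pairings over a symmetric ring. -/

section Frobenius

open MulOpposite

variable {L H : Type} [Ring L] [Ring H] {𝓛 : ℤ → AddSubgroup L} {𝓗 : ℤ → AddSubgroup H}

/-- A symmetrizing form of degree `-N` on a graded ring. -/
structure SymmetricForm (𝓛 : ℤ → AddSubgroup L) (N : ℤ) where
  θ : L →+ ℤ
  comm : ∀ x y, θ (x * y) = θ (y * x)
  exists_eq : ∀ f : L →+ ℤ, ∃ z, ∀ l, f l = θ (l * z)
  eq_zero : ∀ x, (∀ y, θ (y * x) = 0) → x = 0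
  deg : ∀ n, n ≠ N → ∀ x ∈ 𝓛 n, θ x = 0

namespace SymmetricForm

variable {N : ℤ} (Θ : SymmetricForm 𝓛 N)

theorem ext {x y : L} (h : ∀ l, Θ.θ (l * x) = Θ.θ (l * y)) : x = y :=
  sub_eq_zero.1 (Θ.eq_zero _ fun l => by rw [mul_sub, map_sub, h, sub_self])

/-- Homogeneity can be tested with θ: against homogeneous l of degree N - M only the degree M part
of z contributes, and against other degrees both z and that part give zero. By nondegeneracy z
equals its degree M part. -/
theorem mem_of_forall (h𝓛 : HasProj 𝓛)
    (hmul : ∀ {m n x y}, x ∈ 𝓛 m → y ∈ 𝓛 n → x * y ∈ 𝓛 (m + n)) {M : ℤ} {z : L}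
    (h : ∀ a, a + M ≠ N → ∀ l ∈ 𝓛 a, Θ.θ (l * z) = 0) : z ∈ 𝓛 M := by
  obtain ⟨⟨π, h1, h2⟩, h3⟩ := h𝓛
  have hπ : ∀ z, π M z ∈ 𝓛 M := by
    intro z
    have : (⨆ n, 𝓛 n) ≤ (𝓛 M).comap (π M) := by
      refine iSup_le fun n y hy => ?_
      rw [AddSubgroup.mem_comap]
      by_cases hn : n = M
      · subst hn; rw [h1 _ _ hy]; exact hy
      · rw [h2 _ _ hn _ hy]; exact zero_mem _
    exact this (h3 z)
  have hz : π M z = z := by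
    refine Θ.ext fun l => ?_
    refine hom_ext_of_iSup h3 (f := Θ.θ.comp (AddMonoidHom.mulRight (π M z)))
      (g := Θ.θ.comp (AddMonoidHom.mulRight z)) (fun a l hl => ?_) l
    change Θ.θ (l * π M z) = Θ.θ (l * z)
    by_cases ha : a + M = N
    · refine hom_ext_of_iSup h3 (f := (Θ.θ.comp (AddMonoidHom.mulLeft l)).comp (π M))
        (g := Θ.θ.comp (AddMonoidHom.mulLeft l)) (fun n y hy => ?_) z
      change Θ.θ (l * π M y) = Θ.θ (l * y)
      by_cases hn : n = M
      · subst hn; rw [h1 _ _ hy]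
      · rw [h2 _ _ hn _ hy, mul_zero, map_zero, Θ.deg _ (fun e => hn (by linarith)) _ (hmul hl hy)]
    · rw [h a ha l hl, Θ.deg _ ha _ (hmul hl (hπ z))]
  exact hz ▸ hπ z

variable {T : GrBimod 𝓛 𝓗} {T' : GrBimod 𝓗 𝓛} {s : ℤ}

/-- Bimodules with a perfect integral pairing are dual to each other. -/
theorem exists_dualPair (h𝓛 : HasProj 𝓛)
    (hmul : ∀ {m n x y}, x ∈ 𝓛 m → y ∈ 𝓛 n → x * y ∈ 𝓛 (m + n))
    (B : T.carrier →+ T'.carrier →+ ℤ) (hl : ∀ (l : L) x y, B (l • x) y = B x (op l • y))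
    (hr : ∀ (h : H) x y, B (op h • x) y = B x (h • y)) (hB : ∀ y, (∀ x, B x y = 0) → y = 0)
    (hdeg : ∀ i j x y, x ∈ T.gr i → y ∈ T'.gr j → i + j + s ≠ N → B x y = 0)
    {ι : Type} [Fintype ι] [DecidableEq ι] (x : ι → T.carrier) (y : ι → T'.carrier) (d : ι → ℤ)
    (x_mem : ∀ i, x i ∈ T.gr (d i)) (y_mem : ∀ i, y i ∈ T'.gr (-s - d i)) (e : ι → L)
    (he : ∀ i, e i • x i = x i) (hspan : ∀ z, z ∈ Submodule.span L (Set.range x))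
    (hxy : ∀ l i j, B (l • x i) (y j) = if i = j then Θ.θ (l * e i) else 0) :
    Nonempty (DualPair T T' s) := by
  -- The value ε(x, y) represents the functional l ↦ B(lx, y). All its algebraic properties follow
  -- by testing with θ, where nondegeneracy gives uniqueness.
  choose ε hε using fun x y => Θ.exists_eq ((B.flip y).comp
    (AddMonoidHom.mk' (fun l : L => l • x) fun l l' => add_smul l l' x))
  have hε : ∀ x y l, B (l • x) y = Θ.θ (l * ε x y) := hε
  have ε_add : ∀ x y y', ε x (y + y') = ε x y + ε x y' := fun x y y' => Θ.ext fun l => by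
    rw [mul_add, map_add, ← hε, ← hε, ← hε, map_add]
  have add_ε : ∀ x x' y, ε (x + x') y = ε x y + ε x' y := fun x x' y => Θ.ext fun l => by
    rw [mul_add, map_add, ← hε, ← hε, ← hε, smul_add, map_add, AddMonoidHom.add_apply]
  have smul_ε : ∀ (l : L) x y, ε (l • x) y = l * ε x y := fun l x y => Θ.ext fun l' => by
    rw [← hε, ← mul_assoc, ← hε, mul_smul]
  -- Symmetry of θ enters here: B(l'x, yl) = B(l l'x, y) = θ(l l' ε(x, y)) = θ(l' ε(x, y) l).
  have ε_smul : ∀ (l : L) x y, ε x (op l • y) = ε x y * l := fun l x y => Θ.ext fun l' => by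
    rw [← hε, ← hl, ← mul_smul, hε, ← mul_assoc, Θ.comm (l' * _) l, mul_assoc]
  have ε_bal : ∀ (h : H) x y, ε (op h • x) y = ε x (h • y) := fun h x y => Θ.ext fun l => by
    rw [← hε, ← hε, ← hr, smul_comm]
  let E : T.carrier →+ T'.carrier →+ L := AddMonoidHom.mk' (fun x => AddMonoidHom.mk' (ε x)
    (ε_add x)) fun x x' => by ext y; exact add_ε x x' y
  have hE : ∀ x y, E x y = ε x y := fun _ _ => rfl
  -- The bases are orthogonal, with the elements e_i in place of 1; since e_i x_i = x_i, this
  -- suffices for expansions in the x_i.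
  have horth : ∀ i j, ε (x i) (y j) = if i = j then e i else 0 := fun i j => Θ.ext fun l => by
    rw [← hε, hxy]
    split_ifs
    · rfl
    · rw [mul_zero, map_zero]
  have sum_left : ∀ z, ∑ i, ε z (y i) • x i = z := by
    intro z
    induction hspan z using Submodule.span_induction with
    | mem z hz =>
      obtain ⟨j, rfl⟩ := hz
      rw [Finset.sum_eq_single j]
      · rw [horth, if_pos rfl, he]
      · intro i _ hi
        rw [horth, if_neg hi.symm, zero_smul]
      · simp
    | zero => exact Finset.sum_eq_zero fun i _ => by rw [← hE, map_zero]; exact zero_smul _ _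
    | add z w _ _ hz hw =>
      conv_rhs => rw [← hz, ← hw, ← Finset.sum_add_distrib]
      exact Finset.sum_congr rfl fun i _ => by rw [add_ε, add_smul]
    | smul l z _ hz =>
      conv_rhs => rw [← hz, Finset.smul_sum]
      exact Finset.sum_congr rfl fun i _ => by rw [smul_ε, mul_smul]
  have hBε : ∀ x y, B x y = Θ.θ (ε x y) := fun x y => by rw [← one_mul (ε x y), ← hε, one_smul]
  refine ⟨⟨E, smul_ε, ε_smul, ε_bal, ?_, ι, x, y, d, x_mem, y_mem, sum_left, fun z => ?_⟩⟩
  · intro i j x y hx hy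
    refine Θ.mem_of_forall h𝓛 hmul fun a ha l hl' => ?_
    rw [hE, ← hε]
    exact hdeg (a + i) j _ _ (T.smul_mem hl' hx) hy fun h => ha (by linarith)
  -- The right-hand expansion follows from the left-hand one by nondegeneracy of B: after expanding
  -- w in the x_i, both values of B at w are Σ θ(ε(w, y_i) ε(x_i, z)).
  · rw [← sub_eq_zero]
    refine hB _ fun w => ?_
    rw [map_sub, sub_eq_zero, map_sum]
    conv_rhs => rw [← sum_left w]
    rw [map_sum, AddMonoidHom.finsetSum_apply]
    refine Finset.sum_congr rfl fun i _ => ?_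
    rw [hE, hBε, ε_smul, hε, Θ.comm]

end SymmetricForm

end Frobenius

/-! ### Pairings of matrices. -/

section Matrices

variable {A B : Type} [Fintype A] [Fintype B] {M : A → B → Type} [∀ a b, AddCommGroup (M a b)]

open Classical in
/-- The matrix with a single possibly nonzero entry. -/
noncomputable def matrixSingle (a : A) (b : B) : M a b →+ ∀ a b, M a b :=
  (AddMonoidHom.single (fun a => ∀ b, M a b) a).comp (AddMonoidHom.single (M a) b)

theorem matrixSingle_same (a : A) (b : B) (x : M a b) : matrixSingle a b x a b = x := by
  simp [matrixSingle]

theorem matrixSingle_ne {a a' : A} {b b' : B} (x : M a b) (h : a' ≠ a ∨ b' ≠ b) :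
    matrixSingle a b x a' b' = 0 := by
  by_cases ha : a' = a
  · subst ha
    simp [matrixSingle, h.resolve_left (fun h => h rfl)]
  · simp [matrixSingle, ha]

theorem sum_matrixSingle (x : ∀ a b, M a b) : ∑ a, ∑ b, matrixSingle a b (x a b) = x := by
  classical
  funext a b
  rw [Finset.sum_apply, Finset.sum_apply, Finset.sum_eq_single a]
  · rw [Finset.sum_apply, Finset.sum_apply, Finset.sum_eq_single b]
    · exact matrixSingle_same a b _
    · intro b' _ h; exact matrixSingle_ne _ (Or.inr h.symm)
    · simp
  · intro a' _ h
    rw [Finset.sum_apply, Finset.sum_apply]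
    exact Finset.sum_eq_zero fun b' _ => matrixSingle_ne _ (Or.inl h.symm)
  · simp

variable {N : B → A → Type} [∀ b a, AddCommGroup (N b a)]

/-- The pairing of matrices given by pairings of their entries. -/
def matrixPairing (τ : ∀ a b, M a b →+ N b a →+ ℤ) :
    (∀ a b, M a b) →+ (∀ b a, N b a) →+ ℤ :=
  AddMonoidHom.mk' (fun x => AddMonoidHom.mk' (fun y => ∑ a, ∑ b, τ a b (x a b) (y b a))
    fun y y' => by simp [Finset.sum_add_distrib]) fun x x' => by
      ext y; simp [Finset.sum_add_distrib]

variable (τ : ∀ a b, M a b →+ N b a →+ ℤ)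

theorem matrixPairing_apply (x : ∀ a b, M a b) (y : ∀ b a, N b a) :
    matrixPairing τ x y = ∑ a, ∑ b, τ a b (x a b) (y b a) := rfl

theorem matrixPairing_single (a : A) (b : B) (u : M a b) (y : ∀ b a, N b a) :
    matrixPairing τ (matrixSingle a b u) y = τ a b u (y b a) := by
  rw [matrixPairing_apply, Finset.sum_eq_single a, Finset.sum_eq_single b, matrixSingle_same]
  · intro b' _ h; rw [matrixSingle_ne _ (Or.inr h), map_zero]; rfl
  · simp
  · intro a' _ h
    exact Finset.sum_eq_zero fun b' _ => by rw [matrixSingle_ne _ (Or.inl h), map_zero]; rfl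
  · simp

theorem matrixPairing_single_right (a : A) (b : B) (x : ∀ a b, M a b) (v : N b a) :
    matrixPairing τ x (matrixSingle b a v) = τ a b (x a b) v := by
  rw [matrixPairing_apply, Finset.sum_eq_single a, Finset.sum_eq_single b, matrixSingle_same]
  · intro b' _ h; rw [matrixSingle_ne _ (Or.inl h), map_zero]
  · simp
  · intro a' _ h
    exact Finset.sum_eq_zero fun b' _ => by rw [matrixSingle_ne _ (Or.inr h), map_zero]
  · simp

theorem eq_zero_of_matrixPairing (hτ : ∀ a b v, (∀ u, τ a b u v = 0) → v = 0)
    (y : ∀ b a, N b a) (h : ∀ x, matrixPairing τ x y = 0) : y = 0 := by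
  funext b a
  exact hτ a b _ fun u => by rw [← matrixPairing_single, h]

end Matrices

/-! ### Maps and identifications of values of the TQFT. -/

namespace TQFT

open MvPolynomial

variable {V W : Type} {R : V → V → Prop} {S : W → W → Prop}

/-- The homomorphism induced by a map of diagrams. -/
noncomputable def map (φ : V → W) (h : ∀ x y, R x y → SameCircle S (φ x) (φ y)) :
    TQFT R →+* TQFT S :=
  Ideal.quotientMap _ (rename φ : MvPolynomial V ℤ →ₐ[ℤ] MvPolynomial W ℤ).toRingHom
    fun _ hf => circleIdeal_map_le φ h hf

theorem trace_cast [Finite V] {R R' : V → V → Prop} (h : R = R') (x : TQFT R) :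
    trace R' (TQFT.cast h x) = trace R x := by
  subst h
  obtain ⟨f, rfl⟩ := Ideal.Quotient.mk_surjective x
  rfl

theorem cast_mul {R R' : V → V → Prop} (h : R = R') (x y : TQFT R) :
    TQFT.cast h (x * y) = TQFT.cast h x * TQFT.cast h y :=
  map_mul (Ideal.quotEquivOfEq (congrArg circleIdeal h)) x y

theorem cast_cast {R R' : V → V → Prop} (h : R = R') (x : TQFT R) :
    TQFT.cast h.symm (TQFT.cast h x) = x := (TQFT.cast h).symm_apply_apply x

end TQFT

/-! ### The arc ring as a symmetric algebra. -/

section ArcForm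

open MvPolynomial

variable {P : Type} [LinearOrder P] [Fintype P]

/-- The genus zero evaluation in terms of elements. It reduces the trace form of the arc ring to the
perfect forms on its entries, where symmetry is commutativity. -/
theorem trace_contract (c b : Matching P) (x : TQFT (Closure b.Graph id c))
    (y : TQFT (Closure c.Graph id b)) :
    TQFT.trace _ (contractHom c.Graph id c b x y) =
      TQFT.trace _ (x * TQFT.cast (closure_graph_symm b c) y) := by
  obtain ⟨f, rfl⟩ := Ideal.Quotient.mk_surjective x
  obtain ⟨g, rfl⟩ := Ideal.Quotient.mk_surjective y
  rw [contractHom_mk, TQFT.cast_mk, ← map_mul, TQFT.trace_mk, TQFT.trace_mk, contractPoly_eq_mul,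
    rename_id_apply, tracePoly_contract_self]

namespace ArcRing

/-- The trace form of the arc ring. -/
noncomputable def form : ArcRing P →+ ℤ :=
  AddMonoidHom.mk' (fun x => ∑ c, TQFT.trace (Closure c.Graph id c) (x c c)) fun x y => by
    simp [add_apply, Finset.sum_add_distrib]

theorem form_apply (x : ArcRing P) : form x = ∑ c, TQFT.trace (Closure c.Graph id c) (x c c) := rfl

/-- The trace pairing of the entries of the arc ring. -/
noncomputable def entryPairing (c b : Matching P) :
    TQFT (Closure b.Graph id c) →+ TQFT (Closure c.Graph id b) →+ ℤ :=
  AddMonoidHom.mk' (fun x => ((TQFT.trace _).comp (AddMonoidHom.mulLeft x)).comp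
    (TQFT.cast (closure_graph_symm b c)).toAddMonoidHom) fun x x' => by ext y; simp [add_mul]

theorem form_mul (x y : ArcRing P) : form (x * y) =
    ∑ c, ∑ b, entryPairing c b (x c b) (y b c) := by
  rw [form_apply]
  refine Finset.sum_congr rfl fun c _ => ?_
  rw [mul_apply, map_sum]
  exact Finset.sum_congr rfl fun b _ => trace_contract c b _ _

theorem entryPairing_comm (c b : Matching P) (x : TQFT (Closure b.Graph id c))
    (y : TQFT (Closure c.Graph id b)) : entryPairing c b x y = entryPairing b c y x := by
  change TQFT.trace _ (x * TQFT.cast _ y) = TQFT.trace _ (y * TQFT.cast _ x)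
  rw [← TQFT.trace_cast (closure_graph_symm c b), TQFT.cast_mul, TQFT.cast_cast, mul_comm]

theorem entryPairing_eq_zero (c b : Matching P) (y : TQFT (Closure c.Graph id b))
    (h : ∀ x, entryPairing c b x y = 0) : y = 0 :=
  (TQFT.cast (closure_graph_symm b c)).map_eq_zero_iff.1 (TQFT.eq_zero_of_trace h)

/-- The element of the arc ring with a single possibly nonzero entry. -/
noncomputable def single (c b : Matching P) : TQFT (Closure b.Graph id c) →+ ArcRing P :=
  matrixSingle (M := fun c b : Matching P => TQFT (Closure b.Graph id c)) c b

theorem single_same (c b : Matching P) (u : TQFT (Closure b.Graph id c)) :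
    single c b u c b = u :=
  matrixSingle_same (M := fun c b : Matching P => TQFT (Closure b.Graph id c)) c b u

theorem single_ne {c b c' b' : Matching P} (u : TQFT (Closure b.Graph id c))
    (h : c' ≠ c ∨ b' ≠ b) : single c b u c' b' = 0 :=
  matrixSingle_ne (M := fun c b : Matching P => TQFT (Closure b.Graph id c)) u h

theorem sum_single (l : ArcRing P) : ∑ c, ∑ b, single c b (l c b) = l := sum_matrixSingle l

variable (P) in
/-- The arc ring is a symmetric algebra. -/
noncomputable def symmetricForm :
    SymmetricForm (deg P) (2 * ((Fintype.card P / 2 : ℕ) : ℤ)) where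
  θ := form
  comm x y := by
    rw [form_mul, form_mul, Finset.sum_comm]
    exact Finset.sum_congr rfl fun b _ => Finset.sum_congr rfl fun c _ => entryPairing_comm c b _ _
  exists_eq f := by
    choose z hz using fun c b : Matching P => TQFT.exists_trace_eq
      (f.comp (matrixSingle (M := fun c b : Matching P => TQFT (Closure b.Graph id c)) c b))
    -- The element representing `f` is the transpose of the matrix of entrywise representatives, as
    -- `form_mul` pairs the entry (c, b) with the entry (b, c).
    let w : ArcRing P := fun b c => TQFT.cast (closure_graph_symm c b) (z c b)
    refine ⟨w, fun l => ?_⟩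
    rw [form_mul]
    conv_lhs => rw [← sum_single l, map_sum]
    refine Finset.sum_congr rfl fun c _ => ?_
    rw [map_sum]
    refine Finset.sum_congr rfl fun b _ => (hz c b _).trans ?_
    change TQFT.trace _ (l c b * z c b) = TQFT.trace _ (l c b * TQFT.cast _ (TQFT.cast _ (z c b)))
    rw [TQFT.cast_cast]
  eq_zero x hx := eq_zero_of_matrixPairing entryPairing entryPairing_eq_zero x fun y =>
    (form_mul y x).symm.trans (hx y)
  deg n hn x hx := by
    rw [form_apply]
    refine Finset.sum_eq_zero fun c _ => ?_
    obtain ⟨f, hf, hfx⟩ := mem_deg.1 hx c c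
    rw [← hfx]
    refine tracePoly_of_weight hf ?_
    -- Diagonal diagrams have |P|/2 circles, and the shift by |P|/2 puts the product of their
    -- variables in degree 2(|P|/2).
    rw [circles_self]
    intro h
    exact hn (by linarith)

/-- The right-hand side of the orthogonality required by `SymmetricForm.exists_dualPair`, for e_i
the idempotent of `b`. -/
theorem form_mul_single_one (l : ArcRing P) (b : Matching P) :
    form (l * single b b 1) = TQFT.trace _ (l b b) := by
  refine ((symmetricForm P).comm l _).trans ?_
  refine (form_mul _ _).trans ((matrixPairing_single entryPairing b b 1 l).trans ?_)
  change TQFT.trace _ (1 * TQFT.cast _ (l b b)) = _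
  rw [one_mul, TQFT.trace_cast]

end ArcRing

end ArcForm

end ArcAlgebra

namespace ArcAlgebra

/-! ### Duality between a flat tangle and its mirror image. -/

section Mirror

open MvPolynomial

variable {P Q : Type}

/-- Exchanging the bottom and the top end points. -/
def swapPt (x : P ⊕ₗ Qᵒᵈ) : Q ⊕ₗ Pᵒᵈ := Sum.elim topPt botPt (Sum.map id OrderDual.ofDual (ofLex x))

theorem swapPt_swapPt (x : P ⊕ₗ Qᵒᵈ) : swapPt (swapPt x) = x := by
  obtain ⟨p, rfl⟩ | ⟨q, rfl⟩ := botPt_or_topPt x <;> rfl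

variable [LinearOrder P] [Fintype P] [LinearOrder Q] [Fintype Q]

/-- The flat tangle `T'` is the mirror image of `T`. -/
def FlatTangle.IsMirror (T : FlatTangle P Q) (T' : FlatTangle Q P) : Prop :=
  ∀ x, T' (swapPt x) = swapPt (T x)

namespace FlatTangle.IsMirror

variable {T : FlatTangle P Q} {T' : FlatTangle Q P}

theorem symm (h : T.IsMirror T') : FlatTangle.IsMirror T' T := fun x => by
  have := h (swapPt x)
  rw [swapPt_swapPt] at this
  rw [this, swapPt_swapPt]

theorem closure_bot (h : T.IsMirror T') (a : Matching P) (x y : P ⊕ₗ Qᵒᵈ)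
    (hxy : Closure T.Graph botPt a x y) : Closure T'.Graph topPt a (swapPt x) (swapPt y) := by
  obtain hxy | ⟨p⟩ := hxy
  · exact .inner ((congrArg swapPt hxy).trans (h x).symm)
  · exact .arc p

theorem closure_top (h : T.IsMirror T') (b : Matching Q) (x y : P ⊕ₗ Qᵒᵈ)
    (hxy : Closure T.Graph topPt b x y) : Closure T'.Graph botPt b (swapPt x) (swapPt y) := by
  obtain hxy | ⟨p⟩ := hxy
  · exact .inner ((congrArg swapPt hxy).trans (h x).symm)
  · exact .arc p

theorem closure (h : T.IsMirror T') (b : Matching Q) (a : Matching P) (x y : P ⊕ₗ Qᵒᵈ)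
    (hxy : Closure (Closure T.Graph botPt a) topPt b x y) :
    Closure (Closure T'.Graph botPt b) topPt a (swapPt x) (swapPt y) := by
  rw [T.closure_comm] at hxy
  obtain hxy | ⟨p⟩ := hxy
  · exact .inner (h.closure_top b x y hxy)
  · exact .arc p

/-- The input of `rename_saddlePoly` for the comparison of saddles on the two sides of the mirror.
-/
theorem sameCircle_iff (h : T.IsMirror T') (a : Matching P) (p q : Q) :
    SameCircle (Closure T'.Graph topPt a) (botPt p) (botPt q) ↔
      SameCircle (Closure T.Graph botPt a) (topPt p) (topPt q) :=
  ⟨fun e => e.map swapPt fun x y hxy => SameCircle.of (h.symm.closure_top a x y hxy),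
    fun e => e.map swapPt fun x y hxy => SameCircle.of (h.closure_bot a x y hxy)⟩

/-- The identification of the value of the TQFT on a closure of `T` with the value on its mirror
image. -/
noncomputable def flip (h : T.IsMirror T') (b : Matching Q) (a : Matching P) :
    TQFT (Closure (Closure T.Graph botPt a) topPt b) →+*
      TQFT (Closure (Closure T'.Graph botPt b) topPt a) :=
  TQFT.map swapPt fun x y hxy => SameCircle.of (h.closure b a x y hxy)

theorem flip_mk (h : T.IsMirror T') (b : Matching Q) (a : Matching P)
    (f : MvPolynomial (P ⊕ₗ Qᵒᵈ) ℤ) :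
    h.flip b a (Ideal.Quotient.mk _ f) = Ideal.Quotient.mk _ (rename swapPt f) := rfl

theorem rename_rename_swapPt (f : MvPolynomial (P ⊕ₗ Qᵒᵈ) ℤ) :
    rename (swapPt : Q ⊕ₗ Pᵒᵈ → _) (rename swapPt f) = f := by
  rw [rename_rename, show (swapPt ∘ swapPt : P ⊕ₗ Qᵒᵈ → _) = id from funext swapPt_swapPt,
    rename_id_apply]

theorem flip_flip (h : T.IsMirror T') (b : Matching Q) (a : Matching P)
    (x : TQFT (Closure (Closure T.Graph botPt a) topPt b)) :
    h.symm.flip a b (h.flip b a x) = x := by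
  obtain ⟨f, rfl⟩ := Ideal.Quotient.mk_surjective x
  rw [flip_mk, flip_mk, rename_rename_swapPt]

theorem trace_flip (h : T.IsMirror T') (b : Matching Q) (a : Matching P)
    (x : TQFT (Closure (Closure T.Graph botPt a) topPt b)) :
    TQFT.trace _ (h.flip b a x) = TQFT.trace _ x := by
  obtain ⟨f, rfl⟩ := Ideal.Quotient.mk_surjective x
  exact tracePoly_rename_of_inverse swapPt swapPt
    (fun x y hxy => SameCircle.of (h.closure b a x y hxy))
    (fun x y hxy => SameCircle.of (h.symm.closure a b x y hxy))
    (fun x => by rw [swapPt_swapPt]; rfl) (fun x => by rw [swapPt_swapPt]; rfl) f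

theorem circles_eq (h : T.IsMirror T') (b : Matching Q) (a : Matching P) :
    circles (Closure (Closure T'.Graph botPt b) topPt a) =
      circles (Closure (Closure T.Graph botPt a) topPt b) :=
  card_quot_eq swapPt swapPt
    (fun x y hxy => SameCircle.of (h.symm.closure a b x y hxy))
    (fun x y hxy => SameCircle.of (h.closure b a x y hxy))
    (fun x => by rw [swapPt_swapPt]; rfl) (fun x => by rw [swapPt_swapPt]; rfl)

theorem flip_deg (h : T.IsMirror T') (b : Matching Q) (a : Matching P) {s n : ℤ}
    {x : TQFT (Closure (Closure T.Graph botPt a) topPt b)} (hx : x ∈ TQFT.deg _ s n) :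
    h.flip b a x ∈ TQFT.deg _ s n := by
  obtain ⟨f, hf, rfl⟩ := hx
  refine ⟨rename swapPt f, ?_, rfl⟩
  rw [h.circles_eq]
  exact rename_weight swapPt hf

/-- The trace pairing of the values of the TQFT on the closures of a flat tangle and of its mirror
image. -/
noncomputable def entryPairing (h : T.IsMirror T') (b : Matching Q) (a : Matching P) :
    TQFT (Closure (Closure T.Graph botPt a) topPt b) →+
      TQFT (Closure (Closure T'.Graph botPt b) topPt a) →+ ℤ :=
  AddMonoidHom.mk' (fun x => ((TQFT.trace _).comp (AddMonoidHom.mulLeft x)).comp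
    (h.symm.flip a b).toAddMonoidHom) fun x x' => by ext y; simp [add_mul]

theorem entryPairing_apply (h : T.IsMirror T') (b : Matching Q) (a : Matching P)
    (x : TQFT (Closure (Closure T.Graph botPt a) topPt b))
    (y : TQFT (Closure (Closure T'.Graph botPt b) topPt a)) :
    h.entryPairing b a x y = TQFT.trace _ (x * h.symm.flip a b y) := rfl

theorem entryPairing_comm (h : T.IsMirror T') (b : Matching Q) (a : Matching P)
    (x : TQFT (Closure (Closure T.Graph botPt a) topPt b))
    (y : TQFT (Closure (Closure T'.Graph botPt b) topPt a)) :
    h.entryPairing b a x y = h.symm.entryPairing a b y x := by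
  rw [entryPairing_apply, entryPairing_apply, ← h.trace_flip, map_mul]
  rw [show h.flip b a (h.symm.flip a b y) = y from h.symm.flip_flip a b y, mul_comm]

theorem entryPairing_eq_zero (h : T.IsMirror T') (b : Matching Q) (a : Matching P)
    (y : TQFT (Closure (Closure T'.Graph botPt b) topPt a))
    (hy : ∀ x, h.entryPairing b a x y = 0) : y = 0 := by
  have := TQFT.eq_zero_of_trace hy
  rw [← h.symm.flip_flip a b y]
  exact (congrArg _ this).trans (map_zero _)

/-- After reflection of the mirror side, both traces live on closures of the same open diagram, `T`
with its bottom closed by `a`. Its boundary is connected as in `T'` closed by `a`, so the saddle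
factors agree up to renaming, and the equality is the adjointness `tracePoly_saddlePoly`. -/
theorem entryPairing_contract (h : T.IsMirror T') (c b : Matching Q) (a : Matching P)
    (l : TQFT (Closure b.Graph id c)) (x : TQFT (Closure (Closure T.Graph botPt a) topPt b))
    (y : TQFT (Closure (Closure T'.Graph botPt c) topPt a)) :
    h.entryPairing c a (contractHom _ topPt c b l x) y =
      h.entryPairing b a x (TangleModule.contractBot T' a b c l y) := by
  obtain ⟨l, rfl⟩ := Ideal.Quotient.mk_surjective l
  obtain ⟨x, rfl⟩ := Ideal.Quotient.mk_surjective x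
  obtain ⟨y, rfl⟩ := Ideal.Quotient.mk_surjective y
  obtain ⟨d, hd⟩ := T.exists_induces a
  rw [contractHom_mk, TangleModule.contractBot_mk, entryPairing_apply, entryPairing_apply,
    flip_mk, flip_mk, ← map_mul, ← map_mul, TQFT.trace_mk, TQFT.trace_mk, contractPoly_eq_mul,
    contractPoly_eq_mul]
  have h1 := rename_saddlePoly (h.sameCircle_iff a) b c swapPt id (fun _ => rfl)
  rw [rename_id_apply] at h1
  have h2 : rename swapPt (rename (botPt : Q → Q ⊕ₗ Pᵒᵈ) l) =
      rename (topPt : Q → P ⊕ₗ Qᵒᵈ) l := rename_rename _ _ _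
  have h3 := tracePoly_saddlePoly hd c b (rename topPt l * x * rename swapPt y)
  rw [map_mul (rename swapPt), map_mul (rename swapPt), h1, h2]
  convert h3 using 2 <;> ring

/-- In each factor the weight is the degree minus the shift plus the number of circles, and the
trace needs twice the number of circles in total. -/
theorem entryPairing_deg (h : T.IsMirror T') (b : Matching Q) (a : Matching P) {i j : ℤ}
    {x : TQFT (Closure (Closure T.Graph botPt a) topPt b)}
    {y : TQFT (Closure (Closure T'.Graph botPt b) topPt a)} {p q : ℤ}
    (hx : x ∈ TQFT.deg _ p i) (hy : y ∈ TQFT.deg _ q j) (hij : i + j ≠ p + q) :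
    h.entryPairing b a x y = 0 := by
  obtain ⟨g, hg, hgy⟩ := h.symm.flip_deg a b hy
  obtain ⟨f, hf, rfl⟩ := hx
  rw [entryPairing_apply, ← hgy]
  refine tracePoly_of_weight (IsWeightedHomogeneous.mul hf hg) fun e => hij ?_
  linarith

/-- The trace pairing of the bimodules of a flat tangle and of its mirror image. -/
noncomputable def pairing (h : T.IsMirror T') : TangleModule T →+ TangleModule T' →+ ℤ :=
  matrixPairing (M := fun (b : Matching Q) (a : Matching P) =>
    TQFT (Closure (Closure T.Graph botPt a) topPt b)) h.entryPairing

theorem pairing_apply (h : T.IsMirror T') (x : TangleModule T) (y : TangleModule T') :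
    h.pairing x y = ∑ b, ∑ a, h.entryPairing b a (x b a) (y a b) := rfl

theorem pairing_comm (h : T.IsMirror T') (x : TangleModule T) (y : TangleModule T') :
    h.pairing x y = h.symm.pairing y x := by
  rw [pairing_apply, pairing_apply, Finset.sum_comm]
  exact Finset.sum_congr rfl fun a _ => Finset.sum_congr rfl fun b _ => h.entryPairing_comm b a _ _

theorem pairing_smul (h : T.IsMirror T') (l : ArcRing Q) (x : TangleModule T)
    (y : TangleModule T') : h.pairing (l • x) y = h.pairing x (MulOpposite.op l • y) := by
  have e1 : h.pairing (l • x) y = ∑ c, ∑ a, ∑ b, h.entryPairing c a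
      (contractHom _ topPt c b (l c b) (x b a)) (y a c) := by
    rw [pairing_apply]
    refine Finset.sum_congr rfl fun c _ => Finset.sum_congr rfl fun a _ => ?_
    rw [TangleModule.smul_apply, map_sum, AddMonoidHom.finsetSum_apply]
  have e2 : h.pairing x (MulOpposite.op l • y) = ∑ b, ∑ a, ∑ c, h.entryPairing b a
      (x b a) (TangleModule.contractBot T' a b c (l c b) (y a c)) := by
    rw [pairing_apply]
    refine Finset.sum_congr rfl fun c _ => Finset.sum_congr rfl fun a _ => ?_
    rw [TangleModule.op_smul_apply, map_sum]
    rfl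
  rw [e1, e2]
  simp only [h.entryPairing_contract]
  rw [Finset.sum_comm]
  conv_rhs => rw [Finset.sum_comm]
  exact Finset.sum_congr rfl fun a _ => Finset.sum_comm

/-- The right action on the bimodule of `T` is covered by the left action on that of `T'`, because
being mirror images is symmetric. -/
theorem pairing_op_smul (h : T.IsMirror T') (l : ArcRing P) (x : TangleModule T)
    (y : TangleModule T') : h.pairing (MulOpposite.op l • x) y = h.pairing x (l • y) := by
  rw [pairing_comm, ← pairing_smul, ← pairing_comm]

theorem eq_zero_of_pairing (h : T.IsMirror T') (y : TangleModule T')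
    (hy : ∀ x, h.pairing x y = 0) : y = 0 :=
  eq_zero_of_matrixPairing h.entryPairing h.entryPairing_eq_zero y hy

theorem pairing_deg (h : T.IsMirror T') {i j : ℤ} {x : TangleModule T} {y : TangleModule T'}
    (hx : x ∈ TangleModule.deg T i) (hy : y ∈ TangleModule.deg T' j)
    (hij : i + j ≠ (Fintype.card P / 2 : ℕ) + (Fintype.card Q / 2 : ℕ)) : h.pairing x y = 0 :=
  Finset.sum_eq_zero fun b _ => Finset.sum_eq_zero fun a _ => h.entryPairing_deg b a
    (TangleModule.mem_deg.1 hx b a) (TangleModule.mem_deg.1 hy a b) hij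

end FlatTangle.IsMirror

namespace TangleModule

variable {T : FlatTangle P Q}

/-- The element of the bimodule with a single possibly nonzero entry. -/
noncomputable def single (b : Matching Q) (a : Matching P) :
    TQFT (Closure (Closure T.Graph botPt a) topPt b) →+ TangleModule T :=
  matrixSingle (M := fun (b : Matching Q) (a : Matching P) =>
    TQFT (Closure (Closure T.Graph botPt a) topPt b)) b a

theorem single_same (b : Matching Q) (a : Matching P)
    (u : TQFT (Closure (Closure T.Graph botPt a) topPt b)) : single b a u b a = u :=
  matrixSingle_same (M := fun (b : Matching Q) (a : Matching P) =>
    TQFT (Closure (Closure T.Graph botPt a) topPt b)) b a u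

theorem single_ne {b b' : Matching Q} {a a' : Matching P}
    (u : TQFT (Closure (Closure T.Graph botPt a) topPt b)) (h : b' ≠ b ∨ a' ≠ a) :
    single b a u b' a' = 0 :=
  matrixSingle_ne (M := fun (b : Matching Q) (a : Matching P) =>
    TQFT (Closure (Closure T.Graph botPt a) topPt b)) u h

theorem sum_single (x : TangleModule T) : ∑ b, ∑ a, single b a (x b a) = x := sum_matrixSingle x

theorem single_mem {b : Matching Q} {a : Matching P} {n : ℤ}
    {u : TQFT (Closure (Closure T.Graph botPt a) topPt b)}
    (hu : u ∈ TQFT.deg _ (Fintype.card P / 2 : ℕ) n) : single b a u ∈ deg T n := by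
  refine mem_deg.2 fun b' a' => ?_
  by_cases h : b' = b ∧ a' = a
  · obtain ⟨rfl, rfl⟩ := h
    rw [single_same]
    exact hu
  · rw [single_ne _ (not_and_or.1 h)]
    exact zero_mem _

theorem single_smul_single (c b : Matching Q) (a : Matching P) (l : TQFT (Closure b.Graph id c))
    (u : TQFT (Closure (Closure T.Graph botPt a) topPt b)) :
    ArcRing.single c b l • single b a u = single c a (contractHom _ topPt c b l u) := by
  funext c' a'
  rw [smul_apply, Finset.sum_eq_single b]
  · by_cases h : c' = c
    · subst h
      rw [ArcRing.single_same]
      by_cases ha : a' = a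
      · subst ha; rw [single_same, single_same]
      · rw [single_ne _ (Or.inr ha), single_ne _ (Or.inr ha), map_zero]
    · rw [ArcRing.single_ne _ (Or.inl h), single_ne _ (Or.inl h), map_zero]; rfl
  · intro b' _ h
    rw [single_ne _ (Or.inl h), map_zero]
  · simp

theorem smul_single_apply (l : ArcRing Q) (c b : Matching Q) (a : Matching P)
    (u : TQFT (Closure (Closure T.Graph botPt a) topPt b)) :
    (l • single b a u) c a = contractHom _ topPt c b (l c b) u := by
  rw [smul_apply, Finset.sum_eq_single b, single_same]
  · intro b' _ h
    rw [single_ne _ (Or.inl h), map_zero]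
  · simp

theorem smul_single_apply_ne (l : ArcRing Q) (c b : Matching Q) {a a' : Matching P} (h : a' ≠ a)
    (u : TQFT (Closure (Closure T.Graph botPt a) topPt b)) :
    (l • single b a u) c a' = 0 := by
  rw [smul_apply]
  exact Finset.sum_eq_zero fun b' _ => by rw [single_ne _ (Or.inr h), map_zero]

end TangleModule

theorem FlatTangle.IsMirror.pairing_single {T : FlatTangle P Q} {T' : FlatTangle Q P}
    (h : T.IsMirror T') (x : TangleModule T) (b : Matching Q) (a : Matching P)
    (v : TQFT (Closure (Closure T'.Graph botPt b) topPt a)) :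
    h.pairing x (TangleModule.single a b v) = h.entryPairing b a (x b a) v :=
  matrixPairing_single_right (M := fun (b : Matching Q) (a : Matching P) =>
    TQFT (Closure (Closure T.Graph botPt a) topPt b)) h.entryPairing b a x v

theorem closedMonomial_weight {V B : Type} {R : V → V → Prop} {bd : B → V}
    (S : Finset (ClosedComp R bd)) :
    IsWeightedHomogeneous (two V) (closedMonomial S) (2 * (S.card : ℤ)) := by
  have := IsWeightedHomogeneous.prod S (fun κ : ClosedComp R bd => (X κ.pt : MvPolynomial V ℤ))
    (fun _ => 2) (w := two V) fun κ _ => isWeightedHomogeneous_X ℤ (two V) κ.pt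
  rw [Finset.sum_const, nsmul_eq_mul, mul_comm] at this
  exact this

/-- The bimodules of a flat tangle and of its mirror image are dual to each other. -/
theorem FlatTangle.IsMirror.exists_dualPair {T : FlatTangle P Q} {T' : FlatTangle Q P}
    (h : T.IsMirror T') : Nonempty (DualPair T.bimodule T'.bimodule
      ((Fintype.card Q / 2 : ℕ) - (Fintype.card P / 2 : ℕ) : ℤ)) := by
  classical
  -- `d a` is the matching of the top points left after closing the bottom by `a`. Below, a
  -- generator lives in the entry (`d a`, a) and is a monomial in the closed circles; its dual is
  -- the reflected complementary monomial.
  choose d hd using T.exists_induces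
  let ι := Σ a : Matching P, Finset (ClosedComp (Closure T.Graph botPt a) topPt)
  let m : ∀ (b : Matching Q) (i : ι), TQFT (Closure (Closure T.Graph botPt i.1) topPt b) :=
    fun b i => Ideal.Quotient.mk _ (closedMonomial i.2)
  let x : ι → TangleModule T := fun i => TangleModule.single (d i.1) i.1 (m _ i)
  let y : ι → TangleModule T' := fun i => TangleModule.single i.1 (d i.1)
    (h.flip (d i.1) i.1 (m _ ⟨i.1, i.2ᶜ⟩))
  -- Closing the top by `d a` doubles its |Q|/2 arcs and leaves the closed circles.
  have hcirc : ∀ i : ι, circles (Closure (Closure T.Graph botPt i.1) topPt (d i.1)) =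
      Fintype.card Q / 2 + (i.2.card + i.2ᶜ.card) := fun i => by
    rw [circles_closure (hd i.1), circles_self, Finset.card_add_card_compl]
  have m_mem : ∀ (i : ι) (s : ℤ), m (d i.1) i ∈ TQFT.deg _ s (2 * (i.2.card : ℤ) + s -
      circles (Closure (Closure T.Graph botPt i.1) topPt (d i.1))) := fun i s => by
    refine ⟨_, ?_, rfl⟩
    have e : ∀ a b c : ℤ, a + b - c - b + c = a := by intros; ring
    rw [e]
    exact closedMonomial_weight i.2
  refine (ArcRing.symmetricForm Q).exists_dualPair ArcRing.hasProj ArcRing.mul_mem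
    (T := T.bimodule) (T' := T'.bimodule) h.pairing h.pairing_smul h.pairing_op_smul
    h.eq_zero_of_pairing ?_ x y (fun i => 2 * (i.2.card : ℤ) + (Fintype.card P / 2 : ℕ) -
      circles (Closure (Closure T.Graph botPt i.1) topPt (d i.1))) ?_ ?_
    (fun i => ArcRing.single (d i.1) (d i.1) 1) ?_ ?_ ?_
  -- With s = |Q|/2 - |P|/2 and N = 2(|Q|/2), the condition i + j + s = N reads i + j = |P|/2 +
  -- |Q|/2, the degree at which the pairing lives.
  · intro i j x y hx hy hij
    refine h.pairing_deg hx hy fun e => hij ?_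
    linarith
  · exact fun i => TangleModule.single_mem (m_mem i _)
  · intro i
    refine TangleModule.single_mem (h.flip_deg _ _ ?_)
    -- By the circle count both degrees to be compared are |Sᶜ| - |S|.
    have e1 := m_mem ⟨i.1, i.2ᶜ⟩ (Fintype.card Q / 2 : ℕ)
    have e2 := hcirc i
    dsimp only at e1
    convert e1 using 2
    omega
  · intro i
    refine (TangleModule.single_smul_single _ _ _ _ _).trans ?_
    rw [contractHom_one_left]
  · intro z
    -- The entry (b, a) is spanned by products of polynomials in the top points and closed
    -- monomials. Such a product is a generator multiplied by an element of the entry (b, `d a`) of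
    -- the arc ring, as the contraction along `d a` has no factor.
    have hs : ∀ b a u, TangleModule.single (T := T) b a u ∈
        Submodule.span (ArcRing Q) (Set.range x) := by
      intro b a u
      obtain ⟨f, rfl⟩ := Ideal.Quotient.mk_surjective u
      refine closed_induction (R := Closure T.Graph botPt a) (bd := topPt)
        (p := fun f => TangleModule.single (T := T) b a (Ideal.Quotient.mk _ f) ∈
          Submodule.span (ArcRing Q) (Set.range x)) f ?_ ?_ ?_
      · intro f g hf hg
        rw [map_add, map_add]
        exact add_mem hf hg
      · intro f g hfg hf
        rwa [Ideal.Quotient.eq.2 (circleIdeal_le_closure b hfg)] at hf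
      · intro g S
        have := Submodule.smul_mem (Submodule.span (ArcRing Q) (Set.range x))
          (ArcRing.single b (d a) (Ideal.Quotient.mk _ g)) (Submodule.subset_span ⟨⟨a, S⟩, rfl⟩)
        convert this using 1
        refine Eq.trans ?_ (TangleModule.single_smul_single _ _ _ _ _).symm
        refine congrArg _ ?_
        refine Eq.trans ?_ (contractHom_mk _ _ _ _ _ _).symm
        rw [contractPoly_eq_mul, saddlePoly_self (hd a), mul_one]
    rw [← TangleModule.sum_single (T := T) z]
    exact sum_mem fun b _ => sum_mem fun a _ => hs b a _
  -- The dual generator only sees the entry (`d a'`, a'). For a = a' the closed circles give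
  -- δ_{S,S'} and the remaining factor is the trace of the diagonal entry of l; for a ≠ a' the entry
  -- of l x_{a,S} in column a' vanishes.
  · rintro l ⟨a, S⟩ ⟨a', S'⟩
    refine (h.pairing_single _ _ _ _).trans ?_
    by_cases ha : a' = a
    · subst ha
      obtain ⟨f, hf⟩ := Ideal.Quotient.mk_surjective (l (d a') (d a'))
      have e1 : (ArcRing.symmetricForm Q).θ (l * ArcRing.single (d a') (d a') 1) =
          tracePoly (Closure (d a').Graph id (d a')) f := by
        refine (ArcRing.form_mul_single_one l (d a')).trans ?_
        rw [← hf, TQFT.trace_mk]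
      have e2 : h.entryPairing (d a') a' ((l • x ⟨a', S⟩ : TangleModule T) (d a') a')
          (h.flip (d a') a' (m _ ⟨a', S'ᶜ⟩)) = tracePoly (Closure (Closure T.Graph botPt a') topPt
            (d a')) (rename topPt f * (closedMonomial S * closedMonomial S'ᶜ)) := by
        rw [TangleModule.smul_single_apply, ← hf, h.entryPairing_apply, h.flip_flip,
          contractHom_mk, contractPoly_eq_mul, saddlePoly_self (hd a'), mul_one, ← map_mul,
          TQFT.trace_mk, mul_assoc]
      refine e2.trans ?_
      rw [tracePoly_closed_mul (hd a'), e1]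
      congr 1
      rw [eq_iff_iff]
      constructor
      · intro e; rw [compl_injective e]
      · intro e
        rw [Sigma.mk.injEq] at e
        rw [eq_of_heq e.2]
    · rw [if_neg fun e => ha (congrArg Sigma.fst e).symm]
      have := TangleModule.smul_single_apply_ne (T := T) l (d a') (d a) ha (m _ ⟨a, S⟩)
      exact (congrArg (fun u => h.entryPairing (d a') a' u _) this).trans
        (DFunLike.congr_fun (map_zero (h.entryPairing (d a') a')) _)

/-- The functor of a flat tangle is left adjoint to a shift of the functor of its mirror image. -/
theorem FlatTangle.IsMirror.nonempty_adjunction {T : FlatTangle P Q} {T' : FlatTangle Q P}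
    (h : T.IsMirror T') {j k : ℤ}
    (hjk : j + k = (Fintype.card Q / 2 : ℕ) - (Fintype.card P / 2 : ℕ)) :
    Nonempty (T.functor ⊣ GrMod.shift j ⋙ T'.functor ⋙ GrMod.shift k) :=
  h.exists_dualPair.map fun D => D.adjunction ArcRing.hasProj.2 ArcRing.hasProj.2 hjk

end Mirror

end ArcAlgebra

namespace ArcAlgebra

/-! ### Adjunctions between families of categories. -/

section Families

open CategoryTheory Limits

universe u₁ u₂

variable {W : Type} {C : W → Type u₁} [∀ w, Category.{u₂} (C w)] {E G : (∀ w, C w) ⥤ ∀ w, C w}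

/-- Functors between families of categories are adjoint if their components, which are indexed by a
partial bijection, are. -/
theorem nonempty_adjunction_of_components {r : W → W → Prop}
    (hr : ∀ {w v v'}, r w v → r w v' → v = v') (hr' : ∀ {w w' v}, r w v → r w' v → w = w')
    (L : ∀ w v, r w v → C w ⥤ C v) (R : ∀ w v, r w v → C v ⥤ C w) (adj : ∀ w v h, L w v h ⊣ R w v h)
    (hE : ∀ w v h, E ⋙ Pi.eval C v = Pi.eval C w ⋙ L w v h)
    (hG : ∀ w v h, G ⋙ Pi.eval C w = Pi.eval C v ⋙ R w v h)
    (zE : ∀ v, (¬ ∃ w, r w v) → ∀ X, IsZero (E.obj X v))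
    (zG : ∀ w, (¬ ∃ v, r w v) → ∀ X, IsZero (G.obj X w)) : Nonempty (E ⊣ G) := by
  classical
  -- The equalities of functors are only used through the natural isomorphisms that they induce,
  -- with naturality as the only retained property.
  have hα : ∀ w v (h : r w v), ∃ α : ∀ X : ∀ w, C w, (L w v h).obj (X w) ≅ E.obj X v,
      ∀ (X X' : ∀ w, C w) (f : X ⟶ X'), (L w v h).map (f w) ≫ (α X').hom =
        (α X).hom ≫ E.map f v :=
    fun w v h => ⟨fun X => (eqToIso (hE w v h)).symm.app X,
      fun X X' f => (eqToIso (hE w v h)).inv.naturality f⟩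
  choose α hα using hα
  have hβ : ∀ w v (h : r w v), ∃ β : ∀ Y : ∀ w, C w, (R w v h).obj (Y v) ≅ G.obj Y w,
      ∀ (Y Y' : ∀ w, C w) (f : Y ⟶ Y'), (R w v h).map (f v) ≫ (β Y').hom =
        (β Y).hom ≫ G.map f w :=
    fun w v h => ⟨fun Y => (eqToIso (hG w v h)).symm.app Y,
      fun Y Y' f => (eqToIso (hG w v h)).inv.naturality f⟩
  choose β hβ using hβ
  let e : ∀ w v (h : r w v) (X Y : ∀ w, C w), (E.obj X v ⟶ Y v) ≃ (X w ⟶ G.obj Y w) :=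
    fun w v h X Y => (((α w v h X).symm.homCongr (Iso.refl (Y v))).trans
      ((adj w v h).homEquiv (X w) (Y v))).trans ((Iso.refl (X w)).homCongr (β w v h Y))
  have he : ∀ w v (h : r w v) (X Y : ∀ w, C w) (g : E.obj X v ⟶ Y v), e w v h X Y g =
      (adj w v h).homEquiv (X w) (Y v) ((α w v h X).hom ≫ g) ≫ (β w v h Y).hom := by
    intro w v h X Y g
    simp [e, Iso.homCongr_apply]
  have e_left : ∀ w v h (X X' Y : ∀ w, C w) (f : X' ⟶ X) (g : E.obj X v ⟶ Y v),
      e w v h X' Y (E.map f v ≫ g) = f w ≫ e w v h X Y g := by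
    intro w v h X X' Y f g
    rw [he, he, ← Category.assoc, ← hα, Category.assoc, Adjunction.homEquiv_naturality_left,
      Category.assoc]
  have e_right : ∀ w v h (X Y Y' : ∀ w, C w) (f : Y ⟶ Y') (g : E.obj X v ⟶ Y v),
      e w v h X Y' (g ≫ f v) = e w v h X Y g ≫ G.map f w := by
    intro w v h X Y Y' f g
    rw [he, he, ← Category.assoc, Adjunction.homEquiv_naturality_right, Category.assoc, hβ,
      Category.assoc]
  -- Morphisms are transposed componentwise along the partial bijection. At an unmatched index one
  -- of the objects is zero, and there is exactly one morphism. By uniqueness of partners the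
  -- choices in `fwd` and `bwd` do not matter.
  let fwd : ∀ X Y : ∀ w, C w, (E.obj X ⟶ Y) → (X ⟶ G.obj Y) := fun X Y f w =>
    if h : ∃ v, r w v then e w h.choose h.choose_spec X Y (f _) else (zG w h Y).from_ _
  let bwd : ∀ X Y : ∀ w, C w, (X ⟶ G.obj Y) → (E.obj X ⟶ Y) := fun X Y f v =>
    if h : ∃ w, r w v then (e h.choose v h.choose_spec X Y).symm (f _) else (zE v h X).to_ _
  have fwd_apply : ∀ X Y (f : E.obj X ⟶ Y) w v (h : r w v), fwd X Y f w = e w v h X Y (f v) := by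
    intro X Y f w v h
    have h' : ∃ v, r w v := ⟨v, h⟩
    obtain rfl := hr h h'.choose_spec
    exact dif_pos h'
  have bwd_apply : ∀ X Y (f : X ⟶ G.obj Y) w v (h : r w v),
      bwd X Y f v = (e w v h X Y).symm (f w) := by
    intro X Y f w v h
    have h' : ∃ w, r w v := ⟨w, h⟩
    obtain rfl := hr' h h'.choose_spec
    exact dif_pos h'
  refine ⟨Adjunction.mkOfHomEquiv
    { homEquiv := fun X Y => ⟨fwd X Y, bwd X Y, fun f => ?_, fun f => ?_⟩
      homEquiv_naturality_left_symm := fun {X' X Y} f g => ?_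
      homEquiv_naturality_right := fun {X Y Y'} f g => ?_ }⟩
  · funext v
    by_cases h : ∃ w, r w v
    · obtain ⟨w, h⟩ := h
      rw [bwd_apply _ _ _ _ _ h, fwd_apply _ _ _ _ _ h, Equiv.symm_apply_apply]
    · exact (zE v h X).eq_of_src _ _
  · funext w
    by_cases h : ∃ v, r w v
    · obtain ⟨v, h⟩ := h
      rw [fwd_apply _ _ _ _ _ h, bwd_apply _ _ _ _ _ h, Equiv.apply_symm_apply]
    · exact (zG w h Y).eq_of_tgt _ _
  · funext v
    by_cases h : ∃ w, r w v
    · obtain ⟨w, h⟩ := h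
      change bwd X' Y (f ≫ g) v = E.map f v ≫ bwd X Y g v
      rw [bwd_apply _ _ _ _ _ h, bwd_apply _ _ _ _ _ h, Equiv.symm_apply_eq, e_left,
        Equiv.apply_symm_apply]
      rfl
    · exact (zE v h X').eq_of_src _ _
  · funext w
    by_cases h : ∃ v, r w v
    · obtain ⟨v, h⟩ := h
      change fwd X Y' (f ≫ g) w = fwd X Y f w ≫ G.map g w
      rw [fwd_apply _ _ _ _ _ h, fwd_apply _ _ _ _ _ h]
      exact e_right w v h X Y Y' g (f v)
    · exact (zG w h Y').eq_of_tgt _ _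

end Families

/-! ### Zero objects and shifts of graded modules. -/

namespace GrMod

variable {H : Type} [Ring H] {𝓗 : ℤ → AddSubgroup H}

theorem isZero_of_subsingleton (M : GrMod 𝓗) [Subsingleton M.carrier] : Limits.IsZero M :=
  ⟨fun N => ⟨⟨⟨⟨0, fun _ => zero_mem _⟩⟩,
      fun f => Hom.ext (LinearMap.ext fun x => by
        rw [Subsingleton.elim x 0, map_zero, map_zero])⟩⟩,
    fun N => ⟨⟨⟨⟨0, fun _ => zero_mem _⟩⟩,
      fun f => Hom.ext (LinearMap.ext fun x => Subsingleton.elim _ _)⟩⟩⟩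

/-- Opposite shifts are adjoint. -/
def shiftAdjunction (j : ℤ) : (shift j : GrMod 𝓗 ⥤ GrMod 𝓗) ⊣ shift (-j) where
  unit :=
    { app := fun M => ⟨LinearMap.id, fun {n x} hx => by
        change x ∈ M.gr (n - -j - j)
        rwa [sub_neg_eq_add, add_sub_cancel_right]⟩ }
  counit :=
    { app := fun M => ⟨LinearMap.id, fun {n x} hx => by
        change x ∈ M.gr (n - j - -j) at hx
        rwa [sub_neg_eq_add, sub_add_cancel] at hx⟩ }

end GrMod

/-! ### Mirror images of the step tangles. -/

namespace Adjacent

variable {n i : ℕ} {w v : Fin n → ℤ}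

theorem swapPt_pt (h : Adjacent i w v) (h' : Adjacent i v w) (j : Fin n)
    (hj : j.val = i ∨ j.val = i + 1) : swapPt (h.pt j hj) = h'.pt j hj := by
  by_cases e : w j = 1
  · rw [← h.bot_eq_pt ⟨j, e⟩ hj, ← h'.top_eq_pt ⟨j, e⟩ hj]; rfl
  · rw [← h.top_eq_pt ⟨j, h.exists_pt hj e⟩ hj, ← h'.bot_eq_pt ⟨j, h.exists_pt hj e⟩ hj]; rfl

/-- The description of the step tangle by positions does not distinguish bottom from top: the two
special end points stay at positions `i` and `i + 1`, and through strands are only turned upside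
down. -/
theorem isMirror (h : Adjacent i w v) (h' : Adjacent i v w) (hi : i + 1 < n) :
    FlatTangle.IsMirror (h.tangle hi) (h'.tangle hi) := by
  intro x
  change h'.partner hi (swapPt x) = swapPt (h.partner hi x)
  obtain ⟨p, q, hpq, hp, ⟨rfl, h2⟩ | ⟨rfl, h2⟩⟩ | ⟨j, hj, rfl⟩ := h.cases_pt hi x
  · rw [h2]
    exact (h'.partner_top hi p hp (hpq ▸ q.2)).trans (congrArg botPt (Subtype.ext hpq))
  · rw [h2]
    exact (h'.partner_bot hi q (hpq ▸ hp) (hpq ▸ p.2)).trans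
      (congrArg topPt (Subtype.ext hpq.symm))
  · rw [h.partner_pt, swapPt_pt h h', swapPt_pt h h', h'.partner_pt]

end Adjacent

/-! ### Degree shifts and assembly over all weights. -/

section Step

variable {n k i : ℕ} (hi : i + 1 < n) {w v : Weight n k}

/-- Only positions i and i + 1 matter. For (w_i, w_{i+1}) = (0,1), (0,2), (1,1), (1,2) the pair for
v is (1,0), (1,1), (2,0), (2,1); half the number of points changes by 0, 1, -1, 0, while v_i -
v_{i+1} is 1, 0, 2, 1 and w_i - w_{i+1} is -1, -2, 0, -1. -/
theorem card_points (h : v.1 = w.1 + root hi) :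
    ((Fintype.card (Points v.1) / 2 : ℕ) - (Fintype.card (Points w.1) / 2 : ℕ) : ℤ) =
      1 - (v.1 ⟨i, Nat.lt_of_succ_lt hi⟩ - v.1 ⟨i + 1, hi⟩) ∧
    ((Fintype.card (Points w.1) / 2 : ℕ) - (Fintype.card (Points v.1) / 2 : ℕ) : ℤ) =
      1 + (w.1 ⟨i, Nat.lt_of_succ_lt hi⟩ - w.1 ⟨i + 1, hi⟩) := by
  set a : Fin n := ⟨i, Nat.lt_of_succ_lt hi⟩
  set b : Fin n := ⟨i + 1, hi⟩
  have hab : a ≠ b := by simp [a, b]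
  have hc : ∀ u : Fin n → ℤ, (Fintype.card (Points u) : ℤ) = ∑ j, if u j = 1 then 1 else 0 := by
    intro u
    rw [Fintype.card_subtype, Finset.card_filter]
    push_cast
    rfl
  have hv : ∀ j, v.1 j = w.1 j + (Pi.single a 1 - Pi.single b 1 : Fin n → ℤ) j := fun j => by
    rw [h]; rfl
  have h1 : (Fintype.card (Points v.1) : ℤ) - Fintype.card (Points w.1) =
      ((if v.1 a = 1 then 1 else 0) - (if w.1 a = 1 then 1 else 0)) +
      ((if v.1 b = 1 then 1 else 0) - (if w.1 b = 1 then 1 else 0)) := by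
    rw [hc, hc, ← Finset.sum_sub_distrib]
    refine Finset.sum_eq_add a b hab (fun j _ hj => ?_) (by simp) (by simp)
    have := hv j
    rw [Pi.sub_apply, Pi.single_eq_of_ne hj.1, Pi.single_eq_of_ne hj.2, sub_zero, add_zero] at this
    rw [this, sub_self]
  have ha := hv a
  have hb := hv b
  rw [Pi.sub_apply, Pi.single_eq_same, Pi.single_eq_of_ne hab] at ha
  rw [Pi.sub_apply, Pi.single_eq_same, Pi.single_eq_of_ne hab.symm] at hb
  have b1 := w.2.1 a
  have b2 := w.2.1 b
  have b3 := v.2.1 a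
  have b4 := v.2.1 b
  split_ifs at h1 <;> constructor <;> omega

theorem nonempty_stepAdjunction (h : v.1 = w.1 + root hi) :
    Nonempty (stepFunctor hi w v (Or.inl h) ⊣
      GrMod.shift (-(v.1 ⟨i, Nat.lt_of_succ_lt hi⟩ - v.1 ⟨i + 1, hi⟩)) ⋙
        stepFunctor hi v w (Or.inr h) ⋙ GrMod.shift 1) :=
  (Adjacent.isMirror _ _ hi).nonempty_adjunction (by
    have := (card_points hi h).1
    rw [this]; ring)

theorem nonempty_stepAdjunction' (h : v.1 = w.1 + root hi) :
    Nonempty (stepFunctor hi v w (Or.inr h) ⊣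
      GrMod.shift (w.1 ⟨i, Nat.lt_of_succ_lt hi⟩ - w.1 ⟨i + 1, hi⟩) ⋙
        stepFunctor hi w v (Or.inl h) ⋙ GrMod.shift 1) :=
  (Adjacent.isMirror _ _ hi).nonempty_adjunction (by
    have := (card_points hi h).2
    rw [this]; ring)

/-- The weight w is replaced by the literal expression v - α_i in the definition of E_i, so that the
case distinction there resolves without transport. -/
theorem functorE_eval (h : v.1 = w.1 + root hi) : functorE hi ⋙ Pi.eval (WeightCat n k) v =
    Pi.eval (WeightCat n k) w ⋙ stepFunctor hi w v (Or.inl h) := by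
  obtain ⟨w, hw⟩ := w
  obtain rfl : w = v.1 - root hi := (sub_eq_of_eq_add h).symm
  exact (Functor.pi'_eval _ _).trans (dif_pos hw)

theorem functorF_eval (h : v.1 = w.1 + root hi) : functorF hi ⋙ Pi.eval (WeightCat n k) w =
    Pi.eval (WeightCat n k) v ⋙ stepFunctor hi v w (Or.inr h) := by
  obtain ⟨v, hv⟩ := v
  obtain rfl : v = w.1 + root hi := h
  exact (Functor.pi'_eval _ _).trans (dif_pos hv)

theorem functorE_obj_eq_zero (h : ¬ ∃ w : Weight n k, v.1 = w.1 + root hi) (X : TotalCat n k) :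
    (functorE hi).obj X v = GrMod.zero _ := by
  have h1 : ¬ IsWeight k (v.1 - root hi) := fun h' => h ⟨⟨_, h'⟩, (sub_add_cancel _ _).symm⟩
  have h2 : functorE hi ⋙ Pi.eval (WeightCat n k) v = (Functor.const _).obj (GrMod.zero _) :=
    (Functor.pi'_eval _ _).trans (dif_neg h1)
  exact congrArg (fun G => G.obj X) h2

theorem functorF_obj_eq_zero (h : ¬ ∃ v : Weight n k, v.1 = w.1 + root hi) (X : TotalCat n k) :
    (functorF hi).obj X w = GrMod.zero _ := by
  have h1 : ¬ IsWeight k (w.1 + root hi) := fun h' => h ⟨⟨_, h'⟩, rfl⟩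
  have h2 : functorF hi ⋙ Pi.eval (WeightCat n k) w = (Functor.const _).obj (GrMod.zero _) :=
    (Functor.pi'_eval _ _).trans (dif_neg h1)
  exact congrArg (fun G => G.obj X) h2

theorem isZero_zero {H : Type} [Ring H] {𝓗 : ℤ → AddSubgroup H} : Limits.IsZero (GrMod.zero 𝓗) :=
  have : Subsingleton (GrMod.zero 𝓗).carrier := inferInstanceAs (Subsingleton PUnit)
  GrMod.isZero_of_subsingleton _

theorem isZero_shift_zero {H : Type} [Ring H] {𝓗 : ℤ → AddSubgroup H} (j : ℤ) :
    Limits.IsZero ((GrMod.shift j).obj (GrMod.zero 𝓗)) :=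
  have : Subsingleton ((GrMod.shift j).obj (GrMod.zero 𝓗)).carrier :=
    inferInstanceAs (Subsingleton PUnit)
  GrMod.isZero_of_subsingleton _

/-- The relation v = w + α_i is a partial bijection on weights; at weights without a partner both
functors have a zero component. The inner shift K_i⁻¹ is taken at v, where F_i starts, in agreement
with `card_points`. -/
theorem nonempty_adjunctionE : Nonempty ((functorE hi : TotalCat n k ⥤ TotalCat n k) ⊣
    functorKinv hi ⋙ functorF hi ⋙ functorShift 1) := by
  refine nonempty_adjunction_of_components (r := fun w v : Weight n k => v.1 = w.1 + root hi)
    (fun h h' => Subtype.ext (h.trans h'.symm))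
    (fun h h' => Subtype.ext (add_right_cancel (h.symm.trans h')))
    (fun w v h => stepFunctor hi w v (Or.inl h)) _
    (fun w v h => (nonempty_stepAdjunction hi h).some)
    (fun w v h => functorE_eval hi h) (fun w v h => ?_) (fun v h X => ?_) (fun w h X => ?_)
  · exact congrArg (fun G => functorKinv hi ⋙ G ⋙ GrMod.shift 1) (functorF_eval hi h)
  · rw [functorE_obj_eq_zero hi h]; exact isZero_zero
  · change Limits.IsZero ((GrMod.shift 1).obj ((functorF hi).obj ((functorKinv hi).obj X) w))
    rw [functorF_obj_eq_zero hi h]; exact isZero_shift_zero 1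

theorem nonempty_adjunctionF : Nonempty ((functorF hi : TotalCat n k ⥤ TotalCat n k) ⊣
    functorK hi ⋙ functorE hi ⋙ functorShift 1) := by
  refine nonempty_adjunction_of_components (r := fun v w : Weight n k => v.1 = w.1 + root hi)
    (fun h h' => Subtype.ext (add_right_cancel (h.symm.trans h')))
    (fun h h' => Subtype.ext (h.trans h'.symm))
    (fun v w h => stepFunctor hi v w (Or.inr h)) _
    (fun v w h => (nonempty_stepAdjunction' hi h).some)
    (fun v w h => functorF_eval hi h) (fun v w h => ?_) (fun w h X => ?_) (fun v h X => ?_)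
  · exact congrArg (fun G => functorK hi ⋙ G ⋙ GrMod.shift 1) (functorE_eval hi h)
  · rw [functorF_obj_eq_zero hi h]; exact isZero_zero
  · change Limits.IsZero ((GrMod.shift 1).obj ((functorE hi).obj ((functorK hi).obj X) v))
    rw [functorE_obj_eq_zero hi h]; exact isZero_shift_zero 1

/-- The functors `K_i` and `K_i⁻¹` are adjoint. -/
noncomputable def adjunctionK :
    (functorK hi : TotalCat n k ⥤ TotalCat n k) ⊣ functorKinv hi where
  unit := { app := fun X w => (GrMod.shiftAdjunction _).unit.app (X w) }
  counit := { app := fun X w => (GrMod.shiftAdjunction _).counit.app (X w) }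

end Step

end ArcAlgebra

theorem mainTheorem5 (n k : ℕ) (hk : 1 ≤ k) (hkn : k < n) (i : ℕ) (hi : i + 1 < n) :
    Nonempty ((functorE hi : TotalCat n k ⥤ TotalCat n k) ⊣
      functorKinv hi ⋙ functorF hi ⋙ functorShift 1) ∧
    Nonempty ((functorF hi : TotalCat n k ⥤ TotalCat n k) ⊣
      functorK hi ⋙ functorE hi ⋙ functorShift 1) ∧
    Nonempty ((functorK hi : TotalCat n k ⥤ TotalCat n k) ⊣ functorKinv hi) :=
  ⟨nonempty_adjunctionE hi, nonempty_adjunctionF hi, ⟨adjunctionK hi⟩⟩
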